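/- **Setting.** Fix an arrival rate $\lambda>0$, a threshold $\ell\in\mathbb N=\{0,1,2,\dots\}$ with $h=\ell+1$, and a time horizon $T\in[0,\infty)$. Let $$Q=\{q\in[0,1]^{\mathbb N}: q(i+1)\le q(i)\le q(0)=1 \text{ for all } i\ge 1\}.$$ The following are defined on a common probability space: a Poisson process $\mathcal N_\lambda$ of rate $\lambda$ and unit-rate Poisson processes $\mathcal N_1^i$, $i\ge1$, all independent; i.i.d. random variables $U_j$, $j\ge1$, uniform on $[0,1)$; and, for each $n\ge 1$, a random initial state $q_n(0)$ with values in $\{q\in Q: nq(i)\in\mathbb N \text{ for all } i\}$ and with $\sum_i q_n(0,i)<\infty$ almost surely. The three families (Poisson processes, $(U_j)_j$, initial states) are independent. For $q\in Q$ let $I_i(q)=[1-q(i-1),1-q(i))$ for $i\ge 1$ and, for $1\le i\le \ell$, let $J_i(q,\ell)=\left[\frac{1-q(i-1)}{1-q(\ell)},\frac{1-q(i)}{1-q(\ell)}\right)$ if $q(\ell)<1$ and $J_i(q,\ell)=\emptyset$ if $q(\ell)=1$. For $i,j\ge 1$ put $$r_{ij}(q,\ell)=\begin{cases}\mathbf 1\{U_j\in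 J_i(q,\ell)\} & i\le \ell,\\ \mathbf 1\{q(\ell)=1,\ q(h)<1\} & i=h,\\ \mathbf 1\{q(h)=1,\ U_j\in I_i(q)\} & i>h.\end{cases}$$ Let $\sigma_{nj}$ be the $j$-th jump time of $t\mapsto\mathcal N_\lambda(nt)$. For each $n\ge1$ the occupancy process $q_n$ of the system with $n$ server pools and threshold $\ell$ is the càdlàg, $Q$-valued process on $[0,\infty)$ such that, almost surely, $q_n(t,0)=1$ and, for all $t\ge0$ and $i\ge1$, $$q_n(t,i)=q_n(0,i)+\frac1n\sum_{j=1}^{\mathcal N_\lambda(nt)} r_{ij}\bigl(q_n(\sigma_{nj}^-),\ell\bigr)-\frac1n\,\mathcal N_1^i\!\left(n\int_0^t i\,[q_n(s,i)-q_n(s,i+1)]\,ds\right).$$ Let $D_{\mathbb R^{\mathbb N}}[0,T]$ be the space of càdlàg functions $[0,T]\to\mathbb R^{\mathbb N}$ (product topology), with the metric $$\rho_u^\infty(x,y)=\sup_{t\in[0,T]}\sum_{i=0}^\infty \frac{\min\{|x(t,i)-y(t,i)|,1\}}{2^i}.$$ **Theorem.** Suppose that, with probability one, $q_n(0)\to q(0)$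 in the product topology as $n\to\infty$, for some random element $q(0)$ of $Q$. Then, with probability one, the set of restrictions $\{q_n|_{[0,T]}:n\ge1\}$ is relatively compact in $D_{\mathbb R^{\mathbb N}}[0,T]$ with respect to $\rho_u^\infty$, and the limit of each convergent subsequence is a function $q:[0,T]\to Q$ such that every coordinate $q(\cdot,i)$ is Lipschitz and, for Lebesgue-almost every $t\in[0,T]$, $$\dot q(t,i)=\lambda\,p_i(q(t),\ell)-i\,[q(t,i)-q(t,i+1)]\qquad\text{for all } i\ge1,$$ where, for $q\in Q$ and $i\ge1$, the functions $p_i$ are as follows. (a) If $q(\ell)<1$, then $p_i(q,\ell)=\dfrac{q(i-1)-q(i)}{1-q(\ell)}$ for $1\le i\le\ell$, and $p_i(q,\ell)=0$ for $i\ge h$. (b) If $q(\ell)=1$ and $q(h)<1$, then $p_\ell(q,\ell)=\frac{\ell}{\lambda}[1-q(h)]$ (when $\ell\ge1$), $p_h(q,\ell)=1-\frac{\ell}{\lambda}[1-q(h)]$, and $p_i(q,\ell)=0$ for $i\ne\ell,h$. (c) If $q(h)=1$, then $p_h(q,\ell)=\frac{h}{\lambda}[1-q(h+1)]$, $p_i(q,\ell)=\left[1-\frac{h}{\lambda}(1-q(h+1))\right][q(i-1)-q(i)]$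 for $i\ge h+1$, and $p_i(q,\ell)=0$ for $1\le i\le\ell$. -/

import Mathlib

open MeasureTheory ProbabilityTheory Filter Topology Set
open scoped NNReal

noncomputable section

namespace FluidLimit

/-! ### The path space with the uniform product metric -/

/-- The metric `d(a, b) = ∑ i, min(|a i - b i|, 1) / 2 ^ i` of the product topology on `ℝ^ℕ`. -/
def prodDist (a b : ℕ → ℝ) : ℝ := ∑' i : ℕ, min |a i - b i| 1 / 2 ^ i

theorem prodDist_term_nonneg (a b : ℕ → ℝ) (i : ℕ) : 0 ≤ min |a i - b i| 1 / 2 ^ i := by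
  positivity

theorem prodDist_term_le (a b : ℕ → ℝ) (i : ℕ) :
    min |a i - b i| 1 / 2 ^ i ≤ (1 / 2 : ℝ) ^ i := by
  rw [one_div_pow]
  gcongr
  exact min_le_right _ _

theorem prodDist_summable (a b : ℕ → ℝ) :
    Summable (fun i : ℕ => min |a i - b i| 1 / 2 ^ i) :=
  Summable.of_nonneg_of_le (prodDist_term_nonneg a b) (prodDist_term_le a b)
    summable_geometric_two

theorem prodDist_nonneg (a b : ℕ → ℝ) : 0 ≤ prodDist a b :=
  tsum_nonneg (prodDist_term_nonneg a b)

theorem prodDist_le_two (a b : ℕ → ℝ) : prodDist a b ≤ 2 := by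
  rw [← tsum_geometric_two]
  exact (prodDist_summable a b).tsum_le_tsum (prodDist_term_le a b) summable_geometric_two

theorem prodDist_self (a : ℕ → ℝ) : prodDist a a = 0 := by
  simp [prodDist]

theorem prodDist_comm (a b : ℕ → ℝ) : prodDist a b = prodDist b a := by
  simp only [prodDist, abs_sub_comm]

theorem prodDist_triangle (a b c : ℕ → ℝ) : prodDist a c ≤ prodDist a b + prodDist b c := by
  unfold prodDist
  rw [← (prodDist_summable a b).tsum_add (prodDist_summable b c)]
  refine (prodDist_summable a c).tsum_le_tsum (fun i => ?_)
    ((prodDist_summable a b).add (prodDist_summable b c))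
  rw [← add_div]
  gcongr
  have h : |a i - c i| ≤ |a i - b i| + |b i - c i| := abs_sub_le _ _ _
  have h1 := abs_nonneg (a i - b i)
  have h2 := abs_nonneg (b i - c i)
  rcases le_total |a i - b i| 1 with h3 | h3 <;> rcases le_total |b i - c i| 1 with h4 | h4 <;>
    simp only [min_eq_left, min_eq_right, h3, h4]
  · exact (min_le_left _ _).trans h
  · exact (min_le_right _ _).trans (by linarith)
  · exact (min_le_right _ _).trans (by linarith)
  · exact (min_le_right _ _).trans (by linarith)

theorem eq_of_prodDist_eq_zero {a b : ℕ → ℝ} (h : prodDist a b = 0) : a = b := by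
  funext i
  have h0 : min |a i - b i| 1 / 2 ^ i ≤ 0 := by
    rw [← h]
    exact (prodDist_summable a b).le_tsum i (fun j _ => prodDist_term_nonneg a b j)
  have h1 : min |a i - b i| 1 ≤ 0 := by
    by_contra hc
    push Not at hc
    have : 0 < min |a i - b i| 1 / 2 ^ i := by positivity
    linarith
  rcases min_le_iff.1 h1 with h2 | h2
  · exact sub_eq_zero.1 (abs_nonpos_iff.1 h2)
  · linarith

/-- Càdlàg functions with values in `ℝ^ℕ` (product topology). -/
def IsCadlag {α : Type*} [TopologicalSpace α] [Preorder α] (x : α → ℕ → ℝ) : Prop :=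
  ∀ t, ContinuousWithinAt x (Ici t) t ∧ ∃ l, Tendsto x (𝓝[<] t) (𝓝 l)

/-- The space of all càdlàg functions `[0, T] → ℝ^ℕ`. -/
@[ext]
structure CadlagPath (T : ℝ≥0) where
  toFun : Icc (0 : ℝ) T → ℕ → ℝ
  isCadlag : IsCadlag toFun

/-- The uniform product metric `sup_{t ∈ [0, T]} d(x t, y t)`. -/
def uniformDist {T : ℝ≥0} (x y : CadlagPath T) : ℝ :=
  ⨆ t : Icc (0 : ℝ) T, prodDist (x.toFun t) (y.toFun t)

theorem nonempty_interval (T : ℝ≥0) : Nonempty (Icc (0 : ℝ) T) := ⟨⟨0, le_rfl, T.2⟩⟩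

theorem prodDist_le_uniformDist {T : ℝ≥0} (x y : CadlagPath T) (t : Icc (0 : ℝ) T) :
    prodDist (x.toFun t) (y.toFun t) ≤ uniformDist x y :=
  le_ciSup (f := fun t => prodDist (x.toFun t) (y.toFun t))
    ⟨2, by rintro _ ⟨s, rfl⟩; exact prodDist_le_two _ _⟩ t

instance (T : ℝ≥0) : MetricSpace (CadlagPath T) where
  dist := uniformDist
  dist_self x := by
    have := nonempty_interval T
    simp [uniformDist, prodDist_self]
  dist_comm x y := by simp only [uniformDist, prodDist_comm]
  dist_triangle x y z := by
    have := nonempty_interval T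
    refine ciSup_le fun t => (prodDist_triangle _ (y.toFun t) _).trans ?_
    exact add_le_add (prodDist_le_uniformDist x y t) (prodDist_le_uniformDist y z t)
  eq_of_dist_eq_zero := by
    intro x y h
    ext1
    funext t
    refine eq_of_prodDist_eq_zero (le_antisymm ?_ (prodDist_nonneg _ _))
    exact (prodDist_le_uniformDist x y t).trans (le_of_eq h)

/-- The extension of a path on `[0, T]` to `ℝ` that is constant outside `[0, T]`; only its values
on `[0, T]` and its derivatives in the open interval are of interest. -/
def CadlagPath.extend {T : ℝ≥0} (x : CadlagPath T) : ℝ → ℕ → ℝ :=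
  Set.IccExtend T.2 x.toFun

/-! ### Occupancy states and the dispatching rule -/

/-- Occupancy states: `q i` is the fraction of server pools with at least `i` tasks. -/
def occupancySet : Set (ℕ → ℝ) :=
  {q | q 0 = 1 ∧ ∀ i, q i ∈ Icc (0 : ℝ) 1 ∧ q (i + 1) ≤ q i}

/-- Occupancy states of a system with `n` server pools. -/
def occupancySetN (n : ℕ) : Set (ℕ → ℝ) :=
  {q | q ∈ occupancySet ∧ ∀ i, ∃ m : ℕ, (n : ℝ) * q i = m}

/-- `I_i(q) = [1 - q(i-1), 1 - q(i))`, for `i ≥ 1`. -/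
def intervalI (q : ℕ → ℝ) (i : ℕ) : Set ℝ := Ico (1 - q (i - 1)) (1 - q i)

open Classical in
/-- `J_i(q, ℓ) = [(1 - q(i-1)) / (1 - q(ℓ)), (1 - q(i)) / (1 - q(ℓ)))`, for `1 ≤ i ≤ ℓ`,
which is empty by convention if `q(ℓ) = 1`. -/
def intervalJ (q : ℕ → ℝ) (ℓ i : ℕ) : Set ℝ :=
  if q ℓ < 1 then Ico ((1 - q (i - 1)) / (1 - q ℓ)) ((1 - q i) / (1 - q ℓ)) else ∅

open Classical in
/-- For `i ≥ 1`: whether (`1`) or not (`0`) a task that has selection variable `u`, and that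
finds the occupancy state `q`, is sent to a server pool with exactly `i - 1` tasks. -/
def routing (ℓ : ℕ) (u : ℝ) (q : ℕ → ℝ) (i : ℕ) : ℝ :=
  if i ≤ ℓ then (if u ∈ intervalJ q ℓ i then 1 else 0)
  else if i = ℓ + 1 then (if q ℓ = 1 ∧ q (ℓ + 1) < 1 then 1 else 0)
  else (if q (ℓ + 1) = 1 ∧ u ∈ intervalI q i then 1 else 0)

/-! ### The stochastic system -/

/-- A Poisson process of the given rate. -/
structure IsPoissonProcess {Ω : Type*} [MeasurableSpace Ω] (P : Measure Ω) (rate : ℝ≥0)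
    (N : ℝ≥0 → Ω → ℕ) : Prop where
  measurable : ∀ t, Measurable (N t)
  zero : ∀ᵐ ω ∂P, N 0 ω = 0
  monotone : ∀ᵐ ω ∂P, Monotone (fun t => N t ω)
  rightContinuous : ∀ᵐ ω ∂P, ∀ t, ContinuousWithinAt (fun s => N s ω) (Ici t) t
  indepIncrements : HasIndepIncrements N P
  law : ∀ s t : ℝ≥0, s ≤ t →
    P.map (fun ω => N t ω - N s ω) = poissonMeasure (rate * (t - s))

/-- The stochastic primitives of the systems: a Poisson process `N 0` of rate `lam`, for the
arrivals; Poisson processes `N i`, `i ≥ 1`, of unit rate, for the potential departures from server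
pools with exactly `i` tasks; selection variables `U j`, uniform on `[0, 1)`, where `U j` is used
by the task number `j + 1`; and initial states `qinit n`, for systems with `n` server pools and
finitely many tasks. The Poisson processes are independent of each other, so are the selection
variables, and these two families and the initial states are independent. -/
structure IsPrimitives {Ω : Type*} [MeasurableSpace Ω] (P : Measure Ω) (lam : ℝ≥0)
    (N : ℕ → ℝ≥0 → Ω → ℕ) (U : ℕ → Ω → ℝ) (qinit : ℕ+ → Ω → ℕ → ℝ) : Prop where
  arrivals : IsPoissonProcess P lam (N 0)
  departures : ∀ i, 1 ≤ i → IsPoissonProcess P 1 (N i)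
  selection_measurable : ∀ j, Measurable (U j)
  selection_law : ∀ j, P.map (U j) = volume.restrict (Ico 0 1)
  init_measurable : ∀ n : ℕ+, Measurable (qinit n)
  init_mem : ∀ (n : ℕ+) (ω : Ω), qinit n ω ∈ occupancySetN n
  init_finite : ∀ n : ℕ+, ∀ᵐ ω ∂P, Summable (qinit n ω)
  indep_driving : iIndepFun (fun (i : ℕ) (ω : Ω) (t : ℝ≥0) => N i t ω) P
  indep_selection : iIndepFun U P
  indep_driving_selection :
    IndepFun (fun (ω : Ω) (i : ℕ) (t : ℝ≥0) => N i t ω) (fun (ω : Ω) (j : ℕ) => U j ω) P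
  indep_init :
    IndepFun (fun ω : Ω => ((fun (i : ℕ) (t : ℝ≥0) => N i t ω), (fun j : ℕ => U j ω)))
      (fun (ω : Ω) (n : ℕ+) => qinit n ω) P

/-- The time of the `j`-th jump of a counting path, `j ≥ 1`. -/
def jumpTime (c : ℝ≥0 → ℕ) (j : ℕ) : ℝ≥0 := sInf {t | j ≤ c t}

/-- The scaled number of arrivals, up to time `t`, to server pools with exactly `i - 1` tasks: the
`j`-th task arrives at the `j`-th jump time of `c (n ·)`, where `c` is the path of the arrival
process, and is routed according to the state just before its arrival. -/
def arrivalCount (n ℓ : ℕ) (c : ℝ≥0 → ℕ) (u : ℕ → ℝ) (q : ℝ≥0 → ℕ → ℝ) (t : ℝ≥0) (i : ℕ) : ℝ :=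
  if i = 0 then 0
  else (1 / (n : ℝ)) * ∑ j ∈ Finset.range (c (n * t)),
    routing ℓ (u j) (Function.leftLim q (jumpTime (fun s => c (n * s)) (j + 1))) i

/-- The scaled number of departures, up to time `t`, from server pools with exactly `i` tasks,
where `c i` is the path of the `i`-th potential departure process. -/
def departureCount (n : ℕ) (c : ℕ → ℝ≥0 → ℕ) (q : ℝ≥0 → ℕ → ℝ) (t : ℝ≥0) (i : ℕ) : ℝ :=
  if i = 0 then 0
  else (1 / (n : ℝ)) * (c i (Real.toNNReal
    (n * ∫ s in (0 : ℝ)..t, (i : ℝ) * (q s.toNNReal i - q s.toNNReal (i + 1)))) : ℝ)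

/-- `q` is a càdlàg path of occupancy states that solves, with threshold `ℓ`, the implicit
equations of the system with `n` server pools driven by the given paths. -/
structure IsSystemPath (n ℓ : ℕ) (c : ℕ → ℝ≥0 → ℕ) (u : ℕ → ℝ) (qinit : ℕ → ℝ)
    (q : ℝ≥0 → ℕ → ℝ) : Prop where
  mem : ∀ t, q t ∈ occupancySet
  isCadlag : IsCadlag q
  eq : ∀ t i, q t i = qinit i + arrivalCount n ℓ (c 0) u q t i - departureCount n c q t i

/-! ### The fluid dynamics -/

open Classical in
/-- The functions `p_i(q, ℓ)`, for `i ≥ 1`. -/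
def fluidP (lam : ℝ) (ℓ : ℕ) (q : ℕ → ℝ) (i : ℕ) : ℝ :=
  if q ℓ < 1 then
    if i ≤ ℓ then (q (i - 1) - q i) / (1 - q ℓ) else 0
  else if q (ℓ + 1) < 1 then
    if i = ℓ then (ℓ : ℝ) / lam * (1 - q (ℓ + 1))
    else if i = ℓ + 1 then 1 - (ℓ : ℝ) / lam * (1 - q (ℓ + 1))
    else 0
  else
    if i = ℓ + 1 then ((ℓ : ℝ) + 1) / lam * (1 - q (ℓ + 2))
    else if ℓ + 2 ≤ i then
      (1 - ((ℓ : ℝ) + 1) / lam * (1 - q (ℓ + 2))) * (q (i - 1) - q i)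
    else 0

/-- The fluid dynamics with threshold `ℓ` hold at almost every time in `[0, T]`. -/
def SolvesFluidODE (lam : ℝ) (ℓ : ℕ) (T : ℝ) (q : ℝ → ℕ → ℝ) : Prop :=
  ∀ᵐ t ∂(volume.restrict (Icc 0 T)), ∀ i : ℕ, 1 ≤ i →
    HasDerivAt (fun s => q s i)
      (lam * fluidP lam ℓ (q t) i - (i : ℝ) * (q t i - q t (i + 1))) t

end FluidLimit

end

/-!
The proof is pathwise, on an event of probability one (`IsRegularSample`) that is the outcome of the
only two probabilistic steps.

The first one is the functional law of large numbers for Poisson processes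
(`IsPoissonProcess.isCountingPath`, `IsCountingPath.fslln`).

The second one concerns the selection variables. The fluid rates above the threshold come from the
tasks that find every pool with more than `ℓ` tasks, and one has to know that the selection variables
of these tasks are still asymptotically uniform. The state that a task finds is an explicit measurable
function of the Poisson processes, the initial state and the selection variables of the earlier tasks:
it is read off from the chain of states at the successive events, which is defined by recursion and
which coincides with the given solution of the system equations (`leftLim_eq_preArrivalState`; events
do not accumulate, as only finitely many levels are occupied over a bounded time). Hence whether a task
finds such a state is independent of its selection variable. An exponential moment bound of
Azuma–Hoeffding type and the Borel–Cantelli lemma yield the law of large numbers for the selected tasks,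
uniformly over linear ranges (`ae_eventually_selected_sum_le`, `IsPrimitives.selectionLLN`).

On the event of regular samples each coordinate of the system paths is Lipschitz up to an error that
vanishes as `n → ∞` (`asymptotically_lipschitz`). So, along any nonprincipal ultrafilter, the bounded
coordinates converge pointwise, hence uniformly, and the paths converge in the path space. This gives
relative compactness (`isCompact_closure_range_pathOn`), and it shows that limits are Lipschitz.

Let `Y` be a limit point. The scaled numbers of departures converge to their cumulative intensities
along `Y`, so the scaled numbers of arrivals to each level converge too. So does the scaled number of
tasks that find a saturated state, as these are the tasks that are not sent to the first `ℓ + 1` levels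
(`sum_routing`, `tendsto_saturated`). At a time `t₀` where all the coordinates of `Y` are
differentiable these limits have derivatives. Tasks that arrive shortly after `t₀` find states close
to `Y t₀` (`tendsto_window`), so the law of large numbers for selected tasks determines the rates of
the streams of tasks for which the routing depends continuously on the state (`rate_eq`): the rates of
arrivals to the first `ℓ` levels if `Y t₀ ℓ < 1`, and to the levels above `ℓ + 1` in terms of the rate
of saturated arrivals, while a stream that is empty shortly after `t₀` has rate zero
(`rate_eq_zero`). The other rates follow because a coordinate that equals `1` is at its maximum,
so its derivative is zero and its arrivals balance its departures. This covers all the cases of the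
fluid dynamics (`fluid_dynamics`).
-/

noncomputable section

namespace FluidLimit

/-! ### Counting paths and the law of large numbers for Poisson processes -/

/-- The almost sure properties of a path of a Poisson process of rate `r` on which the pathwise
arguments rely. The law of large numbers is only recorded along integer times. -/
structure IsCountingPath (c : ℝ≥0 → ℕ) (r : ℝ) : Prop where
  zero : c 0 = 0
  mono : Monotone c
  rightContinuous : ∀ t, ContinuousWithinAt c (Ici t) t
  lln : Tendsto (fun k : ℕ => (c k : ℝ) / k) atTop (𝓝 r)

theorem IsCountingPath.exists_le {c : ℝ≥0 → ℕ} {r : ℝ} (hc : IsCountingPath c r) (hr : 0 < r)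
    (m : ℕ) : ∃ t, m ≤ c t := by
  by_contra! h
  have h1 : Tendsto (fun k : ℕ => (c k : ℝ) / k) atTop (𝓝 0) := by
    refine squeeze_zero (fun k => by positivity) (g := fun k : ℕ => (m : ℝ) / k) (fun k => ?_)
      (tendsto_const_div_atTop_nhds_zero_nat _)
    gcongr
    exact (h k).le
  exact hr.ne (tendsto_nhds_unique h1 hc.lln)

theorem eventually_eq_of_rightContinuous {c : ℝ≥0 → ℕ} {t : ℝ≥0}
    (h : ContinuousWithinAt c (Ici t) t) : ∀ᶠ s in 𝓝[≥] t, c s = c t := by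
  have := h.tendsto
  rw [nhds_discrete] at this
  exact tendsto_pure.1 this

theorem jumpTime_le_iff {c : ℝ≥0 → ℕ} (hm : Monotone c)
    (hr : ∀ t, ContinuousWithinAt c (Ici t) t) {m : ℕ} (hu : ∃ t, m ≤ c t) (t : ℝ≥0) :
    jumpTime c m ≤ t ↔ m ≤ c t := by
  have hmem : m ≤ c (jumpTime c m) := by
    by_contra! hlt
    have h1 := eventually_eq_of_rightContinuous (hr (jumpTime c m))
    obtain ⟨u, hu1, hu2⟩ := (mem_nhdsGE_iff_exists_Ico_subset).1 h1
    obtain ⟨s, hs, hsu⟩ := exists_lt_of_csInf_lt (s := {t | m ≤ c t}) hu (b := u) hu1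
    have hs2 : jumpTime c m ≤ s := csInf_le (OrderBot.bddBelow _) hs
    have h3 : c s = c (jumpTime c m) := hu2 ⟨hs2, hsu⟩
    have hs' : m ≤ c s := hs
    omega
  exact ⟨fun h => hmem.trans (hm h), fun h => csInf_le (OrderBot.bddBelow _) h⟩

theorem IsCountingPath.jumpTime_le_iff {c : ℝ≥0 → ℕ} {r : ℝ} (hc : IsCountingPath c r)
    (hr : 0 < r) (m : ℕ) (t : ℝ≥0) : jumpTime c m ≤ t ↔ m ≤ c t :=
  FluidLimit.jumpTime_le_iff hc.mono hc.rightContinuous (hc.exists_le hr m) t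

/-- The jump times of the accelerated path `t ↦ c (n t)`. -/
theorem IsCountingPath.jumpTime_mul_le_iff {c : ℝ≥0 → ℕ} {r : ℝ} (hc : IsCountingPath c r)
    (hr : 0 < r) {n : ℕ} (hn : 0 < n) (m : ℕ) (t : ℝ≥0) :
    jumpTime (fun s => c (n * s)) m ≤ t ↔ m ≤ c (n * t) := by
  have hn' : (n : ℝ≥0) ≠ 0 := by exact_mod_cast hn.ne'
  refine FluidLimit.jumpTime_le_iff (fun a b h => hc.mono (by gcongr)) (fun t => ?_) ?_ t
  · have h1 : ContinuousWithinAt (fun s : ℝ≥0 => (n : ℝ≥0) * s) (Ici t) t :=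
      (continuous_const.mul continuous_id).continuousWithinAt
    exact ContinuousWithinAt.comp (t := Ici ((n : ℝ≥0) * t)) (hc.rightContinuous _) h1
      (fun s hs => mul_le_mul_right (show t ≤ s from hs) _)
  · obtain ⟨t, ht⟩ := hc.exists_le hr m
    exact ⟨t / n, by simpa [mul_div_cancel₀ _ hn'] using ht⟩

/-- The law of large numbers along integers, in a form that is uniform over the integers. -/
theorem IsCountingPath.exists_nat_bound {c : ℝ≥0 → ℕ} {r : ℝ} (hc : IsCountingPath c r) {ε : ℝ}
    (hε : 0 < ε) : ∃ C : ℝ, 0 ≤ C ∧ ∀ k : ℕ, |(c k : ℝ) - r * k| ≤ ε * k + C := by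
  have h1 := (Metric.tendsto_atTop.1 hc.lln) ε hε
  obtain ⟨M, hM⟩ := h1
  refine ⟨∑ k ∈ Finset.range (M + 1), |(c k : ℝ) - r * k|, by positivity, fun k => ?_⟩
  rcases le_or_gt k M with hk | hk
  · have : |(c k : ℝ) - r * k| ≤ ∑ k ∈ Finset.range (M + 1), |(c k : ℝ) - r * k| :=
      Finset.single_le_sum (f := fun k : ℕ => |(c k : ℝ) - r * k|) (fun i _ => abs_nonneg _)
        (Finset.mem_range.2 (by omega))
    have h0 : 0 ≤ ε * k := by positivity
    linarith
  · have hk0 : (0 : ℝ) < k := by exact_mod_cast (by omega : 0 < k)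
    have h2 := hM k hk.le
    rw [Real.dist_eq] at h2
    have h3 : (c k : ℝ) - r * k = (c k / k - r) * k := by field_simp
    rw [h3, abs_mul, abs_of_pos hk0]
    have h4 : 0 ≤ ∑ k ∈ Finset.range (M + 1), |(c k : ℝ) - r * k| := by positivity
    nlinarith

/-- The functional law of large numbers: the scaled path `t ↦ c (n t) / n` converges to
`t ↦ r t`, uniformly over compact sets. -/
theorem IsCountingPath.fslln {c : ℝ≥0 → ℕ} {r : ℝ} (hc : IsCountingPath c r) (hr : 0 ≤ r)
    (K : ℝ≥0) {ε : ℝ} (hε : 0 < ε) :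
    ∀ᶠ n : ℕ+ in atTop, ∀ t ≤ K, |(c ((n : ℕ) * t) : ℝ) / (n : ℕ) - r * t| ≤ ε := by
  obtain ⟨C, hC0, hC⟩ := hc.exists_nat_bound (ε := ε / (2 * (K + 1))) (by positivity)
  have hlarge : ∀ᶠ n : ℕ+ in atTop, ε + C + r ≤ ε / 2 * ((n : ℕ) : ℝ) := by
    have h1 : Tendsto (fun n : ℕ+ => ε / 2 * ((n : ℕ) : ℝ)) atTop atTop := by
      refine Tendsto.const_mul_atTop (by positivity) ?_
      exact tendsto_natCast_atTop_atTop.comp tendsto_PNat_val_atTop_atTop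
    exact h1.eventually_ge_atTop _
  filter_upwards [hlarge] with n hn t ht
  have hn0 : (0 : ℝ) < ((n : ℕ) : ℝ) := by exact_mod_cast n.pos
  have hn1 : (1 : ℝ) ≤ ((n : ℕ) : ℝ) := by exact_mod_cast n.pos
  set s : ℝ≥0 := (n : ℕ) * t with hs
  have hsr : (s : ℝ) = (n : ℕ) * (t : ℝ) := by simp [hs]
  have hf1 : ((⌊s⌋₊ : ℕ) : ℝ≥0) ≤ s := Nat.floor_le zero_le
  have hf2 : s ≤ ((⌊s⌋₊ + 1 : ℕ) : ℝ≥0) := by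
    push_cast; exact (Nat.lt_floor_add_one s).le
  have hf1' : ((⌊s⌋₊ : ℕ) : ℝ) ≤ s := by exact_mod_cast hf1
  have hf2' : (s : ℝ) ≤ (⌊s⌋₊ : ℕ) + 1 := by exact_mod_cast hf2
  have hc1 : (c (⌊s⌋₊ : ℕ) : ℝ) ≤ c s := by exact_mod_cast hc.mono hf1
  have hc2 : (c s : ℝ) ≤ c ((⌊s⌋₊ + 1 : ℕ) : ℝ≥0) := by exact_mod_cast hc.mono hf2
  have hb1 := abs_le.1 (hC ⌊s⌋₊)
  have hb2 := abs_le.1 (hC (⌊s⌋₊ + 1))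
  have htK : (t : ℝ) ≤ K := by exact_mod_cast ht
  have hK0 : (0 : ℝ) ≤ K := K.2
  set e := ε / (2 * ((K : ℝ) + 1)) with he
  have he0 : 0 < e := by positivity
  have heK : e * (K + 1) = ε / 2 := by rw [he]; field_simp
  have hnK : (s : ℝ) ≤ (n : ℕ) * K := by rw [hsr]; gcongr
  have hee : e ≤ ε / 2 := by nlinarith
  have hen : e * (⌊s⌋₊ : ℕ) + e ≤ ε / 2 * (n : ℕ) + e := by
    have : e * (⌊s⌋₊ : ℕ) ≤ e * ((n : ℕ) * K) := by gcongr; linarith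
    have : e * ((n : ℕ) * K) ≤ e * (K + 1) * (n : ℕ) := by nlinarith
    rw [heK] at this
    linarith
  have key : |(c s : ℝ) - r * s| ≤ ε * (n : ℕ) := by
    push_cast at hb1 hb2 hc2
    have hr1 : r * (⌊s⌋₊ : ℕ) ≤ r * s := by gcongr
    have hr2 : r * s ≤ r * ((⌊s⌋₊ : ℕ) + 1) := by gcongr
    rw [abs_le]
    constructor <;> nlinarith
  have : (c s : ℝ) / (n : ℕ) - r * t = (c s - r * s) / (n : ℕ) := by
    rw [hsr]; field_simp
  rw [this, abs_div, abs_of_pos hn0, div_le_iff₀ hn0]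
  exact key

theorem hasSum_poisson_mean (r : ℝ≥0) :
    HasSum (fun k : ℕ => Real.exp (-r) * r ^ k / k.factorial * (k : ℝ)) r := by
  rw [← hasSum_nat_add_iff' 1]
  have h := (hasSum_one_poissonMeasure r).mul_left (r : ℝ)
  simp only [mul_one] at h
  simp only [Finset.range_one, Finset.sum_singleton, Nat.cast_zero, mul_zero, sub_zero]
  refine h.congr_fun fun k => ?_
  rw [Nat.factorial_succ]
  push_cast
  field_simp
  ring

theorem integrable_poissonMeasure_cast (r : ℝ≥0) :
    Integrable (fun k : ℕ => (k : ℝ)) (poissonMeasure r) := by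
  rw [integrable_poissonMeasure_iff]
  simpa using (hasSum_poisson_mean r).summable

theorem integral_poissonMeasure_cast (r : ℝ≥0) : ∫ k : ℕ, (k : ℝ) ∂poissonMeasure r = r := by
  rw [integral_poissonMeasure' (integrable_poissonMeasure_cast r)]
  simpa using (hasSum_poisson_mean r).tsum_eq

/-- The strong law of large numbers for the increments of a Poisson process over the intervals
between consecutive integers. -/
theorem IsPoissonProcess.isCountingPath {Ω : Type*} [MeasurableSpace Ω] {P : Measure Ω}
    {rate : ℝ≥0} {N : ℝ≥0 → Ω → ℕ} (hN : IsPoissonProcess P rate N) :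
    ∀ᵐ ω ∂P, IsCountingPath (fun t => N t ω) rate := by
  set X : ℕ → Ω → ℕ := fun k ω => N ((k + 1 : ℕ) : ℝ≥0) ω - N (k : ℝ≥0) ω with hX
  have hXm : ∀ k, Measurable (X k) := fun k => (hN.measurable _).sub (hN.measurable _)
  have hXlaw : ∀ k, P.map (X k) = poissonMeasure rate := by
    intro k
    have h := hN.law (k : ℝ≥0) ((k + 1 : ℕ) : ℝ≥0) (by push_cast; simp)
    rw [hX]
    simp only
    rw [h]
    congr 1
    push_cast
    simp
  have hcast : Measurable (fun k : ℕ => (k : ℝ)) := measurable_from_top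
  have hint : Integrable (fun ω => (X 0 ω : ℝ)) P := by
    have := integrable_poissonMeasure_cast rate
    rw [← hXlaw 0] at this
    exact (integrable_map_measure hcast.aestronglyMeasurable (hXm 0).aemeasurable).1 this
  have hmean : ∫ ω, (X 0 ω : ℝ) ∂P = rate := by
    rw [← integral_poissonMeasure_cast rate, ← hXlaw 0,
      integral_map (hXm 0).aemeasurable hcast.aestronglyMeasurable]
  have hlt : ∀ i j : ℕ, i < j → IndepFun (X i) (X j) P := by
    intro i j hij
    have h := hN.indepIncrements.nat (t := fun k : ℕ => (k : ℝ≥0))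
      (fun a b h => Nat.cast_le.2 h)
    exact h.indepFun hij.ne
  have hpair : Pairwise (fun i j => IndepFun (fun ω => (X i ω : ℝ)) (fun ω => (X j ω : ℝ)) P) := by
    intro i j hij
    rcases lt_or_gt_of_ne hij with h | h
    · exact (hlt i j h).comp hcast hcast
    · exact ((hlt j i h).symm).comp hcast hcast
  have hid : ∀ i, IdentDistrib (fun ω => (X i ω : ℝ)) (fun ω => (X 0 ω : ℝ)) P P := by
    intro i
    have : IdentDistrib (X i) (X 0) P P :=
      ⟨(hXm i).aemeasurable, (hXm 0).aemeasurable, by rw [hXlaw, hXlaw]⟩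
    exact this.comp hcast
  have hslln := strong_law_ae_real (fun k ω => (X k ω : ℝ)) hint hpair hid
  filter_upwards [hslln, hN.zero, hN.monotone, hN.rightContinuous] with ω h1 h2 h3 h4
  refine ⟨h2, h3, h4, ?_⟩
  rw [hmean] at h1
  refine h1.congr fun k => ?_
  congr 1
  have hk : ∀ i, (X i ω : ℝ) = (N ((i + 1 : ℕ) : ℝ≥0) ω : ℝ) - N (i : ℝ≥0) ω := by
    intro i
    have : N (i : ℝ≥0) ω ≤ N ((i + 1 : ℕ) : ℝ≥0) ω := h3 (by push_cast; simp)
    simp only [hX]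
    rw [Nat.cast_sub this]
  simp only [hk]
  rw [Finset.sum_range_sub (fun i : ℕ => (N (i : ℝ≥0) ω : ℝ))]
  simp [h2]

/-! ### Occupancy states and routing decisions -/

theorem occupancy_antitone {q : ℕ → ℝ} (hq : q ∈ occupancySet) : Antitone q :=
  antitone_nat_of_succ_le fun i => (hq.2 i).2

theorem occupancy_nonneg {q : ℕ → ℝ} (hq : q ∈ occupancySet) (i : ℕ) : 0 ≤ q i := (hq.2 i).1.1

theorem occupancy_le_one {q : ℕ → ℝ} (hq : q ∈ occupancySet) (i : ℕ) : q i ≤ 1 := (hq.2 i).1.2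

theorem isClosed_occupancySet : IsClosed occupancySet := by
  have h : occupancySet = {q : ℕ → ℝ | q 0 = 1} ∩
      ⋂ i, ({q : ℕ → ℝ | q i ∈ Icc (0 : ℝ) 1} ∩ {q : ℕ → ℝ | q (i + 1) ≤ q i}) := by
    ext q
    simp [occupancySet]
  rw [h]
  refine (isClosed_eq (continuous_apply 0) continuous_const).inter (isClosed_iInter fun i => ?_)
  exact (isClosed_Icc.preimage (continuous_apply i)).inter
    (isClosed_le (continuous_apply _) (continuous_apply _))

/-- Left limits of a path stay in any closed set that contains the path. Where there is no left limit
`Function.leftLim` takes a value of the path, so that this holds there as well. -/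
theorem leftLim_mem {β : Type*} [TopologicalSpace β] {q : ℝ≥0 → β} {s : Set β}
    (hs : IsClosed s) (t : ℝ≥0) (h0 : q t ∈ s) (h : ∀ᶠ r in 𝓝[<] t, q r ∈ s) :
    Function.leftLim q t ∈ s := by
  by_cases hb : 𝓝[<] t = ⊥
  · rwa [leftLim_eq_of_eq_bot _ hb]
  by_cases hl : ∃ y, Tendsto q (𝓝[<] t) (𝓝 y)
  · have : (𝓝[<] t).NeBot := ⟨hb⟩
    exact hs.mem_of_tendsto (tendsto_leftLim_of_tendsto hl) h
  · rwa [leftLim_eq_of_not_tendsto _ hl]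

theorem routing_eq_zero_or_one (ℓ : ℕ) (u : ℝ) (q : ℕ → ℝ) (i : ℕ) :
    routing ℓ u q i = 0 ∨ routing ℓ u q i = 1 := by
  unfold routing
  split_ifs <;> simp

theorem routing_nonneg (ℓ : ℕ) (u : ℝ) (q : ℕ → ℝ) (i : ℕ) : 0 ≤ routing ℓ u q i := by
  rcases routing_eq_zero_or_one ℓ u q i with h | h <;> simp [h]

theorem routing_le_one (ℓ : ℕ) (u : ℝ) (q : ℕ → ℝ) (i : ℕ) : routing ℓ u q i ≤ 1 := by
  rcases routing_eq_zero_or_one ℓ u q i with h | h <;> simp [h]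

/-- Above the threshold at most one of the disjoint intervals `I_i(q)` contains the selection
variable, so that a task can only be sent to boundedly many levels. -/
theorem routing_eventually_zero (ℓ : ℕ) (u : ℝ) {q : ℕ → ℝ} (hq : q ∈ occupancySet) :
    ∃ I, ∀ i, I < i → routing ℓ u q i = 0 := by
  by_cases h : ∃ i, ℓ + 1 < i ∧ u ∈ intervalI q i
  · obtain ⟨i, hi, hu⟩ := h
    refine ⟨i, fun i' hi' => ?_⟩
    have hnot : u ∉ intervalI q i' := by
      intro hu'
      have h1 := hu.2
      have h2 := hu'.1
      have h3 := occupancy_antitone hq (show i ≤ i' - 1 by omega)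
      linarith
    simp [routing, show ¬ i' ≤ ℓ by omega, show i' ≠ ℓ + 1 by omega, hnot]
  · push Not at h
    refine ⟨ℓ + 1, fun i hi => ?_⟩
    simp [routing, show ¬ i ≤ ℓ by omega, show i ≠ ℓ + 1 by omega, h i hi]

open Classical in
/-- A telescoping sum over consecutive intervals: the indicators of the intervals
`[f (i - 1), f i)` with `1 ≤ i ≤ m` add up to the indicator of `[f 0, f m)`. -/
theorem sum_indicator_Ico {f : ℕ → ℝ} (hf : Monotone f) (u : ℝ) (m : ℕ) :
    ∑ i ∈ Finset.Icc 1 m, (if u ∈ Ico (f (i - 1)) (f i) then (1 : ℝ) else 0)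
      = if u ∈ Ico (f 0) (f m) then 1 else 0 := by
  induction m with
  | zero => simp
  | succ m ih =>
    rw [Finset.sum_Icc_succ_top (by omega), ih]
    have h0 := hf (Nat.zero_le m)
    have h1 := hf (Nat.le_succ m)
    simp only [mem_Ico, Nat.add_sub_cancel]
    rcases lt_or_ge u (f m) with h | h
    · have h' := h.trans_le h1
      simp [h, h', not_le.2 h]
    · have h' := h0.trans h
      simp [h, h', not_lt.2 h]

open Classical in
/-- A task is routed to a pool with at most `ℓ` tasks unless it finds all the pools with more than
`ℓ` tasks. -/
theorem sum_routing {ℓ : ℕ} {u : ℝ} (hu : u ∈ Ico (0 : ℝ) 1) {q : ℕ → ℝ}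
    (hq : q ∈ occupancySet) :
    ∑ i ∈ Finset.Icc 1 (ℓ + 1), routing ℓ u q i = if q (ℓ + 1) = 1 then 0 else 1 := by
  rw [Finset.sum_Icc_succ_top (by omega)]
  have hlast : routing ℓ u q (ℓ + 1) = if q ℓ = 1 ∧ q (ℓ + 1) < 1 then 1 else 0 := by
    simp [routing]
  have hsum : ∑ i ∈ Finset.Icc 1 ℓ, routing ℓ u q i = if q ℓ < 1 then 1 else 0 := by
    by_cases hℓ : q ℓ < 1
    · have h1 : 0 < 1 - q ℓ := by linarith
      have hmono : Monotone fun i => (1 - q i) / (1 - q ℓ) := by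
        intro a b hab
        have := occupancy_antitone hq hab
        dsimp only
        gcongr
      have h2 := sum_indicator_Ico hmono u ℓ
      rw [div_self h1.ne', hq.1] at h2
      simp only [sub_self, zero_div, hu, if_true] at h2
      rw [if_pos hℓ, ← h2]
      refine Finset.sum_congr rfl fun i hi => ?_
      simp [routing, intervalJ, (Finset.mem_Icc.1 hi).2, hℓ]
    · rw [if_neg hℓ]
      refine Finset.sum_eq_zero fun i hi => ?_
      simp [routing, intervalJ, (Finset.mem_Icc.1 hi).2, hℓ]
  rw [hlast, hsum]
  have h3 := occupancy_antitone hq (Nat.le_succ ℓ)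
  have h4 := occupancy_le_one hq ℓ
  have h5 := occupancy_le_one hq (ℓ + 1)
  rcases h4.lt_or_eq with h | h
  · have : q (ℓ + 1) ≠ 1 := by intro h'; linarith [show q (ℓ + 1) ≤ q ℓ from h3]
    simp [h, h.ne, this]
  · rcases h5.lt_or_eq with h' | h'
    · simp [h, h', h'.ne]
    · simp [h, h']

/-! ### Pathwise facts about system paths -/

theorem measurable_of_rightContinuous {f : ℝ → ℝ} (hf : ∀ t, ContinuousWithinAt f (Ici t) t) :
    Measurable f := by
  -- `f` is the limit of its values at grid points that approach the argument from the right
  refine measurable_of_tendsto_metrizable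
    (f := fun (k : ℕ) (t : ℝ) => f ((⌊((k : ℝ) + 1) * t⌋ + 1 : ℝ) / ((k : ℝ) + 1))) (fun k => ?_) ?_
  · have h1 : Measurable fun z : ℤ => f (((z : ℝ) + 1) / ((k : ℝ) + 1)) := measurable_from_top
    exact h1.comp (Int.measurable_floor.comp (measurable_const.mul measurable_id))
  · rw [tendsto_pi_nhds]
    intro t
    refine (hf t).tendsto.comp (tendsto_nhdsWithin_iff.2 ⟨?_, Eventually.of_forall fun k => ?_⟩)
    · have h2 : Tendsto (fun k : ℕ => t + 1 / ((k : ℝ) + 1)) atTop (𝓝 (t + 0)) :=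
        tendsto_const_nhds.add tendsto_one_div_add_atTop_nhds_zero_nat
      rw [add_zero] at h2
      refine tendsto_of_tendsto_of_tendsto_of_le_of_le tendsto_const_nhds h2 (fun k => ?_)
        (fun k => ?_)
      · have hk : (0 : ℝ) < (k : ℝ) + 1 := by positivity
        have := Int.lt_floor_add_one (((k : ℝ) + 1) * t)
        dsimp only
        rw [le_div_iff₀ hk]
        linarith
      · have hk : (0 : ℝ) < (k : ℝ) + 1 := by positivity
        have := Int.floor_le (((k : ℝ) + 1) * t)
        dsimp only
        have h3 : (t + 1 / ((k : ℝ) + 1)) * ((k : ℝ) + 1) = ((k : ℝ) + 1) * t + 1 := by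
          field_simp
        rw [div_le_iff₀ hk, h3]
        linarith
    · have hk : (0 : ℝ) < (k : ℝ) + 1 := by positivity
      have := Int.lt_floor_add_one (((k : ℝ) + 1) * t)
      rw [mem_Ici, le_div_iff₀ hk]
      linarith

theorem IsCadlag.measurable_coord {q : ℝ≥0 → ℕ → ℝ} (hq : IsCadlag q) (i : ℕ) :
    Measurable fun s : ℝ => q s.toNNReal i := by
  refine measurable_of_rightContinuous fun t => ?_
  have h1 : ContinuousWithinAt (fun s : ℝ≥0 => q s i) (Ici t.toNNReal) t.toNNReal :=
    ((continuous_apply i).continuousAt).comp_continuousWithinAt (hq _).1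
  exact h1.comp continuous_real_toNNReal.continuousWithinAt fun s hs =>
    Real.toNNReal_le_toNNReal hs

/-- The departure rate `i (q_i - q_{i+1})` is integrable along a path of occupancy states. -/
theorem intervalIntegrable_departureRate {q : ℝ≥0 → ℕ → ℝ} (hq : IsCadlag q)
    (hmem : ∀ t, q t ∈ occupancySet) (i : ℕ) (a b : ℝ) :
    IntervalIntegrable (fun s : ℝ => (i : ℝ) * (q s.toNNReal i - q s.toNNReal (i + 1)))
      volume a b := by
  have hm : Measurable fun s : ℝ => (i : ℝ) * (q s.toNNReal i - q s.toNNReal (i + 1)) :=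
    measurable_const.mul ((hq.measurable_coord i).sub (hq.measurable_coord (i + 1)))
  refine (intervalIntegrable_const (c := (i : ℝ))).mono_fun hm.aestronglyMeasurable ?_
  refine Eventually.of_forall fun s => ?_
  have h1 := occupancy_nonneg (hmem s.toNNReal) (i + 1)
  have h2 := occupancy_le_one (hmem s.toNNReal) i
  have h3 := ((hmem s.toNNReal).2 i).2
  dsimp only
  rw [Real.norm_eq_abs, Real.norm_eq_abs, abs_mul,
    abs_of_nonneg (by linarith : 0 ≤ q s.toNNReal i - q s.toNNReal (i + 1))]
  have := abs_nonneg (i : ℝ)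
  nlinarith

/-- The internal clocks of a system path: the argument at which the driving counting path `c i` is
read at time `t`. Clock `0` belongs to the arrivals. -/
def internalClock (n : ℕ) (q : ℝ≥0 → ℕ → ℝ) (i : ℕ) (t : ℝ≥0) : ℝ :=
  if i = 0 then n * t
  else n * ∫ s in (0 : ℝ)..t, (i : ℝ) * (q s.toNNReal i - q s.toNNReal (i + 1))

/-- The rates at which the internal clocks run while the state is `z`. -/
def eventRate (n : ℕ) (z : ℕ → ℝ) (i : ℕ) : ℝ :=
  if i = 0 then n else n * (i * (z i - z (i + 1)))

theorem eventRate_nonneg (n : ℕ) {z : ℕ → ℝ} (hz : z ∈ occupancySet) (i : ℕ) :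
    0 ≤ eventRate n z i := by
  unfold eventRate
  split_ifs
  · positivity
  · have := (hz.2 i).2
    have : 0 ≤ z i - z (i + 1) := by linarith
    positivity

/-- The pathwise setting for one system: the driving paths are regular, the initial state is on the
grid and has finitely many tasks, and `q` solves the system equations. -/
structure IsDrivenPath (n ℓ : ℕ) (lam : ℝ) (c : ℕ → ℝ≥0 → ℕ) (u : ℕ → ℝ) (z₀ : ℕ → ℝ)
    (q : ℝ≥0 → ℕ → ℝ) : Prop where
  n_pos : 0 < n
  lam_pos : 0 < lam
  arrivals : IsCountingPath (c 0) lam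
  departures : ∀ i, 1 ≤ i → IsCountingPath (c i) 1
  init_mem : z₀ ∈ occupancySetN n
  init_summable : Summable z₀
  path : IsSystemPath n ℓ c u z₀ q

namespace IsDrivenPath

variable {n ℓ : ℕ} {lam : ℝ} {c : ℕ → ℝ≥0 → ℕ} {u : ℕ → ℝ} {z₀ : ℕ → ℝ} {q : ℝ≥0 → ℕ → ℝ}

theorem counting (h : IsDrivenPath n ℓ lam c u z₀ q) (i : ℕ) :
    ∃ r : ℝ, 0 < r ∧ IsCountingPath (c i) r := by
  rcases Nat.eq_zero_or_pos i with rfl | hi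
  · exact ⟨lam, h.lam_pos, h.arrivals⟩
  · exact ⟨1, one_pos, h.departures i hi⟩

theorem mono (h : IsDrivenPath n ℓ lam c u z₀ q) (i : ℕ) : Monotone (c i) := by
  obtain ⟨r, _, hr⟩ := h.counting i
  exact hr.mono

theorem jumpTime_le_iff (h : IsDrivenPath n ℓ lam c u z₀ q) (i m : ℕ) (t : ℝ≥0) :
    jumpTime (c i) m ≤ t ↔ m ≤ c i t := by
  obtain ⟨r, h0, hr⟩ := h.counting i
  exact hr.jumpTime_le_iff h0 m t

theorem clock_sub (h : IsDrivenPath n ℓ lam c u z₀ q) {i : ℕ} (hi : i ≠ 0) (s t : ℝ≥0) :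
    internalClock n q i t - internalClock n q i s
      = n * ∫ r in (s : ℝ)..t, (i : ℝ) * (q r.toNNReal i - q r.toNNReal (i + 1)) := by
  have hint := intervalIntegrable_departureRate h.path.isCadlag h.path.mem i
  simp only [internalClock, if_neg hi]
  rw [← mul_sub, intervalIntegral.integral_interval_sub_left (hint _ _) (hint _ _)]

theorem clock_zero (i : ℕ) : internalClock n q i 0 = 0 := by
  simp [internalClock]

theorem clock_sub_nonneg (h : IsDrivenPath n ℓ lam c u z₀ q) (i : ℕ) {s t : ℝ≥0} (hst : s ≤ t) :
    0 ≤ internalClock n q i t - internalClock n q i s := by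
  have hst' : (s : ℝ) ≤ t := hst
  by_cases hi : i = 0
  · have hn : (0 : ℝ) ≤ n := by positivity
    simp only [internalClock, if_pos hi]
    nlinarith
  · rw [h.clock_sub hi]
    refine mul_nonneg (by positivity) (intervalIntegral.integral_nonneg hst' fun r _ => ?_)
    have := ((h.path.mem r.toNNReal).2 i).2
    have : 0 ≤ q r.toNNReal i - q r.toNNReal (i + 1) := by linarith
    positivity

theorem clock_sub_le (h : IsDrivenPath n ℓ lam c u z₀ q) {i : ℕ} (hi : i ≠ 0) {s t : ℝ≥0}
    (hst : s ≤ t) :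
    internalClock n q i t - internalClock n q i s ≤ n * (i * (t - s)) := by
  have hst' : (s : ℝ) ≤ t := hst
  rw [h.clock_sub hi]
  gcongr
  have hint := intervalIntegrable_departureRate h.path.isCadlag h.path.mem i
  calc _ ≤ ∫ r in (s : ℝ)..t, (i : ℝ) := by
        refine intervalIntegral.integral_mono_on hst' (hint _ _) (by simp) fun r _ => ?_
        have h1 := occupancy_nonneg (h.path.mem r.toNNReal) (i + 1)
        have h2 := occupancy_le_one (h.path.mem r.toNNReal) i
        have h3 : (0 : ℝ) ≤ i := by positivity
        nlinarith
    _ = i * (t - s) := by simp; ring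

theorem clock_mono (h : IsDrivenPath n ℓ lam c u z₀ q) (i : ℕ) :
    Monotone (internalClock n q i) := fun _ _ hst => by
  linarith [h.clock_sub_nonneg i hst]

theorem clock_nonneg (h : IsDrivenPath n ℓ lam c u z₀ q) (i : ℕ) (t : ℝ≥0) :
    0 ≤ internalClock n q i t := by
  have := h.clock_mono i (zero_le (a := t))
  rwa [clock_zero] at this

theorem clock_continuous (h : IsDrivenPath n ℓ lam c u z₀ q) (i : ℕ) :
    Continuous (internalClock n q i) := by
  by_cases hi : i = 0
  · have : internalClock n q i = fun t : ℝ≥0 => (n : ℝ) * (t : ℝ) := by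
      funext t
      simp [internalClock, hi]
    rw [this]
    exact continuous_const.mul NNReal.continuous_coe
  · have hl : LipschitzWith ((n : ℝ≥0) * i) (internalClock n q i) := by
      refine LipschitzWith.of_dist_le_mul fun s t => ?_
      rw [Real.dist_eq, NNReal.dist_eq]
      push_cast
      rcases le_total s t with hst | hst
      · have h1 := h.clock_sub_nonneg i hst
        have h2 := h.clock_sub_le hi hst
        have hst' : (s : ℝ) ≤ t := hst
        rw [abs_sub_comm, abs_of_nonneg h1, abs_sub_comm, abs_of_nonneg (by linarith)]
        linarith
      · have h1 := h.clock_sub_nonneg i hst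
        have h2 := h.clock_sub_le hi hst
        have hst' : (t : ℝ) ≤ s := hst
        rw [abs_of_nonneg h1, abs_of_nonneg (by linarith)]
        linarith
    exact hl.continuous

/-- While the state is constant, the internal clocks run at the constant rates `eventRate`. -/
theorem clock_eq_of_const (h : IsDrivenPath n ℓ lam c u z₀ q) (i : ℕ) {s t : ℝ≥0} (hst : s ≤ t)
    {z : ℕ → ℝ} (hz : ∀ r, s ≤ r → r < t → q r = z) :
    internalClock n q i t = internalClock n q i s + eventRate n z i * (t - s) := by
  have hst' : (s : ℝ) ≤ t := hst
  by_cases hi : i = 0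
  · simp only [internalClock, eventRate, if_pos hi]
    ring
  · have h1 := h.clock_sub hi s t
    have h2 : ∫ r in (s : ℝ)..t, (i : ℝ) * (q r.toNNReal i - q r.toNNReal (i + 1))
        = ∫ r in (s : ℝ)..t, (i : ℝ) * (z i - z (i + 1)) := by
      refine intervalIntegral.integral_congr_ae ?_
      have hne : ∀ᵐ r : ℝ, r ≠ t := by
        simp [ae_iff, measure_singleton]
      filter_upwards [hne] with r hr hmem
      rw [uIoc_of_le hst'] at hmem
      have hr0 : 0 ≤ r := s.2.trans hmem.1.le
      rw [hz r.toNNReal]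
      · rw [← NNReal.coe_le_coe, Real.coe_toNNReal _ hr0]; exact hmem.1.le
      · rw [← NNReal.coe_lt_coe, Real.coe_toNNReal _ hr0]; exact lt_of_le_of_ne hmem.2 hr
    rw [h2] at h1
    simp only [intervalIntegral.integral_const, smul_eq_mul] at h1
    simp only [eventRate, if_neg hi]
    linarith

/-- The system equations in terms of the internal clocks. -/
theorem eq_apply (h : IsDrivenPath n ℓ lam c u z₀ q) (t : ℝ≥0) {i : ℕ} (hi : i ≠ 0) :
    q t i = z₀ i + (1 / (n : ℝ)) * ∑ j ∈ Finset.range (c 0 (internalClock n q 0 t).toNNReal),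
        routing ℓ (u j) (Function.leftLim q (jumpTime (fun s => c 0 (n * s)) (j + 1))) i
      - (1 / (n : ℝ)) * c i (internalClock n q i t).toNNReal := by
  have h0 : (internalClock n q 0 t).toNNReal = n * t := by
    simp [internalClock, Real.toNNReal_mul]
  rw [h.path.eq t i, h0]
  simp [arrivalCount, departureCount, internalClock, hi]

/-- The state only changes when one of the driving paths jumps. -/
theorem eq_of_count_eq (h : IsDrivenPath n ℓ lam c u z₀ q) {s t : ℝ≥0}
    (hst : ∀ i, c i (internalClock n q i t).toNNReal = c i (internalClock n q i s).toNNReal) :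
    q t = q s := by
  funext i
  by_cases hi : i = 0
  · subst hi
    rw [(h.path.mem t).1, (h.path.mem s).1]
  · rw [h.eq_apply t hi, h.eq_apply s hi, hst 0, hst i]

theorem leftLim_mem_occupancySet (h : IsDrivenPath n ℓ lam c u z₀ q) (t : ℝ≥0) :
    Function.leftLim q t ∈ occupancySet :=
  leftLim_mem isClosed_occupancySet t (h.path.mem t) (Eventually.of_forall h.path.mem)

/-- Over a bounded time horizon only finitely many levels are ever occupied. -/
theorem exists_level_bound (h : IsDrivenPath n ℓ lam c u z₀ q) (S : ℝ≥0) :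
    ∃ I, ∀ s ≤ S, ∀ i, I < i → q s i = 0 := by
  have hn : (0 : ℝ) < n := by exact_mod_cast h.n_pos
  -- the initial values are multiples of `1 / n` that tend to zero, so all but finitely many vanish
  have h1 : ∀ᶠ i in atTop, z₀ i = 0 := by
    have h2 := h.init_summable.tendsto_atTop_zero
    filter_upwards [h2.eventually_lt_const (show (0 : ℝ) < 1 / n by positivity)] with i hi
    obtain ⟨m, hm⟩ := h.init_mem.2 i
    rw [lt_div_iff₀ hn, mul_comm, hm] at hi
    have hm0 : m = 0 := by
      have : m < 1 := by exact_mod_cast hi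
      omega
    rw [hm0] at hm
    simpa [hn.ne'] using hm
  obtain ⟨I₀, hI₀⟩ := eventually_atTop.1 h1
  choose F hF using fun j => routing_eventually_zero ℓ (u j)
    (h.leftLim_mem_occupancySet (jumpTime (fun s => c 0 (n * s)) (j + 1)))
  refine ⟨I₀ + ∑ j ∈ Finset.range (c 0 (internalClock n q 0 S).toNNReal), F j,
    fun s hs i hi => ?_⟩
  refine le_antisymm ?_ (occupancy_nonneg (h.path.mem s) i)
  rw [h.eq_apply s (by omega), hI₀ i (by omega), Finset.sum_eq_zero]
  · have : (0 : ℝ) ≤ 1 / n * c i (internalClock n q i s).toNNReal := by positivity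
    linarith
  · intro j hj
    refine hF j i ?_
    have hj' : j ∈ Finset.range (c 0 (internalClock n q 0 S).toNNReal) := by
      rw [Finset.mem_range] at hj ⊢
      exact hj.trans_le (h.mono 0 (Real.toNNReal_le_toNNReal (h.clock_mono 0 hs)))
    have := Finset.single_le_sum (f := F) (fun _ _ => Nat.zero_le _) hj'
    omega

/-- The path is piecewise constant: it stays put for a while after any time. Since only finitely many
levels are involved, it suffices that each of the driving paths is right-continuous. -/
theorem eventually_eq_right (h : IsDrivenPath n ℓ lam c u z₀ q) (s : ℝ≥0) :
    ∀ᶠ t in 𝓝[≥] s, q t = q s := by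
  obtain ⟨I, hI⟩ := h.exists_level_bound (s + 1)
  have h1 : ∀ i, ∀ᶠ t in 𝓝[≥] s,
      c i (internalClock n q i t).toNNReal = c i (internalClock n q i s).toNNReal := by
    intro i
    obtain ⟨r, _, hr⟩ := h.counting i
    have h2 := eventually_eq_of_rightContinuous
      (hr.rightContinuous (internalClock n q i s).toNNReal)
    have h3 : Tendsto (fun t => (internalClock n q i t).toNNReal) (𝓝[≥] s)
        (𝓝[≥] (internalClock n q i s).toNNReal) := by
      refine tendsto_nhdsWithin_iff.2 ⟨?_, ?_⟩
      · exact ((continuous_real_toNNReal.comp (h.clock_continuous i)).tendsto s).mono_left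
          nhdsWithin_le_nhds
      · filter_upwards [self_mem_nhdsWithin] with t ht
        exact Real.toNNReal_le_toNNReal (h.clock_mono i ht)
    exact h3.eventually h2
  have h4 : ∀ᶠ t in 𝓝[≥] s, ∀ i ∈ Finset.range (I + 1),
      c i (internalClock n q i t).toNNReal = c i (internalClock n q i s).toNNReal :=
    (eventually_all_finset _).2 fun i _ => h1 i
  have h5 : ∀ᶠ t in 𝓝[≥] s, t < s + 1 :=
    eventually_nhdsWithin_of_eventually_nhds (gt_mem_nhds (by simp))
  filter_upwards [h4, h5] with t ht4 ht5
  funext i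
  by_cases hi : i = 0
  · subst hi
    rw [(h.path.mem t).1, (h.path.mem s).1]
  rcases le_or_gt i I with hiI | hiI
  · rw [h.eq_apply t hi, h.eq_apply s hi, ht4 0 (by simp), ht4 i (by simp; omega)]
  · rw [hI t ht5.le i hiI, hI s (by simp) i hiI]

end IsDrivenPath

/-! ### The embedded chain of events -/

/-- The number of jumps in `(0, b]` of the counting path with jump times `τ 1 ≤ τ 2 ≤ …`. -/
def clockCount (τ : ℕ → ℝ) (b : ℝ) : ℕ := sInf {m | b < τ (m + 1)}

/-- The time that class `i` needs for its next event if the rates stay constant. A class with rate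
zero gets the value of the arrivals, so that it plays no role in the minimum over all classes.
The first component of `S` is the state and the second one holds the internal clocks. -/
def eventWait (n : ℕ) (τ : ℕ → ℕ → ℝ) (S : (ℕ → ℝ) × (ℕ → ℝ)) (i : ℕ) : ℝ :=
  if 0 < eventRate n S.1 i then
    (τ i (clockCount (τ i) (S.2 i) + 1) - S.2 i) / eventRate n S.1 i
  else (τ 0 (clockCount (τ 0) (S.2 0) + 1) - S.2 0) / n

/-- The internal clocks at the time of the next event. -/
def nextClock (n : ℕ) (τ : ℕ → ℕ → ℝ) (S : (ℕ → ℝ) × (ℕ → ℝ)) (i : ℕ) : ℝ :=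
  S.2 i + eventRate n S.1 i * ⨅ k, eventWait n τ S k

/-- The state right after the next event. -/
def nextState (n ℓ : ℕ) (τ : ℕ → ℕ → ℝ) (u : ℕ → ℝ) (S : (ℕ → ℝ) × (ℕ → ℝ)) (i : ℕ) : ℝ :=
  if i = 0 then S.1 0
  else S.1 i
    + (1 / (n : ℝ)) * ∑ j ∈ Finset.Ico (clockCount (τ 0) (S.2 0))
        (clockCount (τ 0) (nextClock n τ S 0)), routing ℓ (u j) S.1 i
    - (1 / (n : ℝ)) * ((clockCount (τ i) (nextClock n τ S i) : ℝ) - clockCount (τ i) (S.2 i))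

/-- The chain of states and internal clocks of a system at the successive times of its events, as
an explicit function of the jump times `τ`, the selection variables and the initial state. -/
def eventChain (n ℓ : ℕ) (τ : ℕ → ℕ → ℝ) (u z₀ : ℕ → ℝ) : ℕ → (ℕ → ℝ) × (ℕ → ℝ)
  | 0 => (z₀, 0)
  | k + 1 => (nextState n ℓ τ u (eventChain n ℓ τ u z₀ k), nextClock n τ (eventChain n ℓ τ u z₀ k))

/-- The index of the last event before the arrival number `j + 1`. -/
def eventBefore (n ℓ : ℕ) (τ : ℕ → ℕ → ℝ) (u z₀ : ℕ → ℝ) (j : ℕ) : ℕ :=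
  sInf {k | j < clockCount (τ 0) ((eventChain n ℓ τ u z₀ (k + 1)).2 0)}

/-- The selection variables with those from number `j` on erased. -/
def truncate (j : ℕ) (u : ℕ → ℝ) : ℕ → ℝ := fun i => if i < j then u i else 0

/-- The state that the arrival number `j + 1` finds. It depends on the selection variables with
numbers below `j` only. -/
def preArrivalState (n ℓ j : ℕ) (τ : ℕ → ℕ → ℝ) (u z₀ : ℕ → ℝ) : ℕ → ℝ :=
  (eventChain n ℓ τ (truncate j u) z₀ (eventBefore n ℓ τ (truncate j u) z₀ j)).1

/-! ### Measurability of the chain of events -/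

section Measurability

variable {X : Type*} [MeasurableSpace X]

theorem measurable_natIndex {β : Type*} [MeasurableSpace β] {k : X → ℕ} {F : ℕ → X → β}
    (hk : Measurable k) (hF : ∀ m, Measurable (F m)) : Measurable fun x => F (k x) x := by
  have h : Measurable fun p : ℕ × X => F p.1 p.2 := measurable_from_prod_countable_right hF
  exact h.comp (hk.prodMk measurable_id)

theorem measurable_nat_sInf {s : X → Set ℕ} (hs : ∀ m, MeasurableSet {x | m ∈ s x}) :
    Measurable fun x => sInf (s x) := by
  refine measurable_to_countable' fun k => ?_
  have h : (fun x => sInf (s x)) ⁻¹' {k}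
      = ({x | k ∈ s x} ∩ ⋂ m ∈ Finset.range k, {x | m ∈ s x}ᶜ)
        ∪ ({x | k = 0} ∩ ⋂ m, {x | m ∈ s x}ᶜ) := by
    ext x
    simp only [mem_preimage, mem_singleton_iff, mem_union, mem_inter_iff,
      mem_ofPred_eq, mem_iInter, mem_compl_iff, Finset.mem_range]
    constructor
    · rintro rfl
      rcases (s x).eq_empty_or_nonempty with h | h
      · right; simp [h]
      · exact Or.inl ⟨Nat.sInf_mem h, fun m hm => Nat.notMem_of_lt_sInf hm⟩
    · rintro (⟨h1, h2⟩ | ⟨rfl, h2⟩)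
      · refine le_antisymm (Nat.sInf_le h1) ?_
        by_contra! hlt
        exact h2 _ hlt (Nat.sInf_mem ⟨k, h1⟩)
      · rw [Nat.sInf_eq_zero]
        exact Or.inr (eq_empty_iff_forall_notMem.2 h2)
  rw [h]
  refine ((hs k).inter ?_).union ((MeasurableSet.const _).inter ?_)
  · exact Finset.measurableSet_biInter _ fun m _ => (hs m).compl
  · exact MeasurableSet.iInter fun m => (hs m).compl

theorem measurable_clockCount {τ : X → ℕ → ℝ} {b : X → ℝ} (hτ : Measurable τ)
    (hb : Measurable b) : Measurable fun x => clockCount (τ x) (b x) :=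
  measurable_nat_sInf fun m => measurableSet_lt hb ((measurable_pi_apply (m + 1)).comp hτ)

theorem measurable_routing (ℓ i : ℕ) {u : X → ℝ} {z : X → ℕ → ℝ} (hu : Measurable u)
    (hz : Measurable z) : Measurable fun x => routing ℓ (u x) (z x) i := by
  have hzi : ∀ i, Measurable fun x => z x i := fun i => (measurable_pi_apply i).comp hz
  have hI : MeasurableSet {x | u x ∈ intervalI (z x) i} := by
    refine MeasurableSet.inter (measurableSet_le ?_ hu) (measurableSet_lt hu ?_)
    · exact measurable_const.sub (hzi _)
    · exact measurable_const.sub (hzi _)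
  have hJ : MeasurableSet {x | u x ∈ intervalJ (z x) ℓ i} := by
    have h : {x | u x ∈ intervalJ (z x) ℓ i} = {x | z x ℓ < 1} ∩
        {x | u x ∈ Ico ((1 - z x (i - 1)) / (1 - z x ℓ)) ((1 - z x i) / (1 - z x ℓ))} := by
      ext x
      by_cases h : z x ℓ < 1 <;> simp [intervalJ, h]
    rw [h]
    refine (measurableSet_lt (hzi _) measurable_const).inter
      (MeasurableSet.inter (measurableSet_le ?_ hu) (measurableSet_lt hu ?_))
    · exact (measurable_const.sub (hzi _)).div (measurable_const.sub (hzi _))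
    · exact (measurable_const.sub (hzi _)).div (measurable_const.sub (hzi _))
  unfold routing
  refine Measurable.ite (MeasurableSet.const _) (Measurable.ite hJ measurable_const
    measurable_const) (Measurable.ite (MeasurableSet.const _) (Measurable.ite ?_ measurable_const
    measurable_const) (Measurable.ite ?_ measurable_const measurable_const))
  · exact (measurableSet_eq_fun (hzi _) measurable_const).inter
      (measurableSet_lt (hzi _) measurable_const)
  · exact (measurableSet_eq_fun (hzi _) measurable_const).inter hI

theorem measurable_eventRate (n i : ℕ) {z : X → ℕ → ℝ} (hz : Measurable z) :
    Measurable fun x => eventRate n (z x) i := by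
  have hzi : ∀ i, Measurable fun x => z x i := fun i => (measurable_pi_apply i).comp hz
  unfold eventRate
  split_ifs
  · exact measurable_const
  · exact measurable_const.mul (measurable_const.mul ((hzi _).sub (hzi _)))

theorem measurable_eventWait (n i : ℕ) {τ : X → ℕ → ℕ → ℝ} {S : X → (ℕ → ℝ) × (ℕ → ℝ)}
    (hτ : Measurable τ) (hS : Measurable S) : Measurable fun x => eventWait n (τ x) (S x) i := by
  have hτi : ∀ i, Measurable fun x => τ x i := fun i => (measurable_pi_apply i).comp hτ
  have hb : ∀ i, Measurable fun x => (S x).2 i := fun i => (measurable_pi_apply i).comp hS.snd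
  have hr : ∀ i, Measurable fun x => eventRate n (S x).1 i := fun i =>
    measurable_eventRate n i hS.fst
  have hnext : ∀ i, Measurable fun x => τ x i (clockCount (τ x i) ((S x).2 i) + 1) := fun i =>
    measurable_natIndex (F := fun m x => τ x i (m + 1)) (measurable_clockCount (hτi i) (hb i))
      fun m => (measurable_pi_apply (m + 1)).comp (hτi i)
  refine Measurable.ite (measurableSet_lt measurable_const (hr i)) ?_ ?_
  · exact ((hnext i).sub (hb i)).div (hr i)
  · exact ((hnext 0).sub (hb 0)).div measurable_const

theorem measurable_nextClock (n i : ℕ) {τ : X → ℕ → ℕ → ℝ} {S : X → (ℕ → ℝ) × (ℕ → ℝ)}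
    (hτ : Measurable τ) (hS : Measurable S) : Measurable fun x => nextClock n (τ x) (S x) i := by
  have hb : Measurable fun x => (S x).2 i := (measurable_pi_apply i).comp hS.snd
  exact hb.add ((measurable_eventRate n i hS.fst).mul
    (Measurable.iInf fun k => measurable_eventWait n k hτ hS))

theorem measurable_nextState (n ℓ i : ℕ) {τ : X → ℕ → ℕ → ℝ} {u : X → ℕ → ℝ}
    {S : X → (ℕ → ℝ) × (ℕ → ℝ)} (hτ : Measurable τ) (hu : Measurable u) (hS : Measurable S) :
    Measurable fun x => nextState n ℓ (τ x) (u x) (S x) i := by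
  have hτi : ∀ i, Measurable fun x => τ x i := fun i => (measurable_pi_apply i).comp hτ
  have hz : ∀ i, Measurable fun x => (S x).1 i := fun i => (measurable_pi_apply i).comp hS.fst
  have hb : ∀ i, Measurable fun x => (S x).2 i := fun i => (measurable_pi_apply i).comp hS.snd
  have hk : ∀ i, Measurable fun x => clockCount (τ x i) ((S x).2 i) := fun i =>
    measurable_clockCount (hτi i) (hb i)
  have hk' : ∀ i, Measurable fun x => clockCount (τ x i) (nextClock n (τ x) (S x) i) := fun i =>
    measurable_clockCount (hτi i) (measurable_nextClock n i hτ hS)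
  have hcast : Measurable (fun k : ℕ => (k : ℝ)) := measurable_from_top
  unfold nextState
  split_ifs
  · exact hz 0
  · refine ((hz i).add (measurable_const.mul ?_)).sub (measurable_const.mul
      ((hcast.comp (hk' i)).sub (hcast.comp (hk i))))
    refine measurable_natIndex (F := fun a x => ∑ j ∈ Finset.Ico a
      (clockCount (τ x 0) (nextClock n (τ x) (S x) 0)), routing ℓ (u x j) (S x).1 i) (hk 0)
      fun a => ?_
    refine measurable_natIndex (F := fun b x => ∑ j ∈ Finset.Ico a b,
      routing ℓ (u x j) (S x).1 i) (hk' 0) fun b => ?_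
    exact Finset.measurable_sum _ fun j _ =>
      measurable_routing ℓ i ((measurable_pi_apply j).comp hu) hS.fst

theorem measurable_eventChain (n ℓ k : ℕ) {τ : X → ℕ → ℕ → ℝ} {u z₀ : X → ℕ → ℝ}
    (hτ : Measurable τ) (hu : Measurable u) (hz : Measurable z₀) :
    Measurable fun x => eventChain n ℓ (τ x) (u x) (z₀ x) k := by
  induction k with
  | zero => exact hz.prodMk measurable_const
  | succ k ih =>
    exact (measurable_pi_lambda _ fun i => measurable_nextState n ℓ i hτ hu ih).prodMk
      (measurable_pi_lambda _ fun i => measurable_nextClock n i hτ ih)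

theorem measurable_truncate (j : ℕ) {u : X → ℕ → ℝ} (hu : Measurable u) :
    Measurable fun x => truncate j (u x) := by
  refine measurable_pi_lambda _ fun i => ?_
  unfold truncate
  split_ifs
  · exact (measurable_pi_apply i).comp hu
  · exact measurable_const

theorem measurable_preArrivalState (n ℓ j : ℕ) {τ : X → ℕ → ℕ → ℝ} {u z₀ : X → ℕ → ℝ}
    (hτ : Measurable τ) (hu : Measurable u) (hz : Measurable z₀) :
    Measurable fun x => preArrivalState n ℓ j (τ x) (u x) (z₀ x) := by
  have hu' := measurable_truncate j hu
  have hk : Measurable fun x => eventBefore n ℓ (τ x) (truncate j (u x)) (z₀ x) j := by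
    refine measurable_nat_sInf fun k => ?_
    refine measurableSet_lt measurable_const (measurable_clockCount
      ((measurable_pi_apply 0).comp hτ) ((measurable_pi_apply 0).comp ?_))
    exact (measurable_eventChain n ℓ (k + 1) hτ hu' hz).snd
  exact (measurable_natIndex (F := fun k x => eventChain n ℓ (τ x) (truncate j (u x)) (z₀ x) k)
    hk fun k => measurable_eventChain n ℓ k hτ hu' hz).fst

end Measurability

/-! ### Identification of the system path with the chain of events -/

/-- The jump times of a family of counting paths. -/
def jumpTimes (c : ℕ → ℝ≥0 → ℕ) (i m : ℕ) : ℝ := jumpTime (c i) m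

namespace IsDrivenPath

variable {n ℓ : ℕ} {lam : ℝ} {c : ℕ → ℝ≥0 → ℕ} {u : ℕ → ℝ} {z₀ : ℕ → ℝ} {q : ℝ≥0 → ℕ → ℝ}

theorem lt_jumpTimes_iff (h : IsDrivenPath n ℓ lam c u z₀ q) (i m : ℕ) {b : ℝ} (hb : 0 ≤ b) :
    b < jumpTimes c i m ↔ c i b.toNNReal < m := by
  have h1 := h.jumpTime_le_iff i m b.toNNReal
  rw [← not_le, ← not_le, not_iff_not, ← h1, jumpTimes, ← NNReal.coe_le_coe,
    Real.coe_toNNReal _ hb]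

theorem clockCount_eq (h : IsDrivenPath n ℓ lam c u z₀ q) (i : ℕ) {b : ℝ} (hb : 0 ≤ b) :
    clockCount (jumpTimes c i) b = c i b.toNNReal := by
  have hs : {m | b < jumpTimes c i (m + 1)} = Ici (c i b.toNNReal) := by
    ext m
    rw [mem_ofPred_eq, h.lt_jumpTimes_iff i _ hb, mem_Ici, Nat.lt_succ_iff]
  rw [clockCount, hs]
  exact csInf_Ici

/-- The chain state that describes the path at time `t`. -/
def stateAt (n : ℕ) (q : ℝ≥0 → ℕ → ℝ) (t : ℝ≥0) : (ℕ → ℝ) × (ℕ → ℝ) :=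
  (q t, fun i => internalClock n q i t)

theorem clockCount_stateAt (h : IsDrivenPath n ℓ lam c u z₀ q) (i : ℕ) (t : ℝ≥0) :
    clockCount (jumpTimes c i) ((stateAt n q t).2 i) = c i (internalClock n q i t).toNNReal :=
  h.clockCount_eq i (h.clock_nonneg i t)

theorem eventRate_zero (z : ℕ → ℝ) : eventRate n z 0 = n := by simp [eventRate]

theorem eventWait_pos (h : IsDrivenPath n ℓ lam c u z₀ q) (t : ℝ≥0) (i : ℕ) :
    0 < eventWait n (jumpTimes c) (stateAt n q t) i := by
  have hn : (0 : ℝ) < n := by exact_mod_cast h.n_pos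
  have h1 : ∀ i, 0 < jumpTimes c i (clockCount (jumpTimes c i) ((stateAt n q t).2 i) + 1)
      - (stateAt n q t).2 i := by
    intro i
    rw [sub_pos, h.clockCount_stateAt]
    exact (h.lt_jumpTimes_iff i _ (h.clock_nonneg i t)).2 (Nat.lt_succ_self _)
  unfold eventWait
  split_ifs with hr
  · exact div_pos (h1 i) hr
  · exact div_pos (h1 0) hn

/-- The time until the next event is attained by a class with a positive rate. -/
theorem exists_eventWait_eq (h : IsDrivenPath n ℓ lam c u z₀ q) (t : ℝ≥0) :
    ∃ i, 0 < eventRate n (q t) i ∧ (∀ k, eventWait n (jumpTimes c) (stateAt n q t) i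
        ≤ eventWait n (jumpTimes c) (stateAt n q t) k) ∧
      ⨅ k, eventWait n (jumpTimes c) (stateAt n q t) k
        = eventWait n (jumpTimes c) (stateAt n q t) i := by
  have hn : (0 : ℝ) < n := by exact_mod_cast h.n_pos
  set w := eventWait n (jumpTimes c) (stateAt n q t) with hw
  obtain ⟨I, hI⟩ := h.exists_level_bound t
  obtain ⟨i, hi, hmin⟩ := Finset.exists_min_image ((Finset.range (I + 1)).filter fun k =>
    0 < eventRate n (q t) k) w ⟨0, by simp [eventRate_zero, h.n_pos]⟩
  rw [Finset.mem_filter] at hi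
  have h0 : ¬ 0 < eventRate n (q t) 0 → False := by simp [eventRate_zero, h.n_pos]
  have hall : ∀ k, w i ≤ w k := by
    intro k
    by_cases hk : 0 < eventRate n (q t) k
    · refine hmin k (Finset.mem_filter.2 ⟨?_, hk⟩)
      by_contra hkI
      have hkI' : I < k := by simpa using hkI
      have : eventRate n (q t) k = 0 := by
        simp [eventRate, show k ≠ 0 by omega, hI t le_rfl k hkI', hI t le_rfl (k + 1) (by omega)]
      exact hk.ne' this
    · have hk0 : w k = w 0 := by
        rw [hw]
        unfold eventWait
        rw [if_neg (by exact hk), if_pos (by simp [stateAt, eventRate_zero, h.n_pos]),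
          eventRate_zero]
      rw [hk0]
      exact hmin 0 (by simp [eventRate_zero, h.n_pos])
  refine ⟨i, hi.2, hall, le_antisymm (ciInf_le ⟨w i, ?_⟩ i) (le_ciInf hall)⟩
  rintro _ ⟨k, rfl⟩
  exact hall k

/-- The time between the event at time `t` and the next one. -/
def gap (n : ℕ) (c : ℕ → ℝ≥0 → ℕ) (q : ℝ≥0 → ℕ → ℝ) (t : ℝ≥0) : ℝ≥0 :=
  (⨅ k, eventWait n (jumpTimes c) (stateAt n q t) k).toNNReal

theorem coe_gap (h : IsDrivenPath n ℓ lam c u z₀ q) (t : ℝ≥0) :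
    (gap n c q t : ℝ) = ⨅ k, eventWait n (jumpTimes c) (stateAt n q t) k := by
  obtain ⟨i, _, _, h2⟩ := h.exists_eventWait_eq t
  rw [gap, Real.coe_toNNReal]
  rw [h2]
  exact (h.eventWait_pos t i).le

theorem gap_le (h : IsDrivenPath n ℓ lam c u z₀ q) (t : ℝ≥0) (i : ℕ) :
    (gap n c q t : ℝ) ≤ eventWait n (jumpTimes c) (stateAt n q t) i := by
  obtain ⟨k, _, h1, h2⟩ := h.exists_eventWait_eq t
  rw [h.coe_gap, h2]
  exact h1 i

/-- Nothing happens before the next event as long as the state has not changed. -/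
theorem count_eq_of_const (h : IsDrivenPath n ℓ lam c u z₀ q) {t s : ℝ≥0} (hts : t ≤ s)
    (hs : s < t + gap n c q t) (hconst : ∀ r, t ≤ r → r < s → q r = q t) (i : ℕ) :
    c i (internalClock n q i s).toNNReal = c i (internalClock n q i t).toNNReal := by
  have h1 := h.clock_eq_of_const i hts hconst
  have hge := h.mono i (Real.toNNReal_le_toNNReal (h.clock_mono i hts))
  refine le_antisymm ?_ hge
  rcases (eventRate_nonneg n (h.path.mem t) i).lt_or_eq with hr | hr
  · have h2 := h.gap_le t i
    have hs' : (s : ℝ) < t + gap n c q t := by exact_mod_cast hs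
    rw [eventWait, if_pos (by exact hr), le_div_iff₀ (by exact hr), h.clockCount_stateAt] at h2
    have h3 : internalClock n q i s
        < jumpTimes c i (c i (internalClock n q i t).toNNReal + 1) := by
      have h4 : (s - t : ℝ) * eventRate n (q t) i < gap n c q t * eventRate n (q t) i := by
        gcongr
        linarith
      rw [h1]
      simp only [stateAt] at h2
      linarith
    exact Nat.lt_succ_iff.1 ((h.lt_jumpTimes_iff i _ (h.clock_nonneg i s)).1 h3)
  · rw [h1, ← hr]
    simp

/-- The state does not change before the next event. -/
theorem eq_of_lt_gap (h : IsDrivenPath n ℓ lam c u z₀ q) {t s : ℝ≥0} (hts : t ≤ s)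
    (hs : s < t + gap n c q t) : q s = q t := by
  by_contra hne
  -- at the first time of a change no driving path has jumped yet, and by right-continuity the state
  -- then stays the same for a while
  set E : Set ℝ≥0 := {r | t ≤ r ∧ q r ≠ q t} with hE
  have hEne : E.Nonempty := ⟨s, hts, hne⟩
  have hle : t ≤ sInf E := le_csInf hEne fun r hr => hr.1
  have hlt : sInf E < t + gap n c q t := (csInf_le (OrderBot.bddBelow E) ⟨hts, hne⟩).trans_lt hs
  have hconst : ∀ r, t ≤ r → r < sInf E → q r = q t := by
    intro r hr hr'
    by_contra hne'
    have hrE : r ∈ E := ⟨hr, hne'⟩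
    exact (csInf_le (OrderBot.bddBelow _) hrE).not_gt hr'
  have heq : q (sInf E) = q t := h.eq_of_count_eq (h.count_eq_of_const hle hlt hconst)
  obtain ⟨v, hv1, hv2⟩ := (mem_nhdsGE_iff_exists_Ico_subset).1 (h.eventually_eq_right (sInf E))
  obtain ⟨r, hr, hrv⟩ := exists_lt_of_csInf_lt hEne (b := v) hv1
  have : q r = q (sInf E) := hv2 ⟨csInf_le (OrderBot.bddBelow _) hr, hrv⟩
  exact hr.2 (this.trans heq)

theorem clock_add_gap (h : IsDrivenPath n ℓ lam c u z₀ q) (t : ℝ≥0) (i : ℕ) :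
    internalClock n q i (t + gap n c q t) = nextClock n (jumpTimes c) (stateAt n q t) i := by
  rw [h.clock_eq_of_const i (le_self_add) (fun r h1 h2 => h.eq_of_lt_gap h1 h2)]
  rw [nextClock, ← h.coe_gap]
  simp [stateAt]

/-- An arrival that comes after time `t`, and not after the next event, finds the state at
time `t`. -/
theorem leftLim_eq (h : IsDrivenPath n ℓ lam c u z₀ q) (t : ℝ≥0) {j : ℕ}
    (h1 : c 0 (internalClock n q 0 t).toNNReal ≤ j)
    (h2 : j < c 0 (internalClock n q 0 (t + gap n c q t)).toNNReal) :
    Function.leftLim q (jumpTime (fun s => c 0 (n * s)) (j + 1)) = q t := by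
  have h0 : ∀ s, (internalClock n q 0 s).toNNReal = n * s := fun s => by
    simp [internalClock, Real.toNNReal_mul]
  rw [h0] at h1 h2
  set σ := jumpTime (fun s => c 0 (n * s)) (j + 1) with hσ
  have hlt : t < σ := by
    rw [← not_le, h.arrivals.jumpTime_mul_le_iff h.lam_pos h.n_pos]
    omega
  have hle : σ ≤ t + gap n c q t := by
    rw [h.arrivals.jumpTime_mul_le_iff h.lam_pos h.n_pos]
    omega
  have hne : (𝓝[<] σ).NeBot := nhdsLT_neBot_of_exists_lt ⟨t, hlt⟩
  refine leftLim_eq_of_tendsto (tendsto_const_nhds.congr' ?_)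
  filter_upwards [Ioo_mem_nhdsLT hlt] with r hr
  exact (h.eq_of_lt_gap hr.1.le (hr.2.trans_le hle)).symm

theorem state_add_gap (h : IsDrivenPath n ℓ lam c u z₀ q) (t : ℝ≥0) (i : ℕ) :
    q (t + gap n c q t) i = nextState n ℓ (jumpTimes c) u (stateAt n q t) i := by
  by_cases hi : i = 0
  · simp [nextState, hi, stateAt, (h.path.mem _).1]
  · have hmono : c 0 (internalClock n q 0 t).toNNReal
        ≤ c 0 (internalClock n q 0 (t + gap n c q t)).toNNReal :=
      h.mono 0 (Real.toNNReal_le_toNNReal (h.clock_mono 0 le_self_add))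
    have hsum := Finset.sum_Ico_consecutive (fun j => routing ℓ (u j)
      (Function.leftLim q (jumpTime (fun s => c 0 (n * s)) (j + 1))) i) (Nat.zero_le _) hmono
    have hnew : ∑ j ∈ Finset.Ico (c 0 (internalClock n q 0 t).toNNReal)
        (c 0 (internalClock n q 0 (t + gap n c q t)).toNNReal), routing ℓ (u j)
          (Function.leftLim q (jumpTime (fun s => c 0 (n * s)) (j + 1))) i
        = ∑ j ∈ Finset.Ico (c 0 (internalClock n q 0 t).toNNReal)
        (c 0 (internalClock n q 0 (t + gap n c q t)).toNNReal), routing ℓ (u j) (q t) i := by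
      refine Finset.sum_congr rfl fun j hj => ?_
      rw [Finset.mem_Ico] at hj
      rw [h.leftLim_eq t hj.1 hj.2]
    rw [h.eq_apply _ hi, Finset.range_eq_Ico, ← hsum, hnew, nextState, if_neg hi,
      ← h.clock_add_gap, ← h.clock_add_gap, h.clockCount_stateAt, h.clockCount_stateAt,
      h.clockCount_eq 0 (h.clock_nonneg _ _), h.clockCount_eq i (h.clock_nonneg _ _)]
    simp only [stateAt]
    rw [h.eq_apply t hi, Finset.range_eq_Ico]
    ring

/-- The times of the successive events of a path. -/
def eventTime (n : ℕ) (c : ℕ → ℝ≥0 → ℕ) (q : ℝ≥0 → ℕ → ℝ) : ℕ → ℝ≥0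
  | 0 => 0
  | k + 1 => eventTime n c q k + gap n c q (eventTime n c q k)

theorem eventChain_eq (h : IsDrivenPath n ℓ lam c u z₀ q) (k : ℕ) :
    eventChain n ℓ (jumpTimes c) u z₀ k = stateAt n q (eventTime n c q k) := by
  induction k with
  | zero =>
    refine Prod.ext ?_ ?_
    · funext i
      by_cases hi : i = 0
      · simp [eventChain, stateAt, hi, (h.path.mem _).1, h.init_mem.1.1]
      · obtain ⟨r, _, hr⟩ := h.counting i
        simp [eventChain, stateAt, eventTime, h.eq_apply 0 hi, clock_zero, hr.zero,
          h.arrivals.zero]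
    · funext i
      simp [eventChain, stateAt, eventTime, clock_zero]
  | succ k ih =>
    rw [eventChain, ih]
    refine Prod.ext ?_ ?_
    · funext i
      exact (h.state_add_gap _ i).symm
    · funext i
      exact (h.clock_add_gap _ i).symm

theorem eventTime_le_succ (k : ℕ) : eventTime n c q k ≤ eventTime n c q (k + 1) := le_self_add

/-- At each event some driving path jumps. -/
theorem exists_count_lt (h : IsDrivenPath n ℓ lam c u z₀ q) (t : ℝ≥0) :
    ∃ i, 0 < eventRate n (q t) i ∧ c i (internalClock n q i t).toNNReal
      < c i (internalClock n q i (t + gap n c q t)).toNNReal := by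
  obtain ⟨i, hi, _, h2⟩ := h.exists_eventWait_eq t
  refine ⟨i, hi, ?_⟩
  rw [← h.coe_gap, eventWait, if_pos (by exact hi), h.clockCount_stateAt] at h2
  have h3 : internalClock n q i (t + gap n c q t)
      = jumpTimes c i (c i (internalClock n q i t).toNNReal + 1) := by
    rw [h.clock_eq_of_const i le_self_add (fun r h1 h2 => h.eq_of_lt_gap h1 h2)]
    push_cast
    rw [add_sub_cancel_left, h2]
    simp only [stateAt]
    field_simp
    ring
  have h4 := (h.lt_jumpTimes_iff i (c i (internalClock n q i t).toNNReal + 1)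
    (h.clock_nonneg i (t + gap n c q t))).not.1 (by rw [h3]; exact lt_irrefl _)
  omega

/-- Events do not accumulate: only finitely many take place before a given time. -/
theorem exists_eventTime_gt (h : IsDrivenPath n ℓ lam c u z₀ q) (S : ℝ≥0) :
    ∃ k, S < eventTime n c q k := by
  by_contra! hle
  obtain ⟨I, hI⟩ := h.exists_level_bound S
  have hmono : ∀ i k, c i (internalClock n q i (eventTime n c q k)).toNNReal
      ≤ c i (internalClock n q i (eventTime n c q (k + 1))).toNNReal := fun i k =>
    h.mono i (Real.toNNReal_le_toNNReal (h.clock_mono i (eventTime_le_succ k)))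
  -- each event increases the total number of jumps of the finitely many relevant driving paths
  have hcount : ∀ k, k ≤ ∑ i ∈ Finset.range (I + 1),
      c i (internalClock n q i (eventTime n c q k)).toNNReal := by
    intro k
    induction k with
    | zero => exact Nat.zero_le _
    | succ k ih =>
      obtain ⟨i, hi, hlt⟩ := h.exists_count_lt (eventTime n c q k)
      have hiI : i ∈ Finset.range (I + 1) := by
        by_contra hnot
        have hi' : I < i := by simpa using hnot
        have : eventRate n (q (eventTime n c q k)) i = 0 := by
          simp [eventRate, show i ≠ 0 by omega, hI _ (hle k) i hi', hI _ (hle k) (i + 1) (by omega)]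
        exact hi.ne' this
      exact Nat.succ_le_of_lt (ih.trans_lt (Finset.sum_lt_sum (fun i _ => hmono i k)
        ⟨i, hiI, hlt⟩))
  have hbound : ∀ k, ∑ i ∈ Finset.range (I + 1),
      c i (internalClock n q i (eventTime n c q k)).toNNReal
        ≤ ∑ i ∈ Finset.range (I + 1), c i (internalClock n q i S).toNNReal := fun k =>
    Finset.sum_le_sum fun i _ => h.mono i (Real.toNNReal_le_toNNReal (h.clock_mono i (hle k)))
  exact absurd ((hcount _).trans (hbound _)) (Nat.not_succ_le_self _)

theorem count_eventChain (h : IsDrivenPath n ℓ lam c u z₀ q) (k : ℕ) :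
    clockCount (jumpTimes c 0) ((eventChain n ℓ (jumpTimes c) u z₀ k).2 0)
      = c 0 (internalClock n q 0 (eventTime n c q k)).toNNReal := by
  rw [h.eventChain_eq, h.clockCount_stateAt]

/-- Up to the event before the arrival number `j + 1`, the chain does not depend on the
selection variables from number `j` on. -/
theorem eventChain_truncate (h : IsDrivenPath n ℓ lam c u z₀ q) (j k : ℕ)
    (hk : clockCount (jumpTimes c 0) ((eventChain n ℓ (jumpTimes c) u z₀ k).2 0) ≤ j) :
    eventChain n ℓ (jumpTimes c) (truncate j u) z₀ k = eventChain n ℓ (jumpTimes c) u z₀ k := by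
  induction k with
  | zero => rfl
  | succ k ih =>
    have hle : clockCount (jumpTimes c 0) ((eventChain n ℓ (jumpTimes c) u z₀ k).2 0)
        ≤ clockCount (jumpTimes c 0) ((eventChain n ℓ (jumpTimes c) u z₀ (k + 1)).2 0) := by
      rw [h.count_eventChain, h.count_eventChain]
      exact h.mono 0 (Real.toNNReal_le_toNNReal (h.clock_mono 0 (eventTime_le_succ k)))
    have ih' := ih (hle.trans hk)
    rw [eventChain, eventChain, ih']
    refine Prod.ext ?_ rfl
    funext i
    simp only [nextState]
    split_ifs
    · rfl
    · congr 3
      refine Finset.sum_congr rfl fun m hm => ?_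
      have : m < j := (Finset.mem_Ico.1 hm).2.trans_le hk
      simp [truncate, this]

/-- The state that an arrival finds is an explicit function of the driving paths, the initial state
and the selection variables of the earlier arrivals. -/
theorem leftLim_eq_preArrivalState (h : IsDrivenPath n ℓ lam c u z₀ q) (j : ℕ) :
    Function.leftLim q (jumpTime (fun s => c 0 (n * s)) (j + 1))
      = preArrivalState n ℓ j (jumpTimes c) u z₀ := by
  have h0 : ∀ s, (internalClock n q 0 s).toNNReal = n * s := fun s => by
    simp [internalClock, Real.toNNReal_mul]
  obtain ⟨k₁, hk₁⟩ := h.exists_eventTime_gt (jumpTime (fun s => c 0 (n * s)) (j + 1))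
  have hk₁' : j < c 0 (internalClock n q 0 (eventTime n c q k₁)).toNNReal := by
    rw [h0]
    exact Nat.lt_of_succ_le ((h.arrivals.jumpTime_mul_le_iff h.lam_pos h.n_pos _ _).1 hk₁.le)
  have hcmono : Monotone fun k => c 0 (internalClock n q 0 (eventTime n c q k)).toNNReal :=
    monotone_nat_of_le_succ fun k =>
      h.mono 0 (Real.toNNReal_le_toNNReal (h.clock_mono 0 (eventTime_le_succ k)))
  -- the event before the arrival, in terms of the path itself
  set s : Set ℕ := {k | j < c 0 (internalClock n q 0 (eventTime n c q (k + 1))).toNNReal} with hs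
  have hsne : s.Nonempty := ⟨k₁, hk₁'.trans_le (hcmono (Nat.le_succ k₁))⟩
  have hmin : ∀ k ≤ sInf s, c 0 (internalClock n q 0 (eventTime n c q k)).toNNReal ≤ j := by
    intro k hk
    rcases k with _ | k
    · simp [eventTime, clock_zero, h.arrivals.zero]
    · exact not_lt.1 (Nat.notMem_of_lt_sInf (s := s) (Nat.lt_of_succ_le hk))
  have htrunc : ∀ k ≤ sInf s, eventChain n ℓ (jumpTimes c) (truncate j u) z₀ k
      = eventChain n ℓ (jumpTimes c) u z₀ k := fun k hk =>
    h.eventChain_truncate j k (by rw [h.count_eventChain]; exact hmin k hk)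
  -- the clocks one step ahead are still insensitive to the truncation
  have hclock : ∀ k ≤ sInf s, (eventChain n ℓ (jumpTimes c) (truncate j u) z₀ (k + 1)).2
      = (eventChain n ℓ (jumpTimes c) u z₀ (k + 1)).2 := by
    intro k hk
    rw [eventChain, eventChain, htrunc k hk]
  have hbefore : eventBefore n ℓ (jumpTimes c) (truncate j u) z₀ j = sInf s := by
    have hmem : ∀ k ≤ sInf s, (j < clockCount (jumpTimes c 0)
        ((eventChain n ℓ (jumpTimes c) (truncate j u) z₀ (k + 1)).2 0) ↔ k ∈ s) := by
      intro k hk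
      rw [hclock k hk, h.count_eventChain]
      rfl
    refine le_antisymm (Nat.sInf_le ((hmem _ le_rfl).2 (Nat.sInf_mem hsne))) ?_
    by_contra! hlt
    have hne : {k | j < clockCount (jumpTimes c 0)
        ((eventChain n ℓ (jumpTimes c) (truncate j u) z₀ (k + 1)).2 0)}.Nonempty :=
      ⟨_, (hmem _ le_rfl).2 (Nat.sInf_mem hsne)⟩
    exact Nat.notMem_of_lt_sInf hlt ((hmem _ hlt.le).1 (Nat.sInf_mem hne))
  rw [preArrivalState, hbefore, htrunc _ le_rfl, h.eventChain_eq]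
  exact h.leftLim_eq _ (hmin _ le_rfl) (Nat.sInf_mem hsne)

end IsDrivenPath

/-! ### A law of large numbers for predictably selected tasks -/

section Concentration

variable {Ω : Type*} [mΩ : MeasurableSpace Ω] {P : Measure Ω} [IsProbabilityMeasure P]

/-- Exponential moments of a sum of centred bounded variables `ξ j`, each of which is independent
of the past `m j` and is kept or discarded according to a predictable weight `w j`. -/
theorem integral_exp_selected_sum_le {m : ℕ → MeasurableSpace Ω} (hm : ∀ j, m j ≤ mΩ)
    (hmono : Monotone m) {ξ w : ℕ → Ω → ℝ} (hξm : ∀ j, Measurable[m (j + 1)] (ξ j))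
    (hwm : ∀ j, Measurable[m j] (w j)) (hw : ∀ j ω, w j ω = 0 ∨ w j ω = 1)
    (hξb : ∀ j ω, |ξ j ω| ≤ 1) (hξ0 : ∀ j, ∫ ω, ξ j ω ∂P = 0)
    (hind : ∀ j, Indep (m j) (MeasurableSpace.comap (ξ j) inferInstance) P) (θ : ℝ) (k : ℕ) :
    Integrable (fun ω => Real.exp (θ * ∑ j ∈ Finset.range k, w j ω * ξ j ω)) P ∧
    ∫ ω, Real.exp (θ * ∑ j ∈ Finset.range k, w j ω * ξ j ω) ∂P ≤ Real.exp (k * θ ^ 2 / 2) := by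
  have hSm : ∀ k, Measurable[m k] fun ω => ∑ j ∈ Finset.range k, w j ω * ξ j ω := by
    intro k
    refine Finset.measurable_sum _ fun j hj => ?_
    have hj' := Finset.mem_range.1 hj
    exact ((hwm j).mono (hmono hj'.le) le_rfl).mul ((hξm j).mono (hmono hj') le_rfl)
  have hEm : ∀ k, Measurable[m k] fun ω =>
      Real.exp (θ * ∑ j ∈ Finset.range k, w j ω * ξ j ω) := fun k =>
    Real.measurable_exp.comp ((hSm k).const_mul θ)
  have hSb : ∀ k ω, |∑ j ∈ Finset.range k, w j ω * ξ j ω| ≤ k := by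
    intro k ω
    refine (Finset.abs_sum_le_sum_abs _ _).trans ?_
    calc _ ≤ ∑ j ∈ Finset.range k, (1 : ℝ) := by
          refine Finset.sum_le_sum fun j _ => ?_
          rcases hw j ω with h | h <;> simp [h, hξb j ω]
      _ = k := by simp
  have hint : ∀ k, Integrable (fun ω => Real.exp (θ * ∑ j ∈ Finset.range k, w j ω * ξ j ω)) P := by
    intro k
    refine Integrable.of_bound ((hEm k).mono (hm k) le_rfl).aestronglyMeasurable
      (Real.exp (|θ| * k)) (Eventually.of_forall fun ω => ?_)
    rw [Real.norm_eq_abs, Real.abs_exp, Real.exp_le_exp]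
    refine (le_abs_self _).trans ?_
    rw [abs_mul]
    exact mul_le_mul_of_nonneg_left (hSb k ω) (abs_nonneg _)
  refine ⟨hint k, ?_⟩
  induction k with
  | zero => simp
  | succ k ih =>
    set E : Ω → ℝ := fun ω => Real.exp (θ * ∑ j ∈ Finset.range k, w j ω * ξ j ω) with hE
    have hEint : Integrable E P := hint k
    have hwmΩ : Measurable (w k) := (hwm k).mono (hm k) le_rfl
    have hξmΩ : Measurable (ξ k) := (hξm k).mono (hm (k + 1)) le_rfl
    have hEw : Integrable (fun ω => E ω * w k ω) P := by
      refine hEint.mul_bdd (c := 1) hwmΩ.aestronglyMeasurable (Eventually.of_forall fun ω => ?_)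
      rcases hw k ω with h | h <;> simp [h]
    have hsub := hasSubgaussianMGF_of_mem_Icc_of_integral_eq_zero (μ := P) (X := ξ k) (a := -1)
      (b := 1) hξmΩ.aemeasurable (Eventually.of_forall fun ω => abs_le.1 (hξb k ω)) (hξ0 k)
    have hmgf : ∫ ω, Real.exp (θ * ξ k ω) ∂P ≤ Real.exp (θ ^ 2 / 2) := by
      have h1 := hsub.mgf_le θ
      have h2 : (((‖(1 : ℝ) - -1‖₊ / 2) ^ 2 : ℝ≥0) : ℝ) = 1 := by
        push_cast
        norm_num
      rw [h2, one_mul] at h1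
      exact h1
    have hindep : IndepFun (fun ω => E ω * w k ω) (fun ω => Real.exp (θ * ξ k ω)) P := by
      rw [IndepFun_iff_Indep]
      refine indep_of_indep_of_le_left (indep_of_indep_of_le_right (hind k) ?_) ?_
      · exact MeasurableSpace.comap_le_iff_le_map.2 fun s hs =>
          ⟨_, (Real.measurable_exp.comp (measurable_const_mul θ)) hs, rfl⟩
      · exact Measurable.comap_le ((hEm k).mul (hwm k))
    have hexpint : Integrable (fun ω => E ω * w k ω * Real.exp (θ * ξ k ω)) P :=
      hindep.integrable_mul hEw (hsub.integrable_exp_mul θ)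
    have hprod : ∫ ω, E ω * w k ω * Real.exp (θ * ξ k ω) ∂P
        = (∫ ω, E ω * w k ω ∂P) * ∫ ω, Real.exp (θ * ξ k ω) ∂P :=
      hindep.integral_mul_eq_mul_integral hEw.aestronglyMeasurable
        (hsub.integrable_exp_mul θ).aestronglyMeasurable
    -- the weight `w k` is `0` or `1`, so that the last factor is linear in it
    have hsplit : ∀ ω, Real.exp (θ * ∑ j ∈ Finset.range (k + 1), w j ω * ξ j ω)
        = (E ω - E ω * w k ω) + E ω * w k ω * Real.exp (θ * ξ k ω) := by
      intro ω
      rw [Finset.sum_range_succ, mul_add, Real.exp_add]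
      rcases hw k ω with h | h <;> simp [h, hE]
    have hEw0 : 0 ≤ ∫ ω, E ω * w k ω ∂P := by
      refine integral_nonneg fun ω => ?_
      rcases hw k ω with h | h <;> simp [h, hE, Real.exp_nonneg]
    have hEw1 : ∫ ω, E ω * w k ω ∂P ≤ ∫ ω, E ω ∂P := by
      refine integral_mono hEw hEint fun ω => ?_
      rcases hw k ω with h | h <;> simp [h, hE, Real.exp_nonneg]
    have h1 : (1 : ℝ) ≤ Real.exp (θ ^ 2 / 2) := Real.one_le_exp (by positivity)
    simp_rw [hsplit]
    have hEsub : Integrable (fun ω => E ω - E ω * w k ω) P := hEint.sub hEw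
    rw [integral_add hEsub hexpint, integral_sub hEint hEw, hprod]
    have h2 : Real.exp (((k + 1 : ℕ) : ℝ) * θ ^ 2 / 2)
        = Real.exp (k * θ ^ 2 / 2) * Real.exp (θ ^ 2 / 2) := by
      rw [← Real.exp_add]
      congr 1
      push_cast
      ring
    rw [h2]
    have h3 : (∫ ω, E ω * w k ω ∂P) * ∫ ω, Real.exp (θ * ξ k ω) ∂P
        ≤ (∫ ω, E ω * w k ω ∂P) * Real.exp (θ ^ 2 / 2) := by gcongr
    have h4 : (∫ ω, E ω ∂P) * Real.exp (θ ^ 2 / 2)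
        ≤ Real.exp (k * θ ^ 2 / 2) * Real.exp (θ ^ 2 / 2) := by gcongr
    nlinarith

/-- The Azuma–Hoeffding bound for predictably selected sums. -/
theorem measure_selected_sum_le {m : ℕ → MeasurableSpace Ω} (hm : ∀ j, m j ≤ mΩ)
    (hmono : Monotone m) {ξ w : ℕ → Ω → ℝ} (hξm : ∀ j, Measurable[m (j + 1)] (ξ j))
    (hwm : ∀ j, Measurable[m j] (w j)) (hw : ∀ j ω, w j ω = 0 ∨ w j ω = 1)
    (hξb : ∀ j ω, |ξ j ω| ≤ 1) (hξ0 : ∀ j, ∫ ω, ξ j ω ∂P = 0)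
    (hind : ∀ j, Indep (m j) (MeasurableSpace.comap (ξ j) inferInstance) P)
    {K n k : ℕ} (hK : 0 < K) (hk : k ≤ K * n) {ε : ℝ} (hε : 0 < ε) :
    P.real {ω | ε * n < |∑ j ∈ Finset.range k, w j ω * ξ j ω|}
      ≤ 2 * Real.exp (-(ε ^ 2 / (2 * K)) * n) := by
  have hK' : (0 : ℝ) < K := by exact_mod_cast hK
  have hk' : (k : ℝ) ≤ K * n := by exact_mod_cast hk
  have hexp : ∀ θ : ℝ, θ ^ 2 = (ε / K) ^ 2 → Real.exp (-(ε / K) * (ε * n)) *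
      ∫ ω, Real.exp (θ * ∑ j ∈ Finset.range k, w j ω * ξ j ω) ∂P
      ≤ Real.exp (-(ε ^ 2 / (2 * K)) * n) := by
    intro θ hθ
    have h1 := (integral_exp_selected_sum_le (P := P) hm hmono hξm hwm hw hξb hξ0 hind θ k).2
    calc _ ≤ Real.exp (-(ε / K) * (ε * n)) * Real.exp (k * θ ^ 2 / 2) := by gcongr
      _ = Real.exp (-(ε / K) * (ε * n) + k * θ ^ 2 / 2) := by rw [Real.exp_add]
      _ ≤ Real.exp (-(ε ^ 2 / (2 * K)) * n) := by
        rw [Real.exp_le_exp, hθ]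
        have h2 : (k : ℝ) * (ε / K) ^ 2 / 2 ≤ K * n * (ε / K) ^ 2 / 2 := by gcongr
        have h3 : (K : ℝ) * n * (ε / K) ^ 2 / 2 = ε ^ 2 / (2 * K) * n := by field_simp
        have h4 : -(ε / K) * (ε * n) = -2 * (ε ^ 2 / (2 * K) * n) := by field_simp
        linarith
  have hpos : P.real {ω | ε * n ≤ ∑ j ∈ Finset.range k, w j ω * ξ j ω}
      ≤ Real.exp (-(ε ^ 2 / (2 * K)) * n) :=
    (measure_ge_le_exp_mul_mgf (ε * n) (t := ε / K) (by positivity)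
      (integral_exp_selected_sum_le (P := P) hm hmono hξm hwm hw hξb hξ0 hind _ k).1).trans
      (hexp _ rfl)
  have hneg : P.real {ω | ∑ j ∈ Finset.range k, w j ω * ξ j ω ≤ -(ε * n)}
      ≤ Real.exp (-(ε ^ 2 / (2 * K)) * n) := by
    refine (measure_le_le_exp_mul_mgf (-(ε * n)) (t := -(ε / K)) (neg_nonpos.2 (by positivity))
      (integral_exp_selected_sum_le (P := P) hm hmono hξm hwm hw hξb hξ0 hind _ k).1).trans ?_
    have := hexp (-(ε / K)) (by ring)
    have h5 : -(-(ε / K)) * -(ε * n) = -(ε / K) * (ε * n) := by ring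
    rw [h5]
    exact this
  calc _ ≤ P.real ({ω | ε * n ≤ ∑ j ∈ Finset.range k, w j ω * ξ j ω} ∪
        {ω | ∑ j ∈ Finset.range k, w j ω * ξ j ω ≤ -(ε * n)}) := by
        refine measureReal_mono fun ω hω => ?_
        rcases lt_abs.1 (show ε * n < |∑ j ∈ Finset.range k, w j ω * ξ j ω| from hω) with h | h
        · exact Or.inl h.le
        · exact Or.inr (by rw [mem_ofPred_eq]; linarith)
    _ ≤ _ := measureReal_union_le _ _
    _ ≤ _ := by linarith

/-- The strong law of large numbers for predictably selected sums, uniformly over linear ranges of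
the number of summands. The selection rule and the past may depend on the index `n`. -/
theorem ae_eventually_selected_sum_le {m : ℕ+ → ℕ → MeasurableSpace Ω} (hm : ∀ n j, m n j ≤ mΩ)
    (hmono : ∀ n, Monotone (m n)) {ξ : ℕ → Ω → ℝ} {w : ℕ+ → ℕ → Ω → ℝ}
    (hξm : ∀ n j, Measurable[m n (j + 1)] (ξ j))
    (hwm : ∀ n j, Measurable[m n j] (w n j)) (hw : ∀ n j ω, w n j ω = 0 ∨ w n j ω = 1)
    (hξb : ∀ j ω, |ξ j ω| ≤ 1) (hξ0 : ∀ j, ∫ ω, ξ j ω ∂P = 0)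
    (hind : ∀ n j, Indep (m n j) (MeasurableSpace.comap (ξ j) inferInstance) P)
    (K : ℕ) {ε : ℝ} (hε : 0 < ε) :
    ∀ᵐ ω ∂P, ∀ᶠ n : ℕ+ in atTop, ∀ k ≤ K * (n : ℕ),
      |∑ j ∈ Finset.range k, w n j ω * ξ j ω| ≤ ε * (n : ℕ) := by
  set B : ℕ+ → Set Ω := fun n => ⋃ k ∈ Finset.range (K * n + 1),
    {ω | ε * (n : ℕ) < |∑ j ∈ Finset.range k, w n j ω * ξ j ω|} with hB
  set c : ℝ := ε ^ 2 / (2 * ((K + 1 : ℕ) : ℝ)) with hc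
  have hc0 : 0 < c := by positivity
  set f : ℕ → ℝ := fun n => ((K * n + 1 : ℕ) : ℝ) * (2 * Real.exp (-c * n)) with hf
  have hfs : Summable f := by
    have h1 := (Real.summable_pow_mul_exp_neg_nat_mul 1 hc0).mul_left (2 * (K : ℝ))
    have h2 := (Real.summable_pow_mul_exp_neg_nat_mul 0 hc0).mul_left 2
    refine (h1.add h2).congr fun n => ?_
    simp only [hf]
    push_cast
    ring
  have hBn : ∀ n : ℕ+, P (B n) ≤ ENNReal.ofReal (f n) := by
    intro n
    have h1 : P.real (B n) ≤ f n := by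
      refine (measureReal_biUnion_finset_le _ _).trans ?_
      calc _ ≤ ∑ k ∈ Finset.range (K * n + 1), 2 * Real.exp (-c * (n : ℕ)) := by
            refine Finset.sum_le_sum fun k hk => ?_
            have hk' : k ≤ (K + 1) * n := by
              have := Finset.mem_range.1 hk
              nlinarith
            exact measure_selected_sum_le (hm n) (hmono n) (hξm n) (hwm n) (hw n) hξb hξ0 (hind n)
              (Nat.succ_pos K) hk' hε
        _ = f n := by simp [hf]
    rw [← ofReal_measureReal (measure_ne_top P _)]
    exact ENNReal.ofReal_le_ofReal h1
  have hsum : ∑' n, P (B n) ≠ ⊤ := by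
    refine ne_top_of_le_ne_top ?_ (ENNReal.tsum_le_tsum hBn)
    exact (hfs.comp_injective PNat.coe_injective).tsum_ofReal_ne_top
  filter_upwards [ae_finite_setOfPred_mem hsum] with ω hω
  have hev : ∀ᶠ n in cofinite, ω ∉ B n := by
    rw [eventually_cofinite]
    simpa using hω
  filter_upwards [atTop_le_cofinite hev] with n hn k hk
  by_contra! hlt
  refine hn ?_
  simp only [hB, mem_iUnion]
  exact ⟨k, Finset.mem_range.2 (by omega), hlt⟩

end Concentration

/-! ### The past of a task -/

section Past

open Classical in
/-- The jump times of a counting path, computed from countably many of its values, so that they are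
measurable functions of the path. -/
def denseJumpTime (c : ℝ≥0 → ℕ) (m : ℕ) : ℝ :=
  (⨅ k : ℕ, if m ≤ c (TopologicalSpace.denseSeq ℝ≥0 k)
    then (TopologicalSpace.denseSeq ℝ≥0 k : ENNReal) else ⊤).toReal

theorem measurable_denseJumpTime (m : ℕ) : Measurable fun c : ℝ≥0 → ℕ => denseJumpTime c m := by
  refine (Measurable.iInf fun k => Measurable.ite ?_ measurable_const measurable_const).ennreal_toReal
  exact measurableSet_le measurable_const (measurable_pi_apply _)

theorem denseJumpTime_eq {c : ℝ≥0 → ℕ} {m : ℕ} (h : ∀ t, jumpTime c m ≤ t ↔ m ≤ c t) :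
    denseJumpTime c m = jumpTime c m := by
  unfold denseJumpTime
  rw [← ENNReal.coe_toReal]
  congr 1
  refine le_antisymm (le_of_forall_gt fun v hv => ?_) (le_iInf fun k => ?_)
  · obtain ⟨v', hv1, hv2⟩ := ENNReal.lt_iff_exists_nnreal_btwn.1 hv
    obtain ⟨_, ⟨k, rfl⟩, hk⟩ := (TopologicalSpace.denseRange_denseSeq ℝ≥0).exists_between
      (ENNReal.coe_lt_coe.1 hv1)
    refine (iInf_le _ k).trans_lt ?_
    rw [if_pos ((h _).1 hk.1.le)]
    exact (ENNReal.coe_lt_coe.2 hk.2).trans hv2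
  · split_ifs with hk
    · exact ENNReal.coe_le_coe.2 ((h _).2 hk)
    · exact le_top

theorem truncate_truncate {i j : ℕ} (hij : i ≤ j) (u : ℕ → ℝ) :
    truncate i (truncate j u) = truncate i u := by
  funext k
  unfold truncate
  by_cases hk : k < i
  · simp [hk, hk.trans_le hij]
  · simp [hk]

theorem preArrivalState_truncate (n ℓ j : ℕ) (τ : ℕ → ℕ → ℝ) (u z₀ : ℕ → ℝ) :
    preArrivalState n ℓ j τ (truncate j u) z₀ = preArrivalState n ℓ j τ u z₀ := by
  simp only [preArrivalState, truncate_truncate le_rfl]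

variable {Ω : Type*} [mΩ : MeasurableSpace Ω] {P : Measure Ω}

/-- If `X` is independent of `Y`, and the pair of both is independent of `Z`, then `X` is independent
of the pair of `Y` and `Z`. -/
theorem indepFun_prod_of_prod_indepFun [IsProbabilityMeasure P] {α β γ : Type*}
    [MeasurableSpace α] [MeasurableSpace β] [MeasurableSpace γ] {X : Ω → α} {Y : Ω → β} {Z : Ω → γ}
    (hX : Measurable X) (hY : Measurable Y) (hZ : Measurable Z) (h1 : IndepFun X Y P)
    (h2 : IndepFun (fun ω => (X ω, Y ω)) Z P) : IndepFun X (fun ω => (Y ω, Z ω)) P := by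
  have hYZ : IndepFun Y Z P := h2.comp measurable_snd measurable_id
  have : IsProbabilityMeasure (P.map X) := Measure.isProbabilityMeasure_map hX.aemeasurable
  have : IsProbabilityMeasure (P.map Y) := Measure.isProbabilityMeasure_map hY.aemeasurable
  have : IsProbabilityMeasure (P.map Z) := Measure.isProbabilityMeasure_map hZ.aemeasurable
  rw [indepFun_iff_map_prod_eq_prod_map_map hX.aemeasurable (hY.prodMk hZ).aemeasurable,
    (indepFun_iff_map_prod_eq_prod_map_map hY.aemeasurable hZ.aemeasurable).1 hYZ]
  rw [indepFun_iff_map_prod_eq_prod_map_map (hX.prodMk hY).aemeasurable hZ.aemeasurable,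
    (indepFun_iff_map_prod_eq_prod_map_map hX.aemeasurable hY.aemeasurable).1 h1] at h2
  rw [← Measure.prodAssoc_prod, ← h2, Measure.map_map MeasurableEquiv.prodAssoc.measurable
    ((hX.prodMk hY).prodMk hZ)]
  rfl

variable {lam : ℝ≥0} {N : ℕ → ℝ≥0 → Ω → ℕ} {U : ℕ → Ω → ℝ} {qinit : ℕ+ → Ω → ℕ → ℝ}

/-- Everything that the system with `n` pools knows before the arrival number `j + 1`, and all of
the driving Poisson processes: their jump times, the earlier selection variables and the initial
state. -/
def pastData (N : ℕ → ℝ≥0 → Ω → ℕ) (U : ℕ → Ω → ℝ) (qinit : ℕ+ → Ω → ℕ → ℝ) (n : ℕ+) (j : ℕ)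
    (ω : Ω) : (ℕ → ℕ → ℝ) × (ℕ → ℝ) × (ℕ → ℝ) :=
  (fun i m => denseJumpTime (fun t => N i t ω) m, truncate j (fun k => U k ω), qinit n ω)

theorem IsPrimitives.measurable_driving (h : IsPrimitives P lam N U qinit) :
    Measurable fun ω (i : ℕ) (t : ℝ≥0) => N i t ω := by
  refine measurable_pi_lambda _ fun i => measurable_pi_lambda _ fun t => ?_
  rcases Nat.eq_zero_or_pos i with rfl | hi
  · exact h.arrivals.measurable t
  · exact (h.departures i hi).measurable t

theorem IsPrimitives.measurable_selection (h : IsPrimitives P lam N U qinit) :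
    Measurable fun ω (j : ℕ) => U j ω :=
  measurable_pi_lambda _ h.selection_measurable

theorem measurable_denseJumpTimes : Measurable fun (c : ℕ → ℝ≥0 → ℕ) (i m : ℕ) =>
    denseJumpTime (c i) m :=
  measurable_pi_lambda _ fun i => measurable_pi_lambda _ fun m =>
    (measurable_denseJumpTime m).comp (measurable_pi_apply i)

theorem IsPrimitives.measurable_pastData (h : IsPrimitives P lam N U qinit) (n : ℕ+) (j : ℕ) :
    Measurable (pastData N U qinit n j) :=
  (measurable_denseJumpTimes.comp h.measurable_driving).prodMk
    ((measurable_truncate j h.measurable_selection).prodMk (h.init_measurable n))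

/-- A selection variable is independent of the past of its task. -/
theorem IsPrimitives.indepFun_pastData [IsProbabilityMeasure P]
    (h : IsPrimitives P lam N U qinit) (n : ℕ+) (j : ℕ) :
    IndepFun (pastData N U qinit n j) (U j) P := by
  have hV := measurable_truncate j h.measurable_selection
  have htr : Measurable fun u : ℕ → ℝ => truncate j u := measurable_truncate j measurable_id
  have h1 : IndepFun (U j) (fun ω => truncate j (fun k => U k ω)) P := by
    have h2 := h.indep_selection.indepFun_finset {j} (Finset.range j) (by simp)
      h.selection_measurable
    have hf : Measurable fun v : (({j} : Finset ℕ) → ℝ) => v ⟨j, by simp⟩ := measurable_pi_apply _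
    have hg : Measurable fun (v : Finset.range j → ℝ) (i : ℕ) =>
        if hi : i < j then v ⟨i, by simpa using hi⟩ else 0 := by
      refine measurable_pi_lambda _ fun i => ?_
      by_cases hi : i < j
      · simp only [hi, dif_pos]
        exact measurable_pi_apply _
      · simp only [hi, dif_neg, not_false_eq_true]
        exact measurable_const
    have h3 := h2.comp hf hg
    convert! h3 using 2 with ω
  have h2 : IndepFun (fun ω => (U j ω, truncate j (fun k => U k ω)))
      (fun ω (i : ℕ) (t : ℝ≥0) => N i t ω) P :=
    h.indep_driving_selection.symm.comp ((measurable_pi_apply j).prodMk htr) measurable_id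
  have h3 := indepFun_prod_of_prod_indepFun (h.selection_measurable j) hV h.measurable_driving h1 h2
  have h4 : IndepFun (fun ω => (U j ω, (truncate j (fun k => U k ω),
      fun (i : ℕ) (t : ℝ≥0) => N i t ω))) (qinit n) P :=
    h.indep_init.comp (φ := fun x : (ℕ → ℝ≥0 → ℕ) × (ℕ → ℝ) => (x.2 j, (truncate j x.2, x.1)))
      (((measurable_pi_apply j).comp measurable_snd).prodMk
        ((htr.comp measurable_snd).prodMk measurable_fst)) (measurable_pi_apply n)
  have h5 := indepFun_prod_of_prod_indepFun (h.selection_measurable j)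
    (hV.prodMk h.measurable_driving) (h.init_measurable n) h3 h4
  exact (h5.comp measurable_id (ψ := fun x : ((ℕ → ℝ) × (ℕ → ℝ≥0 → ℕ)) × (ℕ → ℝ) =>
    ((fun (i m : ℕ) => denseJumpTime (x.1.2 i) m), x.1.1, x.2))
    ((measurable_denseJumpTimes.comp (measurable_snd.comp measurable_fst)).prodMk
      ((measurable_fst.comp measurable_fst).prodMk measurable_snd))).symm

end Past

/-! ### Selected tasks have uniform selection variables -/

/-- The distribution function of the uniform distribution on `[0, 1)`. -/
def unitClamp (x : ℝ) : ℝ := max 0 (min x 1)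

theorem unitClamp_sub_le {x y : ℝ} (h : x ≤ y) : unitClamp y - unitClamp x ≤ y - x := by
  unfold unitClamp
  rcases max_cases 0 (min x 1) with h1 | h1 <;> rcases max_cases 0 (min y 1) with h2 | h2 <;>
    rcases min_cases x 1 with h3 | h3 <;> rcases min_cases y 1 with h4 | h4 <;> linarith

theorem unitClamp_of_mem {x : ℝ} (h0 : 0 ≤ x) (h1 : x ≤ 1) : unitClamp x = x := by
  simp [unitClamp, h0, h1]

theorem unitClamp_nonneg (x : ℝ) : 0 ≤ unitClamp x := le_max_left _ _

theorem unitClamp_le_one (x : ℝ) : unitClamp x ≤ 1 := max_le zero_le_one (min_le_right _ _)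

/-- The centred indicator of `u < x`, for a variable `u` that is uniform on `[0, 1)`. -/
def centredBelow (x u : ℝ) : ℝ := (if u < x then 1 else 0) - unitClamp x

/-- The selection variables `u j`, chosen according to the weights `w n j`, are asymptotically
uniform: along linear ranges, the number of chosen variables below `x` is the number of all the
chosen ones times `x`, up to an error of smaller order. -/
def SelectionLLN (u : ℕ → ℝ) (w : ℕ+ → ℕ → ℝ) : Prop :=
  ∀ x ε : ℝ, 0 < ε → ∀ K : ℕ, ∀ᶠ n : ℕ+ in atTop, ∀ k ≤ K * (n : ℕ),
    |∑ j ∈ Finset.range k, w n j * centredBelow x (u j)| ≤ ε * (n : ℕ)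

theorem centredBelow_le {x y : ℝ} (h : x ≤ y) (u : ℝ) :
    centredBelow x u ≤ centredBelow y u + (y - x) := by
  have h1 := unitClamp_sub_le h
  have h2 : (if u < x then (1 : ℝ) else 0) ≤ if u < y then 1 else 0 := by
    split_ifs <;> linarith
  unfold centredBelow
  linarith

/-- The numbers of chosen variables below `x` are monotone in `x`, so that rational thresholds and
countably many error bounds suffice. -/
theorem selectionLLN_of_rat {u : ℕ → ℝ} {w : ℕ+ → ℕ → ℝ} (hw : ∀ n j, w n j = 0 ∨ w n j = 1)
    (h : ∀ (x : ℚ) (e K : ℕ), ∀ᶠ n : ℕ+ in atTop, ∀ k ≤ K * (n : ℕ),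
      |∑ j ∈ Finset.range k, w n j * centredBelow x (u j)| ≤ 1 / ((e : ℝ) + 1) * (n : ℕ)) :
    SelectionLLN u w := by
  intro x ε hε K
  obtain ⟨e, he⟩ := exists_nat_one_div_lt (half_pos hε)
  have hδ : 0 < ε / (2 * ((K : ℝ) + 1)) := by positivity
  obtain ⟨y, hy1, hy2⟩ := exists_rat_btwn (sub_lt_self x hδ)
  obtain ⟨z, hz1, hz2⟩ := exists_rat_btwn (lt_add_of_pos_right x hδ)
  have hstep : ∀ (a b : ℝ), a ≤ b → b - a ≤ ε / (2 * ((K : ℝ) + 1)) → ∀ (n : ℕ+) (k : ℕ),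
      k ≤ K * (n : ℕ) → ∑ j ∈ Finset.range k, w n j * centredBelow a (u j)
        ≤ ∑ j ∈ Finset.range k, w n j * centredBelow b (u j) + ε / 2 * (n : ℕ) := by
    intro a b hab hba n k hk
    have h1 : ∑ j ∈ Finset.range k, w n j * centredBelow a (u j)
        ≤ ∑ j ∈ Finset.range k, (w n j * centredBelow b (u j) + (b - a)) := by
      refine Finset.sum_le_sum fun j _ => ?_
      have := centredBelow_le hab (u j)
      rcases hw n j with h | h <;> simp only [h] <;> linarith
    rw [Finset.sum_add_distrib, Finset.sum_const, Finset.card_range, nsmul_eq_mul] at h1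
    have hk' : (k : ℝ) ≤ (K + 1) * (n : ℕ) := by
      have : (k : ℝ) ≤ K * (n : ℕ) := by exact_mod_cast hk
      have h0 : (0 : ℝ) ≤ (n : ℕ) := by positivity
      linarith
    have h2 : (k : ℝ) * (b - a) ≤ (K + 1) * (n : ℕ) * (ε / (2 * ((K : ℝ) + 1))) :=
      mul_le_mul hk' hba (by linarith) (by positivity)
    have h3 : ((K : ℝ) + 1) * (n : ℕ) * (ε / (2 * ((K : ℝ) + 1))) = ε / 2 * (n : ℕ) := by
      field_simp
    linarith
  filter_upwards [h y e K, h z e K] with n hyn hzn k hk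
  have h1 := abs_le.1 (hyn k hk)
  have h2 := abs_le.1 (hzn k hk)
  have h3 := hstep y x hy2.le (by linarith) n k hk
  have h4 := hstep x z hz1.le (by linarith) n k hk
  have h5 : 1 / ((e : ℝ) + 1) * (n : ℕ) ≤ ε / 2 * (n : ℕ) := by gcongr
  rw [abs_le]
  constructor <;> linarith

section Primitives

variable {Ω : Type*} [mΩ : MeasurableSpace Ω] {P : Measure Ω} [IsProbabilityMeasure P]
  {lam : ℝ≥0} {N : ℕ → ℝ≥0 → Ω → ℕ} {U : ℕ → Ω → ℝ} {qinit : ℕ+ → Ω → ℕ → ℝ}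

theorem measurable_centredBelow (x : ℝ) : Measurable (centredBelow x) :=
  (Measurable.ite measurableSet_Iio measurable_const measurable_const).sub measurable_const

theorem abs_centredBelow_le (x u : ℝ) : |centredBelow x u| ≤ 1 := by
  have h0 := unitClamp_nonneg x
  have h1 := unitClamp_le_one x
  unfold centredBelow
  rw [abs_le]
  split_ifs <;> constructor <;> linarith

theorem IsPrimitives.integral_centredBelow (h : IsPrimitives P lam N U qinit) (x : ℝ) (j : ℕ) :
    ∫ ω, centredBelow x (U j ω) ∂P = 0 := by
  have h1 : ∫ ω, centredBelow x (U j ω) ∂P = ∫ u, centredBelow x u ∂P.map (U j) :=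
    (integral_map (h.selection_measurable j).aemeasurable
      (measurable_centredBelow x).aestronglyMeasurable).symm
  have : IsProbabilityMeasure (P.map (U j)) :=
    Measure.isProbabilityMeasure_map (h.selection_measurable j).aemeasurable
  have h2 : ∫ u, (if u < x then (1 : ℝ) else 0) ∂P.map (U j) = unitClamp x := by
    have h3 : (fun u : ℝ => if u < x then (1 : ℝ) else 0) = (Iio x).indicator 1 := by
      funext u
      simp [indicator_apply]
    rw [h3, integral_indicator_one measurableSet_Iio, h.selection_law j, measureReal_def,
      Measure.restrict_apply measurableSet_Iio, inter_comm, Ico_inter_Iio, Real.volume_Ico,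
      ENNReal.toReal_ofReal', sub_zero, max_comm, min_comm]
    rfl
  rw [h1]
  unfold centredBelow
  rw [integral_sub, h2, integral_const]
  · simp
  · exact Integrable.of_bound (Measurable.ite measurableSet_Iio measurable_const
      measurable_const).aestronglyMeasurable 1 (Eventually.of_forall fun u => by
        split_ifs <;> simp)
  · exact integrable_const _

/-- Selection rules that only depend on the past of each task do not bias the selection
variables. -/
theorem IsPrimitives.selectionLLN (h : IsPrimitives P lam N U qinit)
    {g : ℕ+ → ℕ → (ℕ → ℕ → ℝ) × (ℕ → ℝ) × (ℕ → ℝ) → ℝ} (hg : ∀ n j, Measurable (g n j))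
    (hg01 : ∀ n j x, g n j x = 0 ∨ g n j x = 1) :
    ∀ᵐ ω ∂P, SelectionLLN (fun j => U j ω) fun n j => g n j (pastData N U qinit n j ω) := by
  have hmono : ∀ n, Monotone fun j =>
      MeasurableSpace.comap (pastData N U qinit n j) inferInstance := by
    intro n i j hij
    have h1 : pastData N U qinit n i
        = (fun x : (ℕ → ℕ → ℝ) × (ℕ → ℝ) × (ℕ → ℝ) => (x.1, truncate i x.2.1, x.2.2))
          ∘ pastData N U qinit n j := by
      funext ω
      simp [pastData, truncate_truncate hij]
    dsimp only
    rw [h1, ← MeasurableSpace.comap_comp]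
    refine MeasurableSpace.comap_mono (Measurable.comap_le ?_)
    exact measurable_fst.prodMk ((measurable_truncate i measurable_snd.fst).prodMk
      measurable_snd.snd)
  have hξm : ∀ (x : ℚ) (n : ℕ+) j, Measurable[MeasurableSpace.comap
      (pastData N U qinit n (j + 1)) inferInstance] fun ω => centredBelow x (U j ω) := by
    intro x n j
    have h1 : (fun ω => centredBelow x (U j ω))
        = (fun x' : (ℕ → ℕ → ℝ) × (ℕ → ℝ) × (ℕ → ℝ) => centredBelow x (x'.2.1 j))
          ∘ pastData N U qinit n (j + 1) := by
      funext ω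
      simp [pastData, truncate]
    rw [h1]
    exact ((measurable_centredBelow x).comp ((measurable_pi_apply j).comp
      measurable_snd.fst)).comp (comap_measurable _)
  have hmain : ∀ (x : ℚ) (e K : ℕ), ∀ᵐ ω ∂P, ∀ᶠ n : ℕ+ in atTop, ∀ k ≤ K * (n : ℕ),
      |∑ j ∈ Finset.range k, g n j (pastData N U qinit n j ω) * centredBelow x (U j ω)|
        ≤ 1 / ((e : ℝ) + 1) * (n : ℕ) := by
    intro x e K
    refine ae_eventually_selected_sum_le
      (m := fun n j => MeasurableSpace.comap (pastData N U qinit n j) inferInstance)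
      (ξ := fun j ω => centredBelow x (U j ω))
      (w := fun n j ω => g n j (pastData N U qinit n j ω))
      (fun n j => (h.measurable_pastData n j).comap_le) hmono (hξm x)
      (fun n j => (hg n j).comp (comap_measurable _)) (fun n j ω => hg01 n j _)
      (fun j ω => abs_centredBelow_le _ _) (fun j => h.integral_centredBelow x j) (fun n j => ?_) K
      (by positivity)
    refine indep_of_indep_of_le_right ((IndepFun_iff_Indep _ _ _).1 (h.indepFun_pastData n j)) ?_
    exact MeasurableSpace.comap_le_iff_le_map.2 fun s hs =>
      ⟨_, (measurable_centredBelow x) hs, rfl⟩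
  have hall := ae_all_iff.2 fun x => ae_all_iff.2 fun e => ae_all_iff.2 fun K => hmain x e K
  filter_upwards [hall] with ω hω
  exact selectionLLN_of_rat (fun n j => hg01 n j _) hω

end Primitives

open Classical in
/-- The indicator that a state has no pools with fewer than `ℓ + 1` tasks. -/
def saturated (ℓ : ℕ) (z : ℕ → ℝ) : ℝ := if z (ℓ + 1) = 1 then 1 else 0

/-- The state that the arrival number `j + 1` finds. -/
def foundState (n : ℕ) (c : ℕ → ℝ≥0 → ℕ) (q : ℝ≥0 → ℕ → ℝ) (j : ℕ) : ℕ → ℝ :=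
  Function.leftLim q (jumpTime (fun s => c 0 (n * s)) (j + 1))

/-- The regularity of the driving paths and of the system paths on which the fluid limit relies.
All of the following analysis is pathwise. -/
structure IsRegularSample (ℓ : ℕ) (lam : ℝ≥0) (c : ℕ → ℝ≥0 → ℕ) (u : ℕ → ℝ)
    (z₀ : ℕ+ → ℕ → ℝ) (q : ℕ+ → ℝ≥0 → ℕ → ℝ) : Prop where
  driven : ∀ n : ℕ+, IsDrivenPath n ℓ lam c u (z₀ n) (q n)
  selection_mem : ∀ j, u j ∈ Ico (0 : ℝ) 1
  selection_all : SelectionLLN u fun _ _ => 1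
  selection_saturated : SelectionLLN u fun n j => saturated ℓ (foundState n c (q n) j)

/-- Almost every sample is regular. For the last property, the state found by an arrival is
identified with a measurable function of the past of that arrival. -/
theorem ae_isRegularSample {Ω : Type*} [MeasurableSpace Ω] {P : Measure Ω}
    [IsProbabilityMeasure P] {lam : ℝ≥0} (hlam : 0 < lam) {ℓ : ℕ}
    {N : ℕ → ℝ≥0 → Ω → ℕ} {U : ℕ → Ω → ℝ} {qinit : ℕ+ → Ω → ℕ → ℝ}
    (hprim : IsPrimitives P lam N U qinit) {q : ℕ+ → ℝ≥0 → Ω → ℕ → ℝ}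
    (hq : ∀ n : ℕ+, ∀ᵐ ω ∂P, IsSystemPath n ℓ (fun i t => N i t ω)
      (fun j => U j ω) (qinit n ω) (fun t => q n t ω)) :
    ∀ᵐ ω ∂P, IsRegularSample ℓ lam (fun i t => N i t ω) (fun j => U j ω) (fun n => qinit n ω)
      (fun n t => q n t ω) := by
  have hone := hprim.selectionLLN (g := fun _ _ _ => 1) (fun _ _ => measurable_const) (by simp)
  have hsatm : Measurable (saturated ℓ) := by
    classical
    exact Measurable.ite (measurableSet_eq_fun (measurable_pi_apply _) measurable_const)
      measurable_const measurable_const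
  have hsat01 : ∀ z, saturated ℓ z = 0 ∨ saturated ℓ z = 1 := by
    intro z
    unfold saturated
    split_ifs <;> simp
  have hsel := hprim.selectionLLN
    (g := fun n j x => saturated ℓ (preArrivalState n ℓ j x.1 x.2.1 x.2.2))
    (fun n j => hsatm.comp (measurable_preArrivalState n ℓ j measurable_fst measurable_snd.fst
      measurable_snd.snd)) (fun _ _ _ => hsat01 _)
  have hdep : ∀ᵐ ω ∂P, ∀ i, 1 ≤ i → IsCountingPath (fun t => N i t ω) 1 := by
    refine ae_all_iff.2 fun i => ?_
    by_cases hi : 1 ≤ i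
    · filter_upwards [(hprim.departures i hi).isCountingPath] with ω hω _
      simpa using hω
    · exact Eventually.of_forall fun ω h => absurd h hi
  have hU : ∀ᵐ ω ∂P, ∀ j, U j ω ∈ Ico (0 : ℝ) 1 := by
    refine ae_all_iff.2 fun j => ?_
    have h1 : ∀ᵐ u ∂P.map (U j), u ∈ Ico (0 : ℝ) 1 := by
      rw [hprim.selection_law j]
      exact ae_restrict_mem measurableSet_Ico
    exact ae_of_ae_map (hprim.selection_measurable j).aemeasurable h1
  filter_upwards [hone, hsel, hprim.arrivals.isCountingPath, hdep, hU, ae_all_iff.2 hq,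
    ae_all_iff.2 hprim.init_finite] with ω h1 h2 h3 h4 h5 h6 h7
  have hdriven : ∀ n : ℕ+, IsDrivenPath n ℓ lam (fun i t => N i t ω) (fun j => U j ω) (qinit n ω)
      (fun t => q n t ω) := fun n =>
    ⟨n.pos, by exact_mod_cast hlam, h3, h4, hprim.init_mem n ω, h7 n, h6 n⟩
  refine ⟨hdriven, h5, h1, ?_⟩
  convert! h2 using 3 with n j
  congr 1
  have hτ : (fun i m => denseJumpTime (fun t => N i t ω) m) = jumpTimes fun i t => N i t ω := by
    funext i m
    exact denseJumpTime_eq ((hdriven n).jumpTime_le_iff i m)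
  rw [foundState, (hdriven n).leftLim_eq_preArrivalState j]
  simp only [pastData, preArrivalState_truncate, hτ]

/-! ### Convergence in the path space -/

theorem prodDist_le_of_coord {a b : ℕ → ℝ} {δ : ℝ} {I : ℕ}
    (h : ∀ i < I, |a i - b i| ≤ δ) (hδ : 0 ≤ δ) : prodDist a b ≤ 2 * δ + 2 * (1 / 2) ^ I := by
  have hs := (prodDist_summable a b).sum_add_tsum_nat_add I
  have h1 : ∑ i ∈ Finset.range I, min |a i - b i| 1 / 2 ^ i ≤ 2 * δ := by
    calc _ ≤ ∑ i ∈ Finset.range I, δ * (1 / 2 : ℝ) ^ i := by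
          refine Finset.sum_le_sum fun i hi => ?_
          rw [one_div_pow, mul_one_div]
          gcongr
          exact (min_le_left _ _).trans (h i (Finset.mem_range.1 hi))
      _ = δ * ∑ i ∈ Finset.range I, (1 / 2 : ℝ) ^ i := by rw [Finset.mul_sum]
      _ ≤ δ * 2 := by gcongr; exact sum_geometric_two_le I
      _ = 2 * δ := by ring
  have h2 : ∑' i, min |a (i + I) - b (i + I)| 1 / 2 ^ (i + I) ≤ 2 * (1 / 2) ^ I := by
    have h3 : Summable fun i : ℕ => (1 / 2 : ℝ) ^ I * (1 / 2) ^ i :=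
      summable_geometric_two.mul_left _
    have h4 : ∑' i : ℕ, (1 / 2 : ℝ) ^ I * (1 / 2) ^ i = 2 * (1 / 2) ^ I := by
      rw [tsum_mul_left, tsum_geometric_two]
      ring
    rw [← h4]
    refine ((summable_nat_add_iff I).2 (prodDist_summable a b)).tsum_le_tsum (fun i => ?_) h3
    rw [← pow_add, add_comm I i]
    exact prodDist_term_le a b (i + I)
  unfold prodDist
  rw [← hs]
  linarith

/-- Coordinatewise uniform convergence implies convergence in the path space. -/
theorem tendsto_cadlagPath {ι : Type*} {F : Filter ι} {T : ℝ≥0} {x : ι → CadlagPath T}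
    {y : CadlagPath T} (h : ∀ i, ∀ ε : ℝ, 0 < ε → ∀ᶠ n in F, ∀ t,
      |(x n).toFun t i - y.toFun t i| ≤ ε) : Tendsto x F (𝓝 y) := by
  rw [Metric.tendsto_nhds]
  intro ε hε
  obtain ⟨I, hI⟩ := exists_pow_lt_of_lt_one (show (0 : ℝ) < ε / 8 by positivity)
    (show (1 / 2 : ℝ) < 1 by norm_num)
  have h1 : ∀ᶠ n in F, ∀ i ∈ Finset.range I, ∀ t, |(x n).toFun t i - y.toFun t i| ≤ ε / 8 :=
    (eventually_all_finset _).2 fun i _ => h i (ε / 8) (by positivity)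
  filter_upwards [h1] with n hn
  have := nonempty_interval T
  have h2 : uniformDist (x n) y ≤ 2 * (ε / 8) + 2 * (1 / 2) ^ I :=
    ciSup_le fun t => prodDist_le_of_coord (fun i hi => hn i (Finset.mem_range.2 hi) t)
      (by positivity)
  have h3 : dist (x n) y = uniformDist (x n) y := rfl
  rw [h3]
  linarith

/-- Convergence in the path space implies coordinatewise uniform convergence. -/
theorem eventually_coord_of_tendsto {ι : Type*} {F : Filter ι} {T : ℝ≥0} {x : ι → CadlagPath T}
    {y : CadlagPath T} (h : Tendsto x F (𝓝 y)) (i : ℕ) {ε : ℝ} (hε : 0 < ε) :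
    ∀ᶠ n in F, ∀ t, |(x n).toFun t i - y.toFun t i| ≤ ε := by
  filter_upwards [Metric.tendsto_nhds.1 h (min ε 1 / 2 ^ i) (by positivity)] with n hn t
  have h1 : min |(x n).toFun t i - y.toFun t i| 1 / 2 ^ i < min ε 1 / 2 ^ i :=
    (((prodDist_summable _ _).le_tsum i (fun j _ => prodDist_term_nonneg _ _ j)).trans
      (prodDist_le_uniformDist (x n) y t)).trans_lt hn
  have h2 : min |(x n).toFun t i - y.toFun t i| 1 < min ε 1 :=
    (div_lt_div_iff_of_pos_right (by positivity)).1 h1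
  rcases min_lt_iff.1 h2 with h3 | h3
  · exact (h3.trans_le (min_le_left _ _)).le
  · exact absurd (h3.trans_le (min_le_right _ _)) (lt_irrefl _)

/-- A family that converges along every ultrafilter has a relatively compact range, since it extends
continuously to the compact space of all the ultrafilters. -/
theorem isCompact_closure_range_of_ultrafilter {ι X : Type*} [TopologicalSpace X] [T3Space X]
    (x : ι → X) (h : ∀ F : Ultrafilter ι, ∃ y, Tendsto x F (𝓝 y)) :
    IsCompact (closure (range x)) := by
  let : TopologicalSpace ι := ⊥
  have hd := isDenseInducing_pure (α := ι)
  have hcont : Continuous (hd.extend x) := hd.continuous_extend fun F => by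
    obtain ⟨y, hy⟩ := h F
    exact ⟨y, hy.mono_left (ultrafilter_comap_pure_nhds F)⟩
  refine exists_isCompact_superset_iff.1 ⟨range (hd.extend x), isCompact_range hcont, ?_⟩
  rintro _ ⟨n, rfl⟩
  exact ⟨pure n, hd.extend_eq_of_tendsto
    ((tendsto_pure_nhds x n).mono_left (ultrafilter_comap_pure_nhds (pure n)))⟩

theorem IsCadlag.restrict {q : ℝ≥0 → ℕ → ℝ} (hq : IsCadlag q) (T : ℝ≥0) :
    IsCadlag fun t : Icc (0 : ℝ) T => q (Real.toNNReal t) := by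
  intro t
  have hc : Continuous fun s : Icc (0 : ℝ) T => Real.toNNReal s :=
    continuous_real_toNNReal.comp continuous_subtype_val
  constructor
  · exact ContinuousWithinAt.comp (t := Ici (Real.toNNReal t)) (hq _).1 hc.continuousWithinAt
      fun s hs => Real.toNNReal_le_toNNReal hs
  · obtain ⟨l, hl⟩ := (hq (Real.toNNReal t)).2
    refine ⟨l, hl.comp (tendsto_nhdsWithin_iff.2
      ⟨(hc.tendsto t).mono_left nhdsWithin_le_nhds, ?_⟩)⟩
    filter_upwards [self_mem_nhdsWithin] with s hs
    have hs' : (s : ℝ) < t := hs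
    exact (Real.toNNReal_lt_toNNReal_iff_of_nonneg s.2.1).2 hs'

/-! ### Scaled arrivals and departures -/

/-- The scaled sum, over the tasks that arrive up to time `t`, of the numbers `R j`. -/
def scaledSum (n : ℕ) (c₀ : ℝ≥0 → ℕ) (R : ℕ → ℝ) (t : ℝ≥0) : ℝ :=
  (1 / (n : ℝ)) * ∑ j ∈ Finset.range (c₀ (n * t)), R j

theorem scaledSum_sub {n : ℕ} {c₀ : ℝ≥0 → ℕ} (hc : Monotone c₀) (R : ℕ → ℝ) {s t : ℝ≥0}
    (hst : s ≤ t) : scaledSum n c₀ R t - scaledSum n c₀ R s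
      = (1 / (n : ℝ)) * ∑ j ∈ Finset.Ico (c₀ (n * s)) (c₀ (n * t)), R j := by
  have h1 : c₀ (n * s) ≤ c₀ (n * t) := hc (by gcongr)
  rw [scaledSum, scaledSum, ← mul_sub, Finset.sum_Ico_eq_sub _ h1]

/-- The fluid-scaled cumulative departure intensity. -/
def scaledClock (q : ℝ≥0 → ℕ → ℝ) (i : ℕ) (t : ℝ≥0) : ℝ :=
  ∫ s in (0 : ℝ)..t, (i : ℝ) * (q s.toNNReal i - q s.toNNReal (i + 1))

namespace IsRegularSample

variable {ℓ : ℕ} {lam : ℝ≥0} {c : ℕ → ℝ≥0 → ℕ} {u : ℕ → ℝ} {z₀ : ℕ+ → ℕ → ℝ}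
  {q : ℕ+ → ℝ≥0 → ℕ → ℝ}

theorem arrivals (h : IsRegularSample ℓ lam c u z₀ q) : IsCountingPath (c 0) lam :=
  (h.driven 1).arrivals

theorem mem (h : IsRegularSample ℓ lam c u z₀ q) (n : ℕ+) (t : ℝ≥0) : q n t ∈ occupancySet :=
  (h.driven n).path.mem t

/-- The scaled number of departures from pools with exactly `i` tasks. -/
def scaledDepartures (c : ℕ → ℝ≥0 → ℕ) (q : ℕ+ → ℝ≥0 → ℕ → ℝ) (n : ℕ+) (i : ℕ) (t : ℝ≥0) : ℝ :=
  (1 / ((n : ℕ) : ℝ)) * c i (internalClock n (q n) i t).toNNReal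

/-- The system equations in terms of the scaled arrivals and departures. -/
theorem balance (h : IsRegularSample ℓ lam c u z₀ q) (n : ℕ+) (t : ℝ≥0) {i : ℕ} (hi : i ≠ 0) :
    q n t i = q n 0 i
      + scaledSum n (c 0) (fun j => routing ℓ (u j) (foundState n c (q n) j) i) t
      - scaledDepartures c q n i t := by
  have h0 : ∀ s, (internalClock n (q n) 0 s).toNNReal = (n : ℕ) * s := fun s => by
    simp [internalClock, Real.toNNReal_mul]
  obtain ⟨r, _, hr⟩ := (h.driven n).counting i
  rw [(h.driven n).eq_apply t hi, (h.driven n).eq_apply 0 hi, h0, h0]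
  simp [scaledSum, scaledDepartures, foundState, IsDrivenPath.clock_zero, hr.zero, h.arrivals.zero]

theorem clock_eq (n : ℕ+) {i : ℕ} (hi : i ≠ 0) (t : ℝ≥0) :
    internalClock n (q n) i t = (n : ℕ) * scaledClock (q n) i t := by
  simp [internalClock, scaledClock, hi]

theorem scaledClock_sub_mem (h : IsRegularSample ℓ lam c u z₀ q) (n : ℕ+) {i : ℕ} (hi : i ≠ 0)
    {s t : ℝ≥0} (hst : s ≤ t) :
    scaledClock (q n) i t - scaledClock (q n) i s ∈ Icc (0 : ℝ) (i * (t - s)) := by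
  have hn : (0 : ℝ) < ((n : ℕ) : ℝ) := by exact_mod_cast n.pos
  have h1 := (h.driven n).clock_sub_nonneg i hst
  have h2 := (h.driven n).clock_sub_le hi hst
  rw [clock_eq n hi, clock_eq n hi, ← mul_sub] at h1 h2
  exact ⟨nonneg_of_mul_nonneg_right h1 hn, le_of_mul_le_mul_left h2 hn⟩

theorem scaledClock_mem (h : IsRegularSample ℓ lam c u z₀ q) (n : ℕ+) {i : ℕ} (hi : i ≠ 0)
    (t : ℝ≥0) : scaledClock (q n) i t ∈ Icc (0 : ℝ) (i * t) := by
  have h1 := h.scaledClock_sub_mem n hi (zero_le (a := t))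
  simpa [scaledClock] using h1

/-- The scaled departures are close to their cumulative intensity. -/
theorem scaledDepartures_close (h : IsRegularSample ℓ lam c u z₀ q) {i : ℕ} (hi : i ≠ 0)
    (T : ℝ≥0) {ε : ℝ} (hε : 0 < ε) :
    ∀ᶠ n : ℕ+ in atTop, ∀ t ≤ T, |scaledDepartures c q n i t - scaledClock (q n) i t| ≤ ε := by
  have hc := (h.driven 1).departures i (by omega)
  filter_upwards [hc.fslln zero_le_one (i * T) hε] with n hn t ht
  have h1 := h.scaledClock_mem n hi t
  have h2 := hn (scaledClock (q n) i t).toNNReal (by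
    rw [← NNReal.coe_le_coe, Real.coe_toNNReal _ h1.1]
    push_cast
    have : (t : ℝ) ≤ T := ht
    exact h1.2.trans (by gcongr))
  rw [Real.coe_toNNReal _ h1.1, one_mul] at h2
  rw [scaledDepartures, clock_eq n hi, Real.toNNReal_mul (by positivity), Real.toNNReal_natCast,
    one_div_mul_eq_div]
  exact h2

theorem scaledArrivals_close (h : IsRegularSample ℓ lam c u z₀ q) (T : ℝ≥0) {ε : ℝ}
    (hε : 0 < ε) : ∀ᶠ n : ℕ+ in atTop, ∀ t ≤ T, |scaledSum n (c 0) (fun _ => 1) t - lam * t| ≤ ε := by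
  filter_upwards [h.arrivals.fslln lam.2 T hε] with n hn t ht
  simpa [scaledSum, one_div_mul_eq_div, inv_mul_eq_div] using hn t ht

theorem scaledSum_sub_le (h : IsRegularSample ℓ lam c u z₀ q) (n : ℕ+) {R w : ℕ → ℝ} {s t : ℝ≥0}
    (hst : s ≤ t) (hR : ∀ j, (c 0) ((n : ℕ) * s) ≤ j → j < (c 0) ((n : ℕ) * t) → R j ≤ w j) :
    scaledSum n (c 0) R t - scaledSum n (c 0) R s
      ≤ scaledSum n (c 0) w t - scaledSum n (c 0) w s := by
  rw [scaledSum_sub h.arrivals.mono _ hst, scaledSum_sub h.arrivals.mono _ hst]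
  refine mul_le_mul_of_nonneg_left (Finset.sum_le_sum fun j hj => ?_) (by positivity)
  rw [Finset.mem_Ico] at hj
  exact hR j hj.1 hj.2

/-- The paths are asymptotically Lipschitz: arrivals to a given level are at most all the arrivals,
and departures have rate at most `i`. -/
theorem asymptotically_lipschitz (h : IsRegularSample ℓ lam c u z₀ q) (i : ℕ) (T : ℝ≥0) {ε : ℝ}
    (hε : 0 < ε) : ∀ᶠ n : ℕ+ in atTop, ∀ s t, s ≤ t → t ≤ T →
      |q n t i - q n s i| ≤ (lam + i) * (t - s) + ε := by
  rcases eq_or_ne i 0 with rfl | hi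
  · refine Eventually.of_forall fun n s t hst _ => ?_
    have hst' : (s : ℝ) ≤ t := hst
    have : (0 : ℝ) ≤ (lam + (0 : ℕ)) * ((t : ℝ) - s) := mul_nonneg (by positivity) (by linarith)
    rw [(h.mem n t).1, (h.mem n s).1, sub_self, abs_zero]
    linarith
  · filter_upwards [h.scaledDepartures_close hi T (show 0 < ε / 4 by positivity),
      h.scaledArrivals_close T (show 0 < ε / 4 by positivity)] with n h1 h2 s t hst htT
    have hD1 := abs_le.1 (h1 t htT)
    have hD2 := abs_le.1 (h1 s (hst.trans htT))
    have hA1 := abs_le.1 (h2 t htT)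
    have hA2 := abs_le.1 (h2 s (hst.trans htT))
    have hI := h.scaledClock_sub_mem n hi hst
    have hu := h.scaledSum_sub_le n (R := fun j => routing ℓ (u j) (foundState n c (q n) j) i)
      (w := fun _ => 1) hst fun j _ _ => routing_le_one _ _ _ _
    have hl := h.scaledSum_sub_le n (R := fun _ => 0)
      (w := fun j => routing ℓ (u j) (foundState n c (q n) j) i) hst
      fun j _ _ => routing_nonneg _ _ _ _
    have hzero : ∀ r, scaledSum n (c 0) (fun _ => 0) r = 0 := fun r => by simp [scaledSum]
    rw [hzero, hzero, sub_zero] at hl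
    have hst' : (s : ℝ) ≤ t := hst
    have h3 : (0 : ℝ) ≤ lam * ((t : ℝ) - s) := mul_nonneg lam.2 (by linarith)
    have h4 : (0 : ℝ) ≤ i * ((t : ℝ) - s) := mul_nonneg (by positivity) (by linarith)
    rw [h.balance n t hi, h.balance n s hi, abs_le]
    constructor <;> nlinarith [hI.1, hI.2]

/-! ### Relative compactness -/

/-- Along a filter that tends to infinity, pointwise convergence of the paths is uniform. -/
theorem uniform_of_pointwise (h : IsRegularSample ℓ lam c u z₀ q) {F : Filter ℕ+} [F.NeBot]
    (hF : F ≤ atTop) {T : ℝ≥0} {i : ℕ} {y : ℝ≥0 → ℝ}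
    (hy : ∀ t ≤ T, Tendsto (fun n => q n t i) F (𝓝 (y t))) :
    (∀ s t, s ≤ t → t ≤ T → |y t - y s| ≤ (lam + i) * (t - s)) ∧
    ∀ ε : ℝ, 0 < ε → ∀ᶠ n in F, ∀ t ≤ T, |q n t i - y t| ≤ ε := by
  have hlip : ∀ s t, s ≤ t → t ≤ T → |y t - y s| ≤ (lam + i) * (t - s) := by
    intro s t hst htT
    refine le_of_forall_pos_le_add fun ε hε => ?_
    refine le_of_tendsto ((hy t htT).sub (hy s (hst.trans htT))).abs ?_
    filter_upwards [hF (h.asymptotically_lipschitz i T hε)] with n hn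
    exact hn s t hst htT
  refine ⟨hlip, fun ε hε => ?_⟩
  -- a grid whose mesh `δ` makes the Lipschitz terms small
  set L : ℝ≥0 := lam + i + 1 with hL
  have hL0 : 0 < L := by positivity
  set δ : ℝ≥0 := (ε / 4).toNNReal / L with hδ
  have hε4 : ((ε / 4).toNNReal : ℝ) = ε / 4 := Real.coe_toNNReal _ (by positivity)
  have hδ0 : 0 < δ := div_pos (Real.toNNReal_pos.2 (by positivity)) hL0
  have hgrid : ∀ᶠ n in F, ∀ m ∈ (Finset.range (⌊T / δ⌋₊ + 1)),
      |q n (m * δ) i - y (m * δ)| ≤ ε / 4 := by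
    refine (eventually_all_finset _).2 fun m hm => ?_
    have hmT : (m : ℝ≥0) * δ ≤ T := by
      rw [← le_div_iff₀ hδ0]
      exact (Nat.cast_le.2 (Nat.lt_succ_iff.1 (Finset.mem_range.1 hm))).trans
        (Nat.floor_le zero_le)
    filter_upwards [Metric.tendsto_nhds.1 (hy _ hmT) (ε / 4) (by positivity)] with n hn
    rw [Real.dist_eq] at hn
    exact hn.le
  filter_upwards [hgrid, hF (h.asymptotically_lipschitz i T (show 0 < ε / 4 by positivity))]
    with n h1 h2 t ht
  set m := ⌊t / δ⌋₊ with hm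
  have hm1 : (m : ℝ≥0) * δ ≤ t := by
    rw [← le_div_iff₀ hδ0]
    exact Nat.floor_le zero_le
  have hm2 : t ≤ ((m : ℝ≥0) + 1) * δ := by
    rw [← div_le_iff₀ hδ0]
    exact (Nat.lt_floor_add_one _).le
  have hmem : m ∈ Finset.range (⌊T / δ⌋₊ + 1) := by
    rw [Finset.mem_range, Nat.lt_succ_iff]
    exact Nat.floor_le_floor (by gcongr)
  have h3 := abs_le.1 (h1 m hmem)
  have h4 := abs_le.1 (h2 _ t hm1 ht)
  have h5 := abs_le.1 (hlip _ t hm1 ht)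
  have hm2' : (t : ℝ) ≤ ((m : ℝ) + 1) * δ := by exact_mod_cast hm2
  have hm1' : (m : ℝ) * δ ≤ t := by exact_mod_cast hm1
  have hLδ : (L : ℝ) * δ = ε / 4 := by
    rw [hδ, NNReal.coe_div, hε4]
    field_simp
  have h6 : ((lam : ℝ) + i) * (t - ((m * δ : ℝ≥0) : ℝ)) ≤ ε / 4 := by
    rw [← hLδ]
    have hLr : (L : ℝ) = lam + i + 1 := by simp [hL]
    push_cast
    have h7 : (0 : ℝ) ≤ lam + i := by positivity
    have h8 : (0 : ℝ) ≤ δ := δ.2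
    calc ((lam : ℝ) + i) * (t - m * δ) ≤ (lam + i) * δ := by gcongr; linarith
      _ ≤ L * δ := by rw [hLr]; nlinarith
  rw [abs_le]
  constructor <;> linarith

/-- The restrictions of the system paths to `[0, T]`. -/
def pathOn (h : IsRegularSample ℓ lam c u z₀ q) (T : ℝ≥0) (n : ℕ+) : CadlagPath T where
  toFun t := q n (Real.toNNReal t)
  isCadlag := (h.driven n).path.isCadlag.restrict T

/-- The restrictions of the system paths form a relatively compact set: along a nonprincipal
ultrafilter all the coordinates converge pointwise, since they are bounded, and hence uniformly. -/
theorem isCompact_closure_range_pathOn (h : IsRegularSample ℓ lam c u z₀ q) (T : ℝ≥0) :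
    IsCompact (closure (range (h.pathOn T))) := by
  refine isCompact_closure_range_of_ultrafilter _ fun F => ?_
  rcases F.le_cofinite_or_eq_pure with hF | ⟨n, rfl⟩
  swap
  · exact ⟨h.pathOn T n, tendsto_pure_nhds _ n⟩
  have hF' : (F : Filter ℕ+) ≤ atTop := by
    refine hF.trans (le_iInf fun n => ?_)
    rw [le_principal_iff, mem_cofinite]
    rw [compl_Ici]
    exact finite_Iio n
  have hlim : ∀ (t : ℝ≥0) (i : ℕ), ∃ y, Tendsto (fun n => q n t i) F (𝓝 y) := by
    intro t i
    obtain ⟨y, _, hy⟩ := (isCompact_Icc (a := (0 : ℝ)) (b := 1)).ultrafilter_le_nhds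
      (F.map fun n => q n t i) (by
        rw [le_principal_iff]
        exact Filter.mem_map.2 (univ_mem' fun n => ((h.mem n t).2 i).1))
    exact ⟨y, hy⟩
  choose y hy using hlim
  have huni := fun i => h.uniform_of_pointwise hF' (T := T) (i := i) (y := fun t => y t i)
    fun t _ => hy t i
  have hcont : Continuous fun (t : Icc (0 : ℝ) T) i => y (Real.toNNReal t) i := by
    refine continuous_pi fun i => ?_
    have hl : LipschitzWith (lam + i) fun t : Icc (0 : ℝ) T => y (Real.toNNReal t) i := by
      refine LipschitzWith.of_dist_le_mul fun s t => ?_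
      wlog hst : s ≤ t generalizing s t
      · rw [dist_comm, dist_comm s t]
        exact this t s (le_of_not_ge hst)
      have h1 := (huni i).1 (Real.toNNReal s) (Real.toNNReal t) (Real.toNNReal_le_toNNReal hst)
        (Real.toNNReal_le_iff_le_coe.2 t.2.2)
      rw [Real.coe_toNNReal _ s.2.1, Real.coe_toNNReal _ t.2.1] at h1
      have hst' : (s : ℝ) ≤ t := hst
      rw [Real.dist_eq, Subtype.dist_eq, Real.dist_eq, abs_sub_comm, abs_sub_comm (s : ℝ),
        abs_of_nonneg (by linarith : (0 : ℝ) ≤ t - s)]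
      push_cast
      exact h1
    exact hl.continuous
  refine ⟨⟨_, fun t => ⟨hcont.continuousWithinAt, _,
    (hcont.tendsto t).mono_left nhdsWithin_le_nhds⟩⟩, tendsto_cadlagPath fun i ε hε => ?_⟩
  filter_upwards [(huni i).2 ε hε] with n hn t
  exact hn _ (Real.toNNReal_le_iff_le_coe.2 t.2.2)

end IsRegularSample

/-! ### Limits of the scaled arrivals -/

theorem continuous_unitClamp : Continuous unitClamp :=
  continuous_const.max (continuous_id.min continuous_const)

open Classical in
/-- The indicator of `[a, b)`. -/
def indIco (a b v : ℝ) : ℝ := if v ∈ Ico a b then 1 else 0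

theorem indIco_nonneg (a b v : ℝ) : 0 ≤ indIco a b v := by
  unfold indIco
  split_ifs <;> simp

theorem indIco_of_le {a b : ℝ} (hba : b ≤ a) (v : ℝ) : indIco a b v = 0 :=
  if_neg fun hv => (hv.1.trans_lt hv.2).not_ge hba

theorem indIco_mono {a b a' b' : ℝ} (ha : a' ≤ a) (hb : b ≤ b') (v : ℝ) :
    indIco a b v ≤ indIco a' b' v := by
  unfold indIco
  split_ifs with h1 h2 h2
  · exact le_rfl
  · exact absurd ⟨ha.trans h1.1, h1.2.trans_le hb⟩ h2
  · exact zero_le_one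
  · exact le_rfl

theorem indIco_eq {a b : ℝ} (hab : a ≤ b) (v : ℝ) :
    indIco a b v = centredBelow b v - centredBelow a v + (unitClamp b - unitClamp a) := by
  unfold indIco centredBelow
  by_cases h1 : v < a
  · simp [h1, h1.trans_le hab, not_le.2 h1]
  · by_cases h2 : v < b <;> simp [h1, h2, not_lt.1 h1]

/-- The limit of the scaled arrivals to pools with exactly `i - 1` tasks, if `Y` is the limit of the
paths: the increase of `Y · i` plus the limit of the departures. -/
def limitArrivals (Y : ℝ≥0 → ℕ → ℝ) (i : ℕ) (t : ℝ≥0) : ℝ := Y t i - Y 0 i + scaledClock Y i t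

/-- The limit of the scaled number of tasks that find all the pools with more than `ℓ` tasks: the
total number of arrivals minus those to pools with at most `ℓ` tasks. -/
def limitSaturated (lam : ℝ≥0) (ℓ : ℕ) (Y : ℝ≥0 → ℕ → ℝ) (t : ℝ≥0) : ℝ :=
  lam * t - ∑ i ∈ Finset.Icc 1 (ℓ + 1), limitArrivals Y i t

/-- `Y` is a continuous path to which the paths `q n` converge along `F`, uniformly on `[0, T]` in
each coordinate. -/
structure IsUniformLimit (F : Filter ℕ+) (T : ℝ≥0) (q : ℕ+ → ℝ≥0 → ℕ → ℝ) (Y : ℝ≥0 → ℕ → ℝ) :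
    Prop where
  le_atTop : F ≤ atTop
  continuous : ∀ i, Continuous fun t => Y t i
  close : ∀ i, ∀ ε : ℝ, 0 < ε → ∀ᶠ n in F, ∀ t ≤ T, |q n t i - Y t i| ≤ ε

/-- The states found by the tasks that arrive shortly after time `t₀`, for large systems: a
property holds eventually if, on a right neighbourhood of `t₀`, it holds for the states found by
all the arrivals to all the large systems. -/
def windowFilter (F : Filter ℕ+) (c : ℕ → ℝ≥0 → ℕ) (q : ℕ+ → ℝ≥0 → ℕ → ℝ) (t₀ : ℝ≥0) :
    Filter (ℕ → ℝ) where
  sets := {V | ∀ᶠ s in 𝓝[>] t₀, ∀ᶠ n : ℕ+ in F, ∀ j, c 0 ((n : ℕ) * t₀) ≤ j →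
    j < c 0 ((n : ℕ) * s) → foundState n c (q n) j ∈ V}
  univ_sets := by simp
  sets_of_superset := by
    intro V W hV hVW
    rw [mem_ofPred_eq] at hV ⊢
    filter_upwards [hV] with s hs
    filter_upwards [hs] with n hn j h1 h2
    exact hVW (hn j h1 h2)
  inter_sets := by
    intro V W hV hW
    rw [mem_ofPred_eq] at hV hW ⊢
    filter_upwards [hV, hW] with s hs hs'
    filter_upwards [hs, hs'] with n hn hn' j h1 h2
    exact ⟨hn j h1 h2, hn' j h1 h2⟩

theorem eventually_windowFilter {F : Filter ℕ+} {c : ℕ → ℝ≥0 → ℕ} {q : ℕ+ → ℝ≥0 → ℕ → ℝ}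
    {t₀ : ℝ≥0} {p : (ℕ → ℝ) → Prop} : (∀ᶠ z in windowFilter F c q t₀, p z) ↔
      ∀ᶠ s in 𝓝[>] t₀, ∀ᶠ n : ℕ+ in F, ∀ j, c 0 ((n : ℕ) * t₀) ≤ j →
        j < c 0 ((n : ℕ) * s) → p (foundState n c (q n) j) := Iff.rfl

/-- An inequality between the increments to the right of a point passes to the derivatives. -/
theorem HasDerivAt.le_mul_of_right {f g : ℝ → ℝ} {f' g' t κ : ℝ} (hf : HasDerivAt f f' t)
    (hg : HasDerivAt g g' t) (h : ∀ᶠ s in 𝓝[>] t, f s - f t ≤ κ * (g s - g t)) :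
    f' ≤ κ * g' := by
  have hle : 𝓝[>] t ≤ 𝓝[≠] t := nhdsWithin_mono _ fun s hs => ne_of_gt hs
  have h1 := (hasDerivAt_iff_tendsto_slope.1 hf).mono_left hle
  have h2 := ((hasDerivAt_iff_tendsto_slope.1 hg).mono_left hle).const_mul κ
  refine le_of_tendsto_of_tendsto h1 h2 ?_
  filter_upwards [h, self_mem_nhdsWithin] with s hs hts
  have hpos : 0 < s - t := sub_pos.2 hts
  rw [slope_def_field, slope_def_field, ← mul_div_assoc]
  exact div_le_div_of_nonneg_right hs hpos.le

theorem HasDerivAt.mul_le_of_right {f g : ℝ → ℝ} {f' g' t κ : ℝ} (hf : HasDerivAt f f' t)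
    (hg : HasDerivAt g g' t) (h : ∀ᶠ s in 𝓝[>] t, κ * (g s - g t) ≤ f s - f t) :
    κ * g' ≤ f' := by
  have := HasDerivAt.le_mul_of_right hf.neg hg (κ := -κ) (by
    filter_upwards [h] with s hs
    simp only [Pi.neg_apply]
    linarith)
  linarith

theorem tendsto_toNNReal_nhdsGT {t₀ : ℝ≥0} :
    Tendsto Real.toNNReal (𝓝[>] (t₀ : ℝ)) (𝓝[>] t₀) := by
  refine tendsto_nhdsWithin_iff.2 ⟨?_, ?_⟩
  · have := (continuous_real_toNNReal.tendsto (t₀ : ℝ)).mono_left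
      (nhdsWithin_le_nhds (s := Ioi (t₀ : ℝ)))
    rwa [Real.toNNReal_coe] at this
  · filter_upwards [self_mem_nhdsWithin] with s hs
    exact Real.lt_toNNReal_iff_coe_lt.2 hs

theorem hasDerivAt_mul_toNNReal (lam : ℝ) {t₀ : ℝ≥0} (h0 : 0 < t₀) :
    HasDerivAt (fun s : ℝ => lam * (s.toNNReal : ℝ)) lam t₀ := by
  have h1 : HasDerivAt (fun s : ℝ => lam * s) lam t₀ := by
    simpa using (hasDerivAt_id (t₀ : ℝ)).const_mul lam
  refine h1.congr_of_eventuallyEq ?_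
  filter_upwards [lt_mem_nhds (show (0 : ℝ) < t₀ from h0)] with s hs
  rw [Real.coe_toNNReal _ hs.le]

namespace IsRegularSample

variable {ℓ : ℕ} {lam : ℝ≥0} {c : ℕ → ℝ≥0 → ℕ} {u : ℕ → ℝ} {z₀ : ℕ+ → ℕ → ℝ}
  {q : ℕ+ → ℝ≥0 → ℕ → ℝ} {F : Filter ℕ+} {T : ℝ≥0} {Y : ℝ≥0 → ℕ → ℝ}

theorem tendsto_path (hY : IsUniformLimit F T q Y) {t : ℝ≥0} (ht : t ≤ T) (i : ℕ) :
    Tendsto (fun n => q n t i) F (𝓝 (Y t i)) := by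
  rw [Metric.tendsto_nhds]
  intro ε hε
  filter_upwards [hY.close i (ε / 2) (by positivity)] with n hn
  rw [Real.dist_eq]
  linarith [hn t ht]

theorem tendsto_scaledClock (h : IsRegularSample ℓ lam c u z₀ q) (hY : IsUniformLimit F T q Y)
    {t : ℝ≥0} (ht : t ≤ T) (i : ℕ) :
    Tendsto (fun n => scaledClock (q n) i t) F (𝓝 (scaledClock Y i t)) := by
  rw [Metric.tendsto_nhds]
  intro ε hε
  set δ : ℝ := ε / (2 * i * T + 1) with hδ
  have hδ0 : 0 < δ := by positivity
  filter_upwards [hY.close i (δ / 2) (by positivity), hY.close (i + 1) (δ / 2) (by positivity)]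
    with n h1 h2
  have hint := intervalIntegrable_departureRate (h.driven n).path.isCadlag (h.driven n).path.mem i
    0 t
  have hcont : Continuous fun s : ℝ => (i : ℝ) * (Y s.toNNReal i - Y s.toNNReal (i + 1)) :=
    continuous_const.mul (((hY.continuous i).comp continuous_real_toNNReal).sub
      ((hY.continuous (i + 1)).comp continuous_real_toNNReal))
  have hb : ‖∫ s in (0 : ℝ)..t, ((i : ℝ) * (q n s.toNNReal i - q n s.toNNReal (i + 1))
      - (i : ℝ) * (Y s.toNNReal i - Y s.toNNReal (i + 1)))‖ ≤ (i * δ) * |(t : ℝ) - 0| := by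
    refine intervalIntegral.norm_integral_le_of_norm_le_const fun s hs => ?_
    rw [uIoc_of_le t.coe_nonneg] at hs
    have hsT : s.toNNReal ≤ T := (Real.toNNReal_le_iff_le_coe.2 hs.2).trans ht
    have h3 := abs_le.1 (h1 _ hsT)
    have h4 := abs_le.1 (h2 _ hsT)
    rw [← mul_sub, Real.norm_eq_abs, abs_mul, Nat.abs_cast]
    gcongr
    rw [abs_le]
    constructor <;> linarith
  rw [intervalIntegral.integral_sub hint (hcont.intervalIntegrable _ _), sub_zero,
    abs_of_nonneg t.coe_nonneg] at hb
  rw [dist_eq_norm]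
  refine hb.trans_lt ?_
  have htT : (t : ℝ) ≤ T := ht
  have h5 : (2 * i * T + 1) * δ = ε := by rw [hδ]; field_simp
  have h6 : (i : ℝ) * δ * t ≤ i * δ * T := by gcongr
  have h7 : 0 ≤ (i : ℝ) * δ * T := by positivity
  nlinarith

/-- The scaled arrivals to each level converge, since the paths and the scaled departures do. -/
theorem tendsto_arrivals (h : IsRegularSample ℓ lam c u z₀ q) (hY : IsUniformLimit F T q Y)
    {t : ℝ≥0} (ht : t ≤ T) {i : ℕ} (hi : i ≠ 0) :
    Tendsto (fun n : ℕ+ => scaledSum n (c 0)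
      (fun j => routing ℓ (u j) (foundState n c (q n) j) i) t) F (𝓝 (limitArrivals Y i t)) := by
  have h1 : Tendsto (fun n : ℕ+ => scaledDepartures c q n i t - scaledClock (q n) i t) F
      (𝓝 0) := by
    rw [Metric.tendsto_nhds]
    intro ε hε
    filter_upwards [hY.le_atTop (h.scaledDepartures_close hi T (half_pos hε))] with n hn
    rw [Real.dist_eq, sub_zero]
    linarith [hn t ht]
  have h2 := (((tendsto_path hY ht i).sub (tendsto_path hY (zero_le (a := T)) i)).add h1).add
    (h.tendsto_scaledClock hY ht i)
  rw [add_zero] at h2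
  refine h2.congr fun n => ?_
  rw [h.balance n t hi]
  ring

theorem tendsto_allArrivals (h : IsRegularSample ℓ lam c u z₀ q) (hY : IsUniformLimit F T q Y)
    {t : ℝ≥0} (ht : t ≤ T) :
    Tendsto (fun n : ℕ+ => scaledSum n (c 0) (fun _ => 1) t) F (𝓝 (lam * t)) := by
  rw [Metric.tendsto_nhds]
  intro ε hε
  filter_upwards [hY.le_atTop (h.scaledArrivals_close T (half_pos hε))] with n hn
  rw [Real.dist_eq]
  linarith [hn t ht]

theorem foundState_mem (h : IsRegularSample ℓ lam c u z₀ q) (n : ℕ+) (j : ℕ) :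
    foundState n c (q n) j ∈ occupancySet := (h.driven n).leftLim_mem_occupancySet _

/-- The tasks that find a saturated state are those that are not sent to any of the first `ℓ + 1`
levels, so their scaled number converges as well. -/
theorem tendsto_saturated (h : IsRegularSample ℓ lam c u z₀ q) (hY : IsUniformLimit F T q Y)
    {t : ℝ≥0} (ht : t ≤ T) :
    Tendsto (fun n : ℕ+ => scaledSum n (c 0)
      (fun j => saturated ℓ (foundState n c (q n) j)) t) F (𝓝 (limitSaturated lam ℓ Y t)) := by
  have h1 := (h.tendsto_allArrivals hY ht).sub (tendsto_finsetSum (Finset.Icc 1 (ℓ + 1))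
    fun i hi => h.tendsto_arrivals hY ht (i := i) (by have := Finset.mem_Icc.1 hi; omega))
  refine h1.congr fun n => ?_
  simp only [scaledSum]
  rw [← Finset.mul_sum, ← mul_sub, Finset.sum_comm, ← Finset.sum_sub_distrib]
  congr 1
  refine Finset.sum_congr rfl fun j _ => ?_
  rw [sum_routing (h.selection_mem j) (h.foundState_mem n j), saturated]
  split_ifs <;> simp

/-- Among the selected tasks, those with a selection variable in `[a, b)` make up the fraction that
is the length of this interval, cut off to `[0, 1)`. -/
theorem tendsto_selected (h : IsRegularSample ℓ lam c u z₀ q) (hF : F ≤ atTop)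
    {w : ℕ+ → ℕ → ℝ} (hw : SelectionLLN u w) {t : ℝ≥0} {W : ℝ}
    (hW : Tendsto (fun n : ℕ+ => scaledSum n (c 0) (w n) t) F (𝓝 W)) {a b : ℝ} (hab : a ≤ b) :
    Tendsto (fun n : ℕ+ => scaledSum n (c 0) (fun j => w n j * indIco a b (u j)) t) F
      (𝓝 ((unitClamp b - unitClamp a) * W)) := by
  have hzero : ∀ x, Tendsto (fun n : ℕ+ => scaledSum n (c 0)
      (fun j => w n j * centredBelow x (u j)) t) F (𝓝 0) := by
    intro x
    obtain ⟨K, hK⟩ := exists_nat_ge ((lam : ℝ) * t + 1)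
    rw [Metric.tendsto_nhds]
    intro ε hε
    filter_upwards [hF (hw x (ε / 2) (half_pos hε) K), hF (h.scaledArrivals_close t one_pos)]
      with n h1 h2
    have hn : (0 : ℝ) < ((n : ℕ) : ℝ) := by exact_mod_cast n.pos
    have h3 := (abs_le.1 (h2 t le_rfl)).2
    have h4 : c 0 ((n : ℕ) * t) ≤ K * (n : ℕ) := by
      have h5 : scaledSum n (c 0) (fun _ => 1) t ≤ K := by linarith
      simp only [scaledSum, Finset.sum_const, Finset.card_range, nsmul_eq_mul, mul_one,
        one_div_mul_eq_div] at h5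
      rw [div_le_iff₀ hn] at h5
      exact_mod_cast h5
    have h6 := h1 _ h4
    rw [dist_zero_right, Real.norm_eq_abs, scaledSum, abs_mul, abs_of_pos (by positivity),
      one_div_mul_eq_div, div_lt_iff₀ hn]
    nlinarith
  have h1 := ((hzero b).sub (hzero a)).add (hW.const_mul (unitClamp b - unitClamp a))
  rw [sub_zero, zero_add] at h1
  refine h1.congr fun n => ?_
  simp only [scaledSum]
  rw [← mul_sub, ← Finset.sum_sub_distrib, mul_left_comm, ← mul_add, Finset.mul_sum,
    ← Finset.sum_add_distrib]
  congr 1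
  refine Finset.sum_congr rfl fun j _ => ?_
  rw [indIco_eq hab]
  ring

/-! ### States found in a short time window -/

/-- Tasks that arrive to large systems shortly after `t₀` find states close to `Y t₀`, since the paths
are uniformly close to the continuous path `Y`. -/
theorem tendsto_window (h : IsRegularSample ℓ lam c u z₀ q) (hY : IsUniformLimit F T q Y)
    {t₀ : ℝ≥0} (ht₀ : t₀ < T) (i : ℕ) :
    Tendsto (fun z : ℕ → ℝ => z i) (windowFilter F c q t₀) (𝓝 (Y t₀ i)) := by
  rw [Metric.tendsto_nhds]
  intro ε hε
  have h1 : ∀ᶠ s in 𝓝 t₀, |Y s i - Y t₀ i| < ε / 3 := by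
    have := Metric.tendsto_nhds.1 ((hY.continuous i).tendsto t₀) (ε / 3) (by positivity)
    simpa only [Real.dist_eq] using this
  obtain ⟨v, hv, hsub⟩ := (mem_nhdsGE_iff_exists_Ico_subset).1 (nhdsWithin_le_nhds h1)
  rw [eventually_windowFilter]
  filter_upwards [Ioo_mem_nhdsGT (lt_min hv ht₀)] with s hs
  filter_upwards [hY.close i (ε / 3) (by positivity)] with n hn j hj1 hj2
  set σ := jumpTime (fun s => c 0 ((n : ℕ) * s)) (j + 1) with hσ
  have hlt : t₀ < σ := by
    rw [← not_le, h.arrivals.jumpTime_mul_le_iff (h.driven n).lam_pos n.pos]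
    omega
  have hle : σ ≤ s := by
    rw [h.arrivals.jumpTime_mul_le_iff (h.driven n).lam_pos n.pos]
    omega
  have hnear : ∀ r, t₀ ≤ r → r ≤ σ → |q n r i - Y t₀ i| ≤ 2 * (ε / 3) := by
    intro r hr1 hr2
    have hrs : r < min v T := (hr2.trans hle).trans_lt hs.2
    have h2 : |Y r i - Y t₀ i| < ε / 3 := hsub ⟨hr1, hrs.trans_le (min_le_left _ _)⟩
    have h3 := hn r (hrs.trans_le (min_le_right _ _)).le
    have h4 := abs_sub_le (q n r i) (Y r i) (Y t₀ i)
    linarith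
  have hclosed : IsClosed {z : ℕ → ℝ | |z i - Y t₀ i| ≤ 2 * (ε / 3)} :=
    isClosed_le ((continuous_apply i).sub continuous_const).abs continuous_const
  have hfound : foundState n c (q n) j ∈ {z : ℕ → ℝ | |z i - Y t₀ i| ≤ 2 * (ε / 3)} := by
    refine leftLim_mem hclosed σ (hnear σ hlt.le le_rfl) ?_
    filter_upwards [Ioo_mem_nhdsLT hlt] with r hr
    exact hnear r hr.1.le hr.2.le
  have hfound' : |foundState n c (q n) j i - Y t₀ i| ≤ 2 * (ε / 3) := hfound
  rw [Real.dist_eq]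
  linarith

/-- The rate of a stream of tasks. Suppose that a task with selection variable `v` that finds the
state `z` belongs to the stream if it belongs to a stream `ω z` that does not depend on `v`, and if
`v` is in an interval that is close to `[α, β)` for tasks that arrive shortly after `t₀`. Then the
rate of the stream at time `t₀` is the rate of the stream `ω` times `β - α`. -/
theorem rate_eq [F.NeBot] (h : IsRegularSample ℓ lam c u z₀ q) (hF : F ≤ atTop)
    {ρ : ℝ → (ℕ → ℝ) → ℝ} {ω : (ℕ → ℝ) → ℝ}
    (hω : SelectionLLN u fun n j => ω (foundState n c (q n) j)) {A W : ℝ≥0 → ℝ}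
    (hA : ∀ t ≤ T, Tendsto (fun n : ℕ+ => scaledSum n (c 0)
      (fun j => ρ (u j) (foundState n c (q n) j)) t) F (𝓝 (A t)))
    (hW : ∀ t ≤ T, Tendsto (fun n : ℕ+ => scaledSum n (c 0)
      (fun j => ω (foundState n c (q n) j)) t) F (𝓝 (W t)))
    {t₀ : ℝ≥0} (ht₀ : t₀ < T) {α β : ℝ} (hα : 0 ≤ α) (hαβ : α ≤ β) (hβ : β ≤ 1)
    (hlow : ∀ ε > 0, ∀ᶠ z in windowFilter F c q t₀, ∀ v ∈ Ico (0 : ℝ) 1,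
      ω z * indIco (α + ε) (β - ε) v ≤ ρ v z)
    (hupp : ∀ ε > 0, ∀ᶠ z in windowFilter F c q t₀, ∀ v ∈ Ico (0 : ℝ) 1,
      ρ v z ≤ ω z * indIco (α - ε) (β + ε) v)
    {A' W' : ℝ} (hA' : HasDerivAt (fun s : ℝ => A s.toNNReal) A' t₀)
    (hW' : HasDerivAt (fun s : ℝ => W s.toNNReal) W' t₀) : A' = (β - α) * W' := by
  have hT : ∀ᶠ s in 𝓝[>] t₀, t₀ < s ∧ s ≤ T := by
    filter_upwards [Ioo_mem_nhdsGT ht₀] with s hs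
    exact ⟨hs.1, hs.2.le⟩
  have hupper : ∀ ε > 0, A' ≤ (unitClamp (β + ε) - unitClamp (α - ε)) * W' := by
    intro ε hε
    refine HasDerivAt.le_mul_of_right hA' hW' (tendsto_toNNReal_nhdsGT.eventually
      (p := fun s => A s - A (t₀ : ℝ).toNNReal ≤ (unitClamp (β + ε) - unitClamp (α - ε))
        * (W s - W (t₀ : ℝ).toNNReal)) ?_)
    filter_upwards [hT, eventually_windowFilter.1 (hupp ε hε)] with s hs hev
    rw [Real.toNNReal_coe, mul_sub]
    have hsel := fun t (ht : t ≤ T) =>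
      h.tendsto_selected hF hω (hW t ht) (show α - ε ≤ β + ε by linarith)
    refine le_of_tendsto_of_tendsto ((hA s hs.2).sub (hA t₀ ht₀.le))
      ((hsel s hs.2).sub (hsel t₀ ht₀.le)) ?_
    filter_upwards [hev] with n hn
    exact h.scaledSum_sub_le n hs.1.le fun j h1 h2 => hn j h1 h2 _ (h.selection_mem j)
  -- the maximum keeps the interval nonreversed if `ε` is large
  have hlower : ∀ ε > 0, (unitClamp (max (α + ε) (β - ε)) - unitClamp (α + ε)) * W' ≤ A' := by
    intro ε hε
    refine HasDerivAt.mul_le_of_right hA' hW' (tendsto_toNNReal_nhdsGT.eventually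
      (p := fun s => (unitClamp (max (α + ε) (β - ε)) - unitClamp (α + ε))
        * (W s - W (t₀ : ℝ).toNNReal) ≤ A s - A (t₀ : ℝ).toNNReal) ?_)
    filter_upwards [hT, eventually_windowFilter.1 (hlow ε hε)] with s hs hev
    rw [Real.toNNReal_coe, mul_sub]
    have hsel := fun t (ht : t ≤ T) =>
      h.tendsto_selected hF hω (hW t ht) (le_max_left (α + ε) (β - ε))
    refine le_of_tendsto_of_tendsto ((hsel s hs.2).sub (hsel t₀ ht₀.le))
      ((hA s hs.2).sub (hA t₀ ht₀.le)) ?_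
    filter_upwards [hev] with n hn
    refine h.scaledSum_sub_le n hs.1.le fun j h1 h2 => ?_
    have heq : indIco (α + ε) (max (α + ε) (β - ε)) (u j) = indIco (α + ε) (β - ε) (u j) := by
      rcases le_total (α + ε) (β - ε) with hc | hc
      · rw [max_eq_right hc]
      · rw [max_eq_left hc, indIco_of_le le_rfl, indIco_of_le hc]
    rw [heq]
    exact hn j h1 h2 _ (h.selection_mem j)
  have hcl := continuous_unitClamp
  have hlim1 : Tendsto (fun ε : ℝ => (unitClamp (β + ε) - unitClamp (α - ε)) * W') (𝓝[>] 0)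
      (𝓝 ((β - α) * W')) := by
    have hc : Continuous fun ε : ℝ => (unitClamp (β + ε) - unitClamp (α - ε)) * W' := by fun_prop
    have := (hc.tendsto 0).mono_left (nhdsWithin_le_nhds (s := Ioi 0))
    simpa [unitClamp_of_mem hα (hαβ.trans hβ), unitClamp_of_mem (hα.trans hαβ) hβ] using this
  have hlim2 : Tendsto (fun ε : ℝ => (unitClamp (max (α + ε) (β - ε)) - unitClamp (α + ε)) * W')
      (𝓝[>] 0) (𝓝 ((β - α) * W')) := by
    have hc : Continuous fun ε : ℝ =>
        (unitClamp (max (α + ε) (β - ε)) - unitClamp (α + ε)) * W' := by fun_prop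
    have := (hc.tendsto 0).mono_left (nhdsWithin_le_nhds (s := Ioi 0))
    simpa [unitClamp_of_mem hα (hαβ.trans hβ), unitClamp_of_mem (hα.trans hαβ) hβ,
      max_eq_right hαβ] using this
  refine le_antisymm (ge_of_tendsto hlim1 ?_) (le_of_tendsto hlim2 ?_)
  · filter_upwards [self_mem_nhdsWithin] with ε hε
    exact hupper ε hε
  · filter_upwards [self_mem_nhdsWithin] with ε hε
    exact hlower ε hε

/-- A stream of tasks has rate zero at `t₀` if it is empty shortly after `t₀`. -/
theorem rate_eq_zero [F.NeBot] (h : IsRegularSample ℓ lam c u z₀ q) (hY : IsUniformLimit F T q Y)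
    {ρ : ℝ → (ℕ → ℝ) → ℝ} {A : ℝ≥0 → ℝ}
    (hA : ∀ t ≤ T, Tendsto (fun n : ℕ+ => scaledSum n (c 0)
      (fun j => ρ (u j) (foundState n c (q n) j)) t) F (𝓝 (A t)))
    {t₀ : ℝ≥0} (h0 : 0 < t₀) (ht₀ : t₀ < T)
    (hzero : ∀ᶠ z in windowFilter F c q t₀, ∀ v ∈ Ico (0 : ℝ) 1, ρ v z = 0)
    {A' : ℝ} (hA' : HasDerivAt (fun s : ℝ => A s.toNNReal) A' t₀) : A' = 0 := by
  have := h.rate_eq hY.le_atTop (ω := fun _ => 1) (W := fun t => lam * t) h.selection_all hA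
    (fun t ht => h.tendsto_allArrivals hY ht) ht₀ le_rfl le_rfl zero_le_one
    (fun ε hε => by
      filter_upwards [hzero] with z hz v hv
      rw [hz v hv, indIco_of_le (by linarith), mul_zero])
    (fun ε hε => by
      filter_upwards [hzero] with z hz v hv
      rw [hz v hv, one_mul]
      exact indIco_nonneg _ _ _) hA' (hasDerivAt_mul_toNNReal lam h0)
  simpa using this

end IsRegularSample

/-! ### The fluid dynamics of limit points -/

/-- If the first `m` coordinates of a state are `1`, then departures only change the last one. -/
theorem sum_departures_of_full {z d : ℕ → ℝ} {m : ℕ} (hz : ∀ i, 1 ≤ i → i ≤ m → z i = 1)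
    (hd : ∀ i, 1 ≤ i → i ≤ m → d i = 0) :
    ∑ i ∈ Finset.Icc 1 m, (d i + (i : ℝ) * (z i - z (i + 1))) = m * (1 - z (m + 1)) := by
  rcases m with _ | m
  · simp
  · rw [Finset.sum_Icc_succ_top (by omega), Finset.sum_eq_zero, hd _ (by omega) le_rfl,
      hz (m + 1) (by omega) le_rfl]
    · ring
    · intro i hi
      rw [Finset.mem_Icc] at hi
      rw [hd i hi.1 (by omega), hz i hi.1 (by omega), hz (i + 1) (by omega) (by omega)]
      ring

namespace IsRegularSample

variable {ℓ : ℕ} {lam : ℝ≥0} {c : ℕ → ℝ≥0 → ℕ} {u : ℕ → ℝ} {z₀ : ℕ+ → ℕ → ℝ}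
  {q : ℕ+ → ℝ≥0 → ℕ → ℝ} {F : Filter ℕ+} {T : ℝ≥0} {Y : ℝ≥0 → ℕ → ℝ}

theorem hasDerivAt_scaledClock (hY : IsUniformLimit F T q Y) (i : ℕ) {t₀ : ℝ≥0} (h0 : 0 < t₀) :
    HasDerivAt (fun s : ℝ => scaledClock Y i s.toNNReal) (i * (Y t₀ i - Y t₀ (i + 1))) t₀ := by
  have hcont : Continuous fun s : ℝ => (i : ℝ) * (Y s.toNNReal i - Y s.toNNReal (i + 1)) :=
    continuous_const.mul (((hY.continuous i).comp continuous_real_toNNReal).sub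
      ((hY.continuous (i + 1)).comp continuous_real_toNNReal))
  have h1 := intervalIntegral.integral_hasDerivAt_right (hcont.intervalIntegrable 0 (t₀ : ℝ))
    (hcont.stronglyMeasurableAtFilter _ _) hcont.continuousAt
  simp only [Real.toNNReal_coe] at h1
  refine h1.congr_of_eventuallyEq ?_
  filter_upwards [lt_mem_nhds (show (0 : ℝ) < t₀ from h0)] with s hs
  rw [scaledClock, Real.coe_toNNReal _ hs.le]

theorem hasDerivAt_limitArrivals (hY : IsUniformLimit F T q Y) (i : ℕ) {t₀ : ℝ≥0} (h0 : 0 < t₀)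
    {d : ℝ} (hd : HasDerivAt (fun s : ℝ => Y s.toNNReal i) d t₀) :
    HasDerivAt (fun s : ℝ => limitArrivals Y i s.toNNReal)
      (d + i * (Y t₀ i - Y t₀ (i + 1))) t₀ :=
  (hd.sub_const (Y 0 i)).add (hasDerivAt_scaledClock hY i h0)

theorem hasDerivAt_limitSaturated (hY : IsUniformLimit F T q Y) {t₀ : ℝ≥0} (h0 : 0 < t₀)
    {d : ℕ → ℝ} (hd : ∀ i, HasDerivAt (fun s : ℝ => Y s.toNNReal i) (d i) t₀) :
    HasDerivAt (fun s : ℝ => limitSaturated lam ℓ Y s.toNNReal)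
      (lam - ∑ i ∈ Finset.Icc 1 (ℓ + 1), (d i + i * (Y t₀ i - Y t₀ (i + 1)))) t₀ :=
  (hasDerivAt_mul_toNNReal lam h0).sub
    (HasDerivAt.fun_sum fun i _ => hasDerivAt_limitArrivals hY i h0 (hd i))

theorem eventually_window_lt (h : IsRegularSample ℓ lam c u z₀ q) (hY : IsUniformLimit F T q Y)
    {t₀ : ℝ≥0} (ht₀ : t₀ < T) {i : ℕ} (hi : Y t₀ i < 1) :
    ∀ᶠ z in windowFilter F c q t₀, z i < 1 :=
  (h.tendsto_window hY ht₀ i).eventually_lt_const hi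

/-- While a fraction of the pools has at most `ℓ` tasks, every task finds such a pool. -/
theorem rate_saturated_eq_zero [F.NeBot] (h : IsRegularSample ℓ lam c u z₀ q)
    (hY : IsUniformLimit F T q Y) {t₀ : ℝ≥0} (h0 : 0 < t₀) (ht₀ : t₀ < T)
    (hlt : Y t₀ (ℓ + 1) < 1) {W' : ℝ}
    (hW' : HasDerivAt (fun s : ℝ => limitSaturated lam ℓ Y s.toNNReal) W' t₀) : W' = 0 := by
  refine h.rate_eq_zero hY (ρ := fun _ z => saturated ℓ z)
    (fun t ht => h.tendsto_saturated hY ht) h0 ht₀ ?_ hW'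
  filter_upwards [h.eventually_window_lt hY ht₀ hlt] with z hz v _
  rw [saturated, if_neg hz.ne]

/-- Tasks that find no pool with at most `ℓ` tasks choose among all the pools uniformly. -/
theorem rate_above [F.NeBot] (h : IsRegularSample ℓ lam c u z₀ q) (hY : IsUniformLimit F T q Y)
    {t₀ : ℝ≥0} (ht₀ : t₀ < T) (hmem : Y t₀ ∈ occupancySet) {i : ℕ} (hi : ℓ + 2 ≤ i)
    {A' W' : ℝ} (hA' : HasDerivAt (fun s : ℝ => limitArrivals Y i s.toNNReal) A' t₀)
    (hW' : HasDerivAt (fun s : ℝ => limitSaturated lam ℓ Y s.toNNReal) W' t₀) :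
    A' = (Y t₀ (i - 1) - Y t₀ i) * W' := by
  have hrout : ∀ v z, routing ℓ v z i
      = saturated ℓ z * indIco (1 - z (i - 1)) (1 - z i) v := by
    intro v z
    rw [routing, if_neg (by omega), if_neg (by omega), saturated, indIco, intervalI]
    by_cases h1 : z (ℓ + 1) = 1 <;> by_cases h2 : v ∈ Ico (1 - z (i - 1)) (1 - z i) <;>
      simp [h1, h2]
  have hsat : ∀ z, 0 ≤ saturated ℓ z := by
    intro z
    unfold saturated
    split_ifs <;> simp
  have hclose : ∀ k, ∀ ε > 0, ∀ᶠ z in windowFilter F c q t₀, |z k - Y t₀ k| < ε := by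
    intro k ε hε
    simpa only [Real.dist_eq] using Metric.tendsto_nhds.1 (h.tendsto_window hY ht₀ k) ε hε
  have hres := h.rate_eq hY.le_atTop (ρ := fun v z => routing ℓ v z i) (ω := saturated ℓ)
    h.selection_saturated (fun t ht => h.tendsto_arrivals hY ht (by omega))
    (fun t ht => h.tendsto_saturated hY ht) ht₀ (α := 1 - Y t₀ (i - 1)) (β := 1 - Y t₀ i)
    (by linarith [occupancy_le_one hmem (i - 1)])
    (by linarith [occupancy_antitone hmem (Nat.sub_le i 1)])
    (by linarith [occupancy_nonneg hmem i])
    (fun ε hε => by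
      filter_upwards [hclose (i - 1) ε hε, hclose i ε hε] with z h1 h2 v _
      rw [abs_lt] at h1 h2
      rw [hrout]
      refine mul_le_mul_of_nonneg_left (indIco_mono ?_ ?_ v) (hsat z) <;> linarith)
    (fun ε hε => by
      filter_upwards [hclose (i - 1) ε hε, hclose i ε hε] with z h1 h2 v _
      rw [abs_lt] at h1 h2
      rw [hrout]
      refine mul_le_mul_of_nonneg_left (indIco_mono ?_ ?_ v) (hsat z) <;> linarith) hA' hW'
  rw [hres]
  ring

/-- While a fraction of the pools has fewer than `ℓ` tasks, the tasks choose among those pools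
uniformly. -/
theorem rate_below [F.NeBot] (h : IsRegularSample ℓ lam c u z₀ q) (hY : IsUniformLimit F T q Y)
    {t₀ : ℝ≥0} (h0 : 0 < t₀) (ht₀ : t₀ < T) (hmem : Y t₀ ∈ occupancySet) (hlt : Y t₀ ℓ < 1) {i : ℕ}
    (hi : 1 ≤ i) (hiℓ : i ≤ ℓ) {A' : ℝ}
    (hA' : HasDerivAt (fun s : ℝ => limitArrivals Y i s.toNNReal) A' t₀) :
    A' = lam * ((Y t₀ (i - 1) - Y t₀ i) / (1 - Y t₀ ℓ)) := by
  have hpos : 0 < 1 - Y t₀ ℓ := by linarith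
  have hclose : ∀ k, ∀ ε > 0, ∀ᶠ z in windowFilter F c q t₀,
      |(1 - z k) / (1 - z ℓ) - (1 - Y t₀ k) / (1 - Y t₀ ℓ)| < ε := by
    intro k ε hε
    have h1 : Tendsto (fun z : ℕ → ℝ => (1 - z k) / (1 - z ℓ)) (windowFilter F c q t₀)
        (𝓝 ((1 - Y t₀ k) / (1 - Y t₀ ℓ))) := ((h.tendsto_window hY ht₀ k).const_sub 1).div
      ((h.tendsto_window hY ht₀ ℓ).const_sub 1) hpos.ne'
    simpa only [Real.dist_eq] using Metric.tendsto_nhds.1 h1 ε hε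
  have hrout : ∀ v z, z ℓ < 1 → routing ℓ v z i
      = indIco ((1 - z (i - 1)) / (1 - z ℓ)) ((1 - z i) / (1 - z ℓ)) v := by
    intro v z hz
    rw [routing, if_pos hiℓ, intervalJ, if_pos hz, indIco]
    congr
  have h1 := occupancy_antitone hmem (Nat.sub_le i 1)
  have h2 := occupancy_antitone hmem hiℓ
  have h3 := occupancy_le_one hmem (i - 1)
  have hres := h.rate_eq hY.le_atTop (ρ := fun v z => routing ℓ v z i) (ω := fun _ => 1)
    h.selection_all (fun t ht => h.tendsto_arrivals hY ht (by omega))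
    (W := fun t => lam * t) (fun t ht => h.tendsto_allArrivals hY ht) ht₀
    (α := (1 - Y t₀ (i - 1)) / (1 - Y t₀ ℓ)) (β := (1 - Y t₀ i) / (1 - Y t₀ ℓ))
    (div_nonneg (by linarith) hpos.le)
    (by gcongr)
    (by rw [div_le_one hpos]; linarith)
    (fun ε hε => by
      filter_upwards [hclose (i - 1) ε hε, hclose i ε hε, h.eventually_window_lt hY ht₀ hlt]
        with z h1 h2 hz v _
      rw [abs_lt] at h1 h2
      rw [hrout v z hz, one_mul]
      exact indIco_mono (by linarith) (by linarith) v)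
    (fun ε hε => by
      filter_upwards [hclose (i - 1) ε hε, hclose i ε hε, h.eventually_window_lt hY ht₀ hlt]
        with z h1 h2 hz v _
      rw [abs_lt] at h1 h2
      rw [hrout v z hz, one_mul]
      exact indIco_mono (by linarith) (by linarith) v) hA' (hasDerivAt_mul_toNNReal lam h0)
  rw [hres]
  field_simp
  ring

/-- While a fraction of the pools has fewer than `ℓ` tasks, no task is sent to a pool with exactly
`ℓ` tasks. -/
theorem rate_threshold_eq_zero [F.NeBot] (h : IsRegularSample ℓ lam c u z₀ q)
    (hY : IsUniformLimit F T q Y) {t₀ : ℝ≥0} (h0 : 0 < t₀) (ht₀ : t₀ < T) (hlt : Y t₀ ℓ < 1)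
    {A' : ℝ} (hA' : HasDerivAt (fun s : ℝ => limitArrivals Y (ℓ + 1) s.toNNReal) A' t₀) :
    A' = 0 := by
  refine h.rate_eq_zero hY (ρ := fun v z => routing ℓ v z (ℓ + 1))
    (fun t ht => h.tendsto_arrivals hY ht (by omega)) h0 ht₀ ?_ hA'
  filter_upwards [h.eventually_window_lt hY ht₀ hlt] with z hz v _
  simp [routing, hz.ne]

/-- The fluid dynamics hold at all the times where the limit is differentiable. A coordinate that
is `1` has derivative zero there, which determines the rates of the arrivals below the threshold
once these pools are full. -/
theorem fluid_dynamics [F.NeBot] (h : IsRegularSample ℓ lam c u z₀ q)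
    (hY : IsUniformLimit F T q Y) (hmem : ∀ t, Y t ∈ occupancySet) {t₀ : ℝ≥0} (h0 : 0 < t₀)
    (ht₀ : t₀ < T) {d : ℕ → ℝ} (hd : ∀ i, HasDerivAt (fun s : ℝ => Y s.toNNReal i) (d i) t₀)
    {i : ℕ} (hi : 1 ≤ i) :
    d i = lam * fluidP lam ℓ (Y t₀) i - i * (Y t₀ i - Y t₀ (i + 1)) := by
  have hlam : (0 : ℝ) < lam := (h.driven 1).lam_pos
  have hone : ∀ k, Y t₀ k = 1 → d k = 0 := by
    intro k hk
    refine IsLocalMax.hasDerivAt_eq_zero (Eventually.of_forall fun s => ?_) (hd k)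
    rw [Real.toNNReal_coe, hk]
    exact occupancy_le_one (hmem _) k
  have hle := occupancy_le_one (hmem t₀)
  have hanti := occupancy_antitone (hmem t₀)
  have hA := fun k => hasDerivAt_limitArrivals hY k h0 (hd k)
  have hW := hasDerivAt_limitSaturated (lam := lam) (ℓ := ℓ) hY h0 hd
  suffices hgoal : d i + i * (Y t₀ i - Y t₀ (i + 1)) = lam * fluidP lam ℓ (Y t₀) i by linarith
  unfold fluidP
  split_ifs with hℓ hiℓ hh hiℓ hih hih hih
  -- level `ℓ` is not full
  · exact h.rate_below hY h0 ht₀ (hmem t₀) hℓ hi hiℓ (hA i)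
  · have hh : Y t₀ (ℓ + 1) < 1 := (hanti (Nat.le_succ ℓ)).trans_lt hℓ
    have hW0 := h.rate_saturated_eq_zero hY h0 ht₀ hh hW
    rcases (show i = ℓ + 1 ∨ ℓ + 2 ≤ i by omega) with rfl | hi2
    · rw [h.rate_threshold_eq_zero hY h0 ht₀ hℓ (hA _), mul_zero]
    · rw [h.rate_above hY ht₀ (hmem t₀) hi2 (hA i) hW, hW0, mul_zero, mul_zero]
  all_goals
    have hfull : ∀ k ≤ ℓ, Y t₀ k = 1 := fun k hk =>
      le_antisymm (hle k) ((not_lt.1 hℓ).trans (hanti hk))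
  -- the levels up to `ℓ` are full, and level `ℓ + 1` is not
  · rw [hiℓ, hone ℓ (hfull ℓ le_rfl), hfull ℓ le_rfl]
    field_simp
    ring
  · have hW0 := h.rate_saturated_eq_zero hY h0 ht₀ hh hW
    rw [Finset.sum_Icc_succ_top (by omega), sum_departures_of_full (fun k _ hk => hfull k hk)
      (fun k _ hk => hone k (hfull k hk))] at hW0
    rw [hih]
    field_simp
    linarith
  · have hW0 := h.rate_saturated_eq_zero hY h0 ht₀ hh hW
    rcases (show i < ℓ ∨ ℓ + 2 ≤ i by omega) with hi1 | hi2
    · rw [hone i (hfull i hi1.le), hfull i hi1.le, hfull (i + 1) hi1]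
      ring
    · rw [h.rate_above hY ht₀ (hmem t₀) hi2 (hA i) hW, hW0, mul_zero, mul_zero]
  all_goals
    have hfull' : ∀ k ≤ ℓ + 1, Y t₀ k = 1 := fun k hk =>
      le_antisymm (hle k) ((not_lt.1 hh).trans (hanti hk))
  -- the levels up to `ℓ + 1` are full
  · rw [hih, hone _ (hfull' _ le_rfl), hfull' _ le_rfl]
    push_cast
    field_simp
    ring
  · rw [h.rate_above hY ht₀ (hmem t₀) hih (hA i) hW, sum_departures_of_full
      (fun k _ hk => hfull' k hk) (fun k _ hk => hone k (hfull' k hk))]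
    push_cast
    field_simp
  · rw [hone i (hfull' i (by omega)), hfull' i (by omega), hfull' (i + 1) (by omega)]
    ring

/-- Limits of subsequences of the system paths stay in the set of occupancy states, their coordinates
are Lipschitz, and they solve the fluid equations. -/
theorem limit_point (h : IsRegularSample ℓ lam c u z₀ q) {φ : ℕ → ℕ+} (hφ : StrictMono φ)
    {y : CadlagPath T} (hy : Tendsto (fun k => h.pathOn T (φ k)) atTop (𝓝 y)) :
    (∀ t, y.toFun t ∈ occupancySet) ∧
    (∀ i, ∃ K : ℝ≥0, LipschitzWith K fun t => y.toFun t i) ∧ SolvesFluidODE lam ℓ T y.extend := by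
  have hF : map φ atTop ≤ atTop := by
    refine tendsto_atTop_mono (f := fun k : ℕ => k.succPNat) (fun k => ?_)
      (tendsto_atTop_atTop.2 fun n => ⟨n, fun k hk => ?_⟩)
    · induction k with
      | zero => exact one_le
      | succ k ih => exact Nat.succ_le_of_lt (lt_of_le_of_lt ih (hφ (Nat.lt_succ_self k)))
    · exact (show (n : ℕ) ≤ k + 1 by omega)
  have hpath : Tendsto (h.pathOn T) (map φ atTop) (𝓝 y) := hy
  set Y : ℝ≥0 → ℕ → ℝ := fun t => y.extend t with hYdef
  have hYeq : ∀ t : Icc (0 : ℝ) T, Y (Real.toNNReal t) = y.toFun t := by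
    intro t
    simp only [hYdef, CadlagPath.extend, Real.coe_toNNReal _ t.2.1]
    exact IccExtend_of_mem _ _ t.2
  have hext : ∀ s : ℝ, y.extend s = Y s.toNNReal := by
    intro s
    simp only [hYdef, CadlagPath.extend]
    rcases le_total 0 s with hs | hs
    · rw [Real.coe_toNNReal _ hs]
    · rw [Real.toNNReal_of_nonpos hs, NNReal.coe_zero]
      exact congrArg y.toFun
        ((projIcc_of_le_left T.2 hs).trans (projIcc_of_le_left T.2 le_rfl).symm)
  have hclose : ∀ i, ∀ ε : ℝ, 0 < ε → ∀ᶠ n in map φ atTop, ∀ t ≤ T,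
      |q n t i - Y t i| ≤ ε := by
    intro i ε hε
    filter_upwards [eventually_coord_of_tendsto hpath i hε] with n hn t ht
    have h1 := hn ⟨t, t.2, ht⟩
    rw [← hYeq ⟨t, t.2, ht⟩] at h1
    simpa [pathOn] using h1
  have hptw : ∀ i, ∀ t ≤ T, Tendsto (fun n => q n t i) (map φ atTop) (𝓝 (Y t i)) := by
    intro i t ht
    rw [Metric.tendsto_nhds]
    intro ε hε
    filter_upwards [hclose i (ε / 2) (by positivity)] with n hn
    rw [Real.dist_eq]
    linarith [hn t ht]
  have hlipT := fun i => (h.uniform_of_pointwise hF (T := T) (i := i) (y := fun t => Y t i)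
    (hptw i)).1
  have hlip : ∀ i : ℕ, LipschitzWith (lam + (i : ℝ≥0)) fun t => y.toFun t i := by
    intro i
    refine LipschitzWith.of_dist_le_mul fun s t => ?_
    wlog hst : s ≤ t generalizing s t
    · rw [dist_comm, dist_comm s t]
      exact this t s (le_of_not_ge hst)
    have h1 := hlipT i (Real.toNNReal s) (Real.toNNReal t) (Real.toNNReal_le_toNNReal hst)
      (Real.toNNReal_le_iff_le_coe.2 t.2.2)
    rw [Real.coe_toNNReal _ s.2.1, Real.coe_toNNReal _ t.2.1, hYeq, hYeq] at h1
    have hst' : (s : ℝ) ≤ t := hst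
    rw [Real.dist_eq, Subtype.dist_eq, Real.dist_eq, abs_sub_comm, abs_sub_comm (s : ℝ),
      abs_of_nonneg (by linarith : (0 : ℝ) ≤ t - s)]
    push_cast
    exact h1
  have hlipR : ∀ i : ℕ, LipschitzWith (lam + (i : ℝ≥0)) fun s : ℝ => y.extend s i := fun i => by
    have := (hlip i).comp (LipschitzWith.projIcc (a := (0 : ℝ)) (b := T) T.2)
    rwa [mul_one] at this
  have hmemY : ∀ t : Icc (0 : ℝ) T, y.toFun t ∈ occupancySet := by
    intro t
    refine isClosed_occupancySet.mem_of_tendsto (b := map φ atTop)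
      (f := fun n => q n (Real.toNNReal t)) ?_ (Eventually.of_forall fun n => h.mem n _)
    rw [tendsto_pi_nhds, ← hYeq]
    exact fun i => hptw i _ (Real.toNNReal_le_iff_le_coe.2 t.2.2)
  have hmem : ∀ t, Y t ∈ occupancySet := fun t => hmemY _
  have hY : IsUniformLimit (map φ atTop) T q Y := by
    refine ⟨hF, fun i => ?_, hclose⟩
    exact (hlipR i).continuous.comp NNReal.continuous_coe
  refine ⟨hmemY, fun i => ⟨_, hlip i⟩, ?_⟩
  have hdiff : ∀ᵐ t : ℝ, ∀ i, DifferentiableAt ℝ (fun s => y.extend s i) t :=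
    ae_all_iff.2 fun i => (hlipR i).ae_differentiableAt_real
  -- the end points of `[0, T]` are excluded, as the extension may have corners there
  have hne : ∀ x : ℝ, ∀ᵐ t : ℝ, t ≠ x := fun x => by simp [ae_iff, measure_singleton]
  unfold SolvesFluidODE
  filter_upwards [ae_restrict_mem measurableSet_Icc, ae_restrict_of_ae hdiff,
    ae_restrict_of_ae (hne 0), ae_restrict_of_ae (hne T)] with t htmem htdiff ht0 htT i hi
  have h0 : 0 < t := lt_of_le_of_ne htmem.1 (Ne.symm ht0)
  have hT : t < T := lt_of_le_of_ne htmem.2 htT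
  lift t to ℝ≥0 using htmem.1
  have hd : ∀ k, HasDerivAt (fun s : ℝ => Y s.toNNReal k) (deriv (fun s => y.extend s k) t) t := by
    intro k
    have h1 := (htdiff k).hasDerivAt
    simp only [hext] at h1 ⊢
    exact h1
  have hres := h.fluid_dynamics hY hmem h0 hT hd hi
  rw [← hres]
  exact (htdiff i).hasDerivAt

end IsRegularSample

end FluidLimit

end

theorem mainTheorem1 {Ω : Type*} [MeasurableSpace Ω] (P : Measure Ω) [IsProbabilityMeasure P]
    (lam : ℝ≥0) (hlam : 0 < lam) (ℓ : ℕ) (T : ℝ≥0)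
    (N : ℕ → ℝ≥0 → Ω → ℕ) (U : ℕ → Ω → ℝ) (qinit : ℕ+ → Ω → ℕ → ℝ)
    (hprim : FluidLimit.IsPrimitives P lam N U qinit)
    (q : ℕ+ → ℝ≥0 → Ω → ℕ → ℝ)
    (hq : ∀ n : ℕ+, ∀ᵐ ω ∂P, FluidLimit.IsSystemPath n ℓ (fun i t => N i t ω)
      (fun j => U j ω) (qinit n ω) (fun t => q n t ω))
    (q0 : Ω → ℕ → ℝ) (hq0 : Measurable q0) (hq0_mem : ∀ ω, q0 ω ∈ FluidLimit.occupancySet)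
    (hinit : ∀ᵐ ω ∂P, Tendsto (fun n : ℕ+ => q n 0 ω) atTop (𝓝 (q0 ω))) :
    ∀ᵐ ω ∂P, ∃ x : ℕ+ → FluidLimit.CadlagPath T,
      (∀ (n : ℕ+) (t : Icc (0 : ℝ) T), (x n).toFun t = q n (Real.toNNReal t) ω) ∧
      IsCompact (closure (Set.range x)) ∧
      ∀ (φ : ℕ → ℕ+) (y : FluidLimit.CadlagPath T), StrictMono φ →
        Tendsto (fun k => x (φ k)) atTop (𝓝 y) →
          (∀ t, y.toFun t ∈ FluidLimit.occupancySet) ∧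
          (∀ i, ∃ K : ℝ≥0, LipschitzWith K (fun t => y.toFun t i)) ∧
          FluidLimit.SolvesFluidODE lam ℓ T y.extend := by
  filter_upwards [FluidLimit.ae_isRegularSample hlam hprim hq] with ω h
  exact ⟨h.pathOn T, fun _ _ => rfl, h.isCompact_closure_range_pathOn T,
    fun _ _ hφ hy => h.limit_point hφ hy⟩
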